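/- **Theorem 6.1.** Let $V$ be a real vector space of dimension $m\ge 8$, let $\langle\cdot,\cdot\rangle$ be a non-degenerate symmetric bilinear form on $V$ (of arbitrary signature), and let $A\in\otimes^4V^*$ be an algebraic curvature tensor, i.e. $A(x,y,z,w)=-A(y,x,z,w)=A(z,w,x,y)$ and $A(x,y,z,w)+A(y,z,x,w)+A(z,x,y,w)=0$. Let $\mathcal J=(J_1,J_2,J_3)$ be a triple of linear maps of $V$. A linear map $J$ of $V$ is called Hermitian if $J^2=-\mathrm{id}$ and $\langle Jx,Jy\rangle=\langle x,y\rangle$, and para Hermitian if $J^2=\mathrm{id}$ and $\langle Jx,Jy\rangle=-\langle x,y\rangle$. The triple $\mathcal J$ is a hyper Hermitian structure if $J_1,J_2,J_3$ are Hermitian and $J_1J_2=-J_2J_1=J_3$; it is a hyper para Hermitian structure if $J_1$ is Hermitian, $J_2,J_3$ are para Hermitian and $J_1J_2=-J_2J_1=J_3$. Then $(V,\langle\cdot,\cdot\rangle,\mathcal J,A)$ is called a hyper Hermitian (resp. hyper para Hermitian) curvature model. With $\varepsilon_{ij}=\langle e_i,e_j\rangle$ for a basis $\{e_i\}$ and $\varepsilon^{ij}$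 the inverse matrix, put (summing over repeated indices) $$\tau=\varepsilon^{il}\varepsilon^{jk}A(e_i,e_j,e_k,e_l),\qquad \tau^\star_{J}=\pm\,\varepsilon^{il}\varepsilon^{jk}A(e_i,e_j,Je_k,Je_l),\qquad \tau^\star_{\mathfrak Q}=\tau^\star_{J_1}+\tau^\star_{J_2}+\tau^\star_{J_3},$$ with sign $+$ if $J$ is Hermitian and $-$ if $J$ is para Hermitian. An almost hyper (para) Hermitian manifold $(M,g,\mathcal J)$ is a smooth (connected, Hausdorff, second countable) manifold $M$ with a smooth pseudo-Riemannian metric $g$ and three smooth fields $\mathcal J=(J_1,J_2,J_3)$ of endomorphisms of $TM$ that form a hyper (para) Hermitian structure on $(T_PM,g_P)$ for every $P\in M$; no integrability is imposed. Its curvature tensor is $R(x,y,z,w)=g(\mathcal R(x,y)z,w)$, where $\mathcal R(x,y)=\nabla_x\nabla_y-\nabla_y\nabla_x-\nabla_{[x,y]}$ and $\nabla$ is the Levi-Civita connection; its scalar curvature $\tau$ and its $\star$-scalar curvature $\tau^\star_{\mathfrak Q}$ at $P$ are those of $(T_PM,g_P,\mathcal J_P,R_P)$. 1. For every hyper Hermitian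 curvature model $(V,\langle\cdot,\cdot\rangle,\mathcal J,A)$ of dimension $m\ge8$ there exist an almost hyper Hermitian manifold $(M,g,\mathcal J^M)$ of dimension $m$ on which both $\tau$ and $\tau^\star_{\mathfrak Q}$ are constant, a point $P\in M$, and a linear isomorphism $\phi:V\to T_PM$ such that $\phi^*g_P=\langle\cdot,\cdot\rangle$, $\phi^*R_P=A$ and $\phi J_a=J^M_{a}(P)\,\phi$ for $a=1,2,3$. 2. For every hyper para Hermitian curvature model of dimension $m\ge8$ the same holds with an almost hyper para Hermitian manifold. -/

import Mathlib

open scoped Manifold ContDiff Bundle Matrix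

namespace CurvReal

/-! ### Curvature models -/

section Algebra

variable {V : Type*} [AddCommGroup V] [Module ℝ V]

/-- `A` is an algebraic curvature tensor on `V`: a 4-linear form with the symmetries of the
Riemann curvature tensor. -/
structure IsAlgebraicCurvatureTensor (A : V →ₗ[ℝ] V →ₗ[ℝ] V →ₗ[ℝ] V →ₗ[ℝ] ℝ) : Prop where
  antisymm : ∀ x y z w, A x y z w = -A y x z w
  pair_symm : ∀ x y z w, A x y z w = A z w x y
  bianchi : ∀ x y z w, A x y z w + A y z x w + A z x y w = 0

/-- `(V, B, A)` is a curvature model: `B` is a nondegenerate symmetric bilinear form (of arbitrary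
signature) and `A` is an algebraic curvature tensor. -/
structure IsCurvatureModel (B : LinearMap.BilinForm ℝ V)
    (A : V →ₗ[ℝ] V →ₗ[ℝ] V →ₗ[ℝ] V →ₗ[ℝ] ℝ) : Prop where
  symm : ∀ x y, B x y = B y x
  nondegenerate : ∀ x, (∀ y, B x y = 0) → x = 0
  curvature : IsAlgebraicCurvatureTensor A

/-- `J` is a Hermitian structure on `(V, B)`: `J² = -id` and `J^* B = B`. -/
structure IsHermitianStructure (B : LinearMap.BilinForm ℝ V) (J : V →ₗ[ℝ] V) : Prop where
  sq : ∀ x, J (J x) = -x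
  compat : ∀ x y, B (J x) (J y) = B x y

/-- `J` is a para Hermitian structure on `(V, B)`: `J² = id` and `J^* B = -B`. -/
structure IsParaHermitianStructure (B : LinearMap.BilinForm ℝ V) (J : V →ₗ[ℝ] V) : Prop where
  sq : ∀ x, J (J x) = x
  compat : ∀ x y, B (J x) (J y) = -B x y

/-- The triple `(J₁, J₂, J₃) = (J 0, J 1, J 2)` is a hyper Hermitian structure on `(V, B)`. -/
structure IsHyperHermitianStructure (B : LinearMap.BilinForm ℝ V) (J : Fin 3 → V →ₗ[ℝ] V) :
    Prop where
  hermitian : ∀ a, IsHermitianStructure B (J a)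
  mul : ∀ x, J 0 (J 1 x) = J 2 x
  mul_rev : ∀ x, J 1 (J 0 x) = -J 2 x

/-- The triple `(J₁, J₂, J₃) = (J 0, J 1, J 2)` is a hyper para Hermitian structure on
`(V, B)`. -/
structure IsHyperParaHermitianStructure (B : LinearMap.BilinForm ℝ V) (J : Fin 3 → V →ₗ[ℝ] V) :
    Prop where
  hermitian : IsHermitianStructure B (J 0)
  para_one : IsParaHermitianStructure B (J 1)
  para_two : IsParaHermitianStructure B (J 2)
  mul : ∀ x, J 0 (J 1 x) = J 2 x
  mul_rev : ∀ x, J 1 (J 0 x) = -J 2 x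

variable {ι : Type*} [Fintype ι] [DecidableEq ι]

/-- The inverse `ε^{ij}` of the matrix `ε_{ij} = B(e_i, e_j)`. -/
noncomputable def invGram (e : Module.Basis ι ℝ V) (B : LinearMap.BilinForm ℝ V) :
    Matrix ι ι ℝ :=
  (Matrix.of fun i j => B (e i) (e j))⁻¹

/-- The scalar curvature `τ = ε^{il} ε^{jk} A(e_i, e_j, e_k, e_l)`, computed in a basis. -/
noncomputable def scalarCurv (e : Module.Basis ι ℝ V) (B : LinearMap.BilinForm ℝ V)
    (A : V → V → V → V → ℝ) : ℝ :=
  ∑ i, ∑ j, ∑ k, ∑ l, invGram e B i l * invGram e B j k * A (e i) (e j) (e k) (e l)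

/-- The `⋆`-scalar curvature `τ⋆_J = ε^{il} ε^{jk} A(e_i, e_j, J e_k, J e_l)` of a Hermitian
structure `J`. -/
noncomputable def starScalarCurv (e : Module.Basis ι ℝ V) (B : LinearMap.BilinForm ℝ V)
    (A : V → V → V → V → ℝ) (J : V →ₗ[ℝ] V) : ℝ :=
  ∑ i, ∑ j, ∑ k, ∑ l, invGram e B i l * invGram e B j k * A (e i) (e j) (J (e k)) (J (e l))

/-- The `⋆`-scalar curvature `τ⋆_J = -ε^{il} ε^{jk} A(e_i, e_j, J e_k, J e_l)` of a para Hermitian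
structure `J`. -/
noncomputable def paraStarScalarCurv (e : Module.Basis ι ℝ V) (B : LinearMap.BilinForm ℝ V)
    (A : V → V → V → V → ℝ) (J : V →ₗ[ℝ] V) : ℝ :=
  -∑ i, ∑ j, ∑ k, ∑ l, invGram e B i l * invGram e B j k * A (e i) (e j) (J (e k)) (J (e l))

end Algebra

/-! ### Curvature of a matrix of metric coefficients on the coordinate space `E`

The coordinate space is a finite-dimensional normed space `E` (such as `ℝᵐ`). Coordinates are taken
with respect to a fixed basis `∂_1, …, ∂_m` of `E`. -/

section Coordinates

variable {E : Type*} [NormedAddCommGroup E] [NormedSpace ℝ E] [FiniteDimensional ℝ E]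

variable (E) in
/-- The index set `{1, …, dim E}`. -/
abbrev Idx : Type := Fin (Module.finrank ℝ E)

variable (E) in
/-- The fixed basis of the coordinate space `E`. -/
noncomputable abbrev coordBasis : Module.Basis (Idx E) ℝ E := Module.finBasis ℝ E

/-- The partial derivative `∂_i f`. -/
noncomputable def partialDeriv (i : Idx E) (f : E → ℝ) (y : E) : ℝ :=
  fderiv ℝ f y (coordBasis E i)

/-- The Christoffel symbols of the Levi-Civita connection,
`Γ_{ij}^k = ½ G^{kl} (∂_i G_{jl} + ∂_j G_{il} - ∂_l G_{ij})`, so that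
`∇_{∂_i} ∂_j = Γ_{ij}^k ∂_k`. -/
noncomputable def christoffel (G : E → Matrix (Idx E) (Idx E) ℝ) (i j k : Idx E) (y : E) : ℝ :=
  (1 / 2) * ∑ l, (G y)⁻¹ k l * (partialDeriv i (fun z => G z j l) y
    + partialDeriv j (fun z => G z i l) y - partialDeriv l (fun z => G z i j) y)

/-- The components `R_{ijk}^l` of `(∇_{∂_i} ∇_{∂_j} - ∇_{∂_j} ∇_{∂_i}) ∂_k = R_{ijk}^l ∂_l`. -/
noncomputable def curvOperatorCoeff (G : E → Matrix (Idx E) (Idx E) ℝ) (i j k l : Idx E) (y : E) :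
    ℝ :=
  partialDeriv i (christoffel G j k l) y - partialDeriv j (christoffel G i k l) y
    + ∑ n, (christoffel G j k n y * christoffel G i n l y
      - christoffel G i k n y * christoffel G j n l y)

/-- The components `R_{ijkl} = G(R(∂_i, ∂_j) ∂_k, ∂_l)` of the curvature tensor. -/
noncomputable def curvTensorCoeff (G : E → Matrix (Idx E) (Idx E) ℝ) (i j k l : Idx E) (y : E) :
    ℝ :=
  ∑ n, curvOperatorCoeff G i j k n y * G y n l

end Coordinates

/-! ### Pseudo-Riemannian manifolds -/

section Manifold

variable (E : Type*) [NormedAddCommGroup E] [NormedSpace ℝ E]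
  (M : Type*) [TopologicalSpace M] [ChartedSpace E M] [IsManifold 𝓘(ℝ, E) ∞ M]

/-- A smooth pseudo-Riemannian metric on a smooth manifold `M` modelled on `E`. -/
structure PseudoRiemannianMetric where
  inner (p : M) : TangentSpace 𝓘(ℝ, E) p →L[ℝ] TangentSpace 𝓘(ℝ, E) p →L[ℝ] ℝ
  symm (p : M) (v w : TangentSpace 𝓘(ℝ, E) p) : inner p v w = inner p w v
  nondegenerate (p : M) (v : TangentSpace 𝓘(ℝ, E) p) (hv : ∀ w, inner p v w = 0) : v = 0
  contMDiff : ContMDiff 𝓘(ℝ, E) (𝓘(ℝ, E).prod 𝓘(ℝ, E →L[ℝ] E →L[ℝ] ℝ)) ∞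
    (fun p ↦ Bundle.TotalSpace.mk' (E →L[ℝ] E →L[ℝ] ℝ) p (inner p))

/-- A smooth field of endomorphisms of the tangent spaces of `M`. -/
structure EndomorphismField where
  toFun (p : M) : TangentSpace 𝓘(ℝ, E) p →L[ℝ] TangentSpace 𝓘(ℝ, E) p
  contMDiff : ContMDiff 𝓘(ℝ, E) (𝓘(ℝ, E).prod 𝓘(ℝ, E →L[ℝ] E)) ∞
    (fun p ↦ Bundle.TotalSpace.mk' (E →L[ℝ] E) p (toFun p))

variable {E M}

/-- The endomorphism `J_p` of `T_p M`, as a linear map. -/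
noncomputable def EndomorphismField.endAt (J : EndomorphismField E M) (p : M) :
    TangentSpace 𝓘(ℝ, E) p →ₗ[ℝ] TangentSpace 𝓘(ℝ, E) p :=
  (J.toFun p).toLinearMap

variable [FiniteDimensional ℝ E]

/-- The `i`-th component `dχ_p(v)^i` of a tangent vector `v` at `p` in the coordinates
`χ : M → E`. -/
noncomputable def tangentCoord (χ : M → E) (p : M) (v : TangentSpace 𝓘(ℝ, E) p) (i : Idx E) : ℝ :=
  (coordBasis E).coord i (mfderiv 𝓘(ℝ, E) 𝓘(ℝ, E) χ p v)

namespace PseudoRiemannianMetric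

variable (g : PseudoRiemannianMetric E M)

/-- The bilinear form `g_p` on `T_p M`. -/
noncomputable def form (p : M) : LinearMap.BilinForm ℝ (TangentSpace 𝓘(ℝ, E) p) :=
  LinearMap.mk₂ ℝ (fun v w => g.inner p v w) (by simp) (by simp) (by simp) (by simp)

/-- The coefficients of the pullback of `g` along a local parametrization `ψ : E → M`:
`G_{ij}(y) = g_{ψ(y)}(dψ_y ∂_i, dψ_y ∂_j)`. -/
noncomputable def pullbackCoeff (ψ : E → M) (y : E) : Matrix (Idx E) (Idx E) ℝ :=
  Matrix.of fun i j => g.inner (ψ y)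
    (mfderiv 𝓘(ℝ, E) 𝓘(ℝ, E) ψ y (coordBasis E i))
    (mfderiv 𝓘(ℝ, E) 𝓘(ℝ, E) ψ y (coordBasis E j))

/-- The coefficients `G_{ij} = g(∂_i, ∂_j)` of `g` in the coordinates given by the preferred chart
at `p` (meaningful on the target of that chart). -/
noncomputable def coeffInChart (p : M) : E → Matrix (Idx E) (Idx E) ℝ :=
  g.pullbackCoeff (extChartAt 𝓘(ℝ, E) p).symm

/-- The curvature tensor `R_p(x, y, z, w) = g_p(R(x, y) z, w)` on `T_p M`, where
`R(x, y) = ∇_x ∇_y - ∇_y ∇_x - ∇_{[x, y]}` and `∇` is the Levi-Civita connection of `g`. It is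
computed in the preferred chart at `p`; as `R` is a tensor, every chart gives the same value. -/
noncomputable def curvature (p : M) (x y z w : TangentSpace 𝓘(ℝ, E) p) : ℝ :=
  ∑ i, ∑ j, ∑ k, ∑ l,
    tangentCoord (extChartAt 𝓘(ℝ, E) p) p x i * tangentCoord (extChartAt 𝓘(ℝ, E) p) p y j *
    tangentCoord (extChartAt 𝓘(ℝ, E) p) p z k * tangentCoord (extChartAt 𝓘(ℝ, E) p) p w l *
      curvTensorCoeff (g.coeffInChart p) i j k l (extChartAt 𝓘(ℝ, E) p p)

/-- A basis of `T_p M`, used to compute contractions; their values do not depend on it. -/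
noncomputable def tangentBasis (p : M) : Module.Basis (Idx E) ℝ (TangentSpace 𝓘(ℝ, E) p) :=
  coordBasis E

/-- The scalar curvature of `(M, g)` at `p`. -/
noncomputable def scalarCurvature (p : M) : ℝ :=
  scalarCurv (tangentBasis p) (g.form p) (g.curvature p)

/-- `τ⋆ = τ⋆_{J₁} + τ⋆_{J₂} + τ⋆_{J₃}` for an almost hyper Hermitian manifold `(M, g, 𝒥)`. -/
noncomputable def hyperStarScalarCurvature (𝒥 : Fin 3 → EndomorphismField E M) (p : M) : ℝ :=
  starScalarCurv (tangentBasis p) (g.form p) (g.curvature p) ((𝒥 0).endAt p)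
    + starScalarCurv (tangentBasis p) (g.form p) (g.curvature p) ((𝒥 1).endAt p)
    + starScalarCurv (tangentBasis p) (g.form p) (g.curvature p) ((𝒥 2).endAt p)

/-- `τ⋆ = τ⋆_{J₁} + τ⋆_{J₂} + τ⋆_{J₃}` for an almost hyper para Hermitian manifold
`(M, g, 𝒥)`; here `J₁` is Hermitian while `J₂` and `J₃` are para Hermitian. -/
noncomputable def hyperParaStarScalarCurvature (𝒥 : Fin 3 → EndomorphismField E M) (p : M) : ℝ :=
  starScalarCurv (tangentBasis p) (g.form p) (g.curvature p) ((𝒥 0).endAt p)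
    + paraStarScalarCurv (tangentBasis p) (g.form p) (g.curvature p) ((𝒥 1).endAt p)
    + paraStarScalarCurv (tangentBasis p) (g.form p) (g.curvature p) ((𝒥 2).endAt p)

/-- `(M, g, 𝒥)` is an almost hyper Hermitian manifold. -/
def IsAlmostHyperHermitian (𝒥 : Fin 3 → EndomorphismField E M) : Prop :=
  ∀ p, IsHyperHermitianStructure (g.form p) (fun a => (𝒥 a).endAt p)

/-- `(M, g, 𝒥)` is an almost hyper para Hermitian manifold. -/
def IsAlmostHyperParaHermitian (𝒥 : Fin 3 → EndomorphismField E M) : Prop :=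
  ∀ p, IsHyperParaHermitianStructure (g.form p) (fun a => (𝒥 a).endAt p)

variable {V : Type*} [AddCommGroup V] [Module ℝ V]

/-- `(V, B, J, A)` is isomorphic to `(T_P M, g_P, 𝒥_P, R_P)`, i.e. `(M, g, 𝒥)` realizes the model
`(V, B, J, A)` at the point `P`. -/
def RealizesAt (𝒥 : Fin 3 → EndomorphismField E M) (P : M) (B : LinearMap.BilinForm ℝ V)
    (J : Fin 3 → V →ₗ[ℝ] V) (A : V →ₗ[ℝ] V →ₗ[ℝ] V →ₗ[ℝ] V →ₗ[ℝ] ℝ) : Prop :=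
  ∃ φ : V ≃ₗ[ℝ] TangentSpace 𝓘(ℝ, E) P,
    (∀ x y, g.form P (φ x) (φ y) = B x y) ∧
    (∀ x y z w, g.curvature P (φ x) (φ y) (φ z) (φ w) = A x y z w) ∧
    (∀ a x, (𝒥 a).endAt P (φ x) = φ (J a x))

end PseudoRiemannianMetric

end Manifold

/-! ### Geometric realizability -/

section Realizability

variable (E : Type*) [NormedAddCommGroup E] [NormedSpace ℝ E] [FiniteDimensional ℝ E]
  {V : Type*} [AddCommGroup V] [Module ℝ V]

/-- The model `(V, B, J, A)` is geometrically realizable by an almost hyper Hermitian manifold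
(smooth, Hausdorff, second countable, connected, modelled on `E`) of constant scalar curvature and
constant `⋆`-scalar curvature. -/
def HyperHermitianRealizable (B : LinearMap.BilinForm ℝ V) (J : Fin 3 → V →ₗ[ℝ] V)
    (A : V →ₗ[ℝ] V →ₗ[ℝ] V →ₗ[ℝ] V →ₗ[ℝ] ℝ) : Prop :=
  ∃ (M : Type) (_ : TopologicalSpace M) (_ : ChartedSpace E M) (_ : IsManifold 𝓘(ℝ, E) ∞ M)
    (g : PseudoRiemannianMetric E M) (𝒥 : Fin 3 → EndomorphismField E M) (P : M),
    T2Space M ∧ SecondCountableTopology M ∧ ConnectedSpace M ∧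
    g.IsAlmostHyperHermitian 𝒥 ∧
    g.RealizesAt 𝒥 P B J A ∧
    (∃ c : ℝ, ∀ p, g.scalarCurvature p = c) ∧
    (∃ c : ℝ, ∀ p, g.hyperStarScalarCurvature 𝒥 p = c)

/-- The model `(V, B, J, A)` is geometrically realizable by an almost hyper para Hermitian manifold
(smooth, Hausdorff, second countable, connected, modelled on `E`) of constant scalar curvature and
constant `⋆`-scalar curvature. -/
def HyperParaHermitianRealizable (B : LinearMap.BilinForm ℝ V) (J : Fin 3 → V →ₗ[ℝ] V)
    (A : V →ₗ[ℝ] V →ₗ[ℝ] V →ₗ[ℝ] V →ₗ[ℝ] ℝ) : Prop :=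
  ∃ (M : Type) (_ : TopologicalSpace M) (_ : ChartedSpace E M) (_ : IsManifold 𝓘(ℝ, E) ∞ M)
    (g : PseudoRiemannianMetric E M) (𝒥 : Fin 3 → EndomorphismField E M) (P : M),
    T2Space M ∧ SecondCountableTopology M ∧ ConnectedSpace M ∧
    g.IsAlmostHyperParaHermitian 𝒥 ∧
    g.RealizesAt 𝒥 P B J A ∧
    (∃ c : ℝ, ∀ p, g.scalarCurvature p = c) ∧
    (∃ c : ℝ, ∀ p, g.hyperParaStarScalarCurvature 𝒥 p = c)

end Realizability

end CurvReal

open CurvReal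

namespace CurvReal

/-! ### Weighted `ℓ¹` algebras of formal power series -/

section WeightedSeries

open Finset MvPowerSeries

/-! The manifold is a ball around the origin of `E` with one chart. All structure comes from a
coframe `Θ = 1 + ½ B⁻¹h`, where `h` is a field of symmetric matrices: the metric is `G = ΘᵀBΘ = B +
h + ¼ hB⁻¹h` and the endomorphisms are `Θ⁻¹JₐΘ`. The hyper structure is then compatible with the
metric at every point whatever `h` is (`IsHyperMatrix.conj`), so that only curvature conditions
remain: `R = A` at the origin, and `τ`, `τ⋆` constant.

Take `h = ε q + ∑ᵤ Hᵘ ∂₀⁻²Uᵤ`. Here `q = -⅓ A_{jabk} xₐx_b` has curvature `A` to first order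
(`linearCurv_quadField2`), `H⁰`, `H¹` are constant symmetric matrices and `U₀`, `U₁` are unknown
functions. Asking that `τ` and `τ⋆` equal `ε` times their values on `A` gives two second-order
equations for two unknowns. They can be solved if the direction `x₀` is noncharacteristic. The
symbols of `τ` and `τ⋆` in that direction, evaluated on the metric and on the square of `dx⁰ ∘ J₁`,
have determinant `(m - 4)β³` with `β = B⁻¹₀₀`; in an orthogonal basis `β ≠ 0`, so `H⁰`, `H¹` can be
chosen dual to the symbols (`IsHyperMatrix.exists_dual_symbols`).

The equations are then solved by a Banach space form of the Cauchy–Kovalevskaya theorem. In the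
weighted `ℓ¹` algebra of power series with weight `r^{α₀} / (|α| choose α₀)` the operators `∂ₐ∂₀⁻¹`,
`a ≠ 0`, have norm at most `r` (`WSeries.norm_derivIntegral_le`). Since the unknowns are themselves
second `x₀`-derivatives, no derivative is lost: the curvature is a strictly differentiable function
of `(ε, U)` at the origin, and its linearization in `U` is the identity plus `O(r)`. For small `r`
it is surjective, so the equations are solvable for some small `ε > 0` (`exists_pert_solution`).

At the origin the metric agrees with `B` to first order, so the equations themselves force `U(0) =
0` and the curvature there is `εA` (`eval_zero_pertCurv`). Dilating the coordinates by `ε^{-1/2}`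
turns `εA` into `A` (`exists_coframe`). The Hermitian and para Hermitian cases are treated together
by signs `σₐ = ±1` with `Jₐ² = -σₐ` and `Jₐ^*B = σₐB`. -/

/-- A positive submultiplicative weight on multi-indices. -/
structure SubmultWeight (ι : Type*) where
  toFun : (ι →₀ ℕ) → ℝ
  pos : ∀ α, 0 < toFun α
  map_zero : toFun 0 = 1
  map_add_le : ∀ α β, toFun (α + β) ≤ toFun α * toFun β

variable {ι : Type*} (w : SubmultWeight ι)

/-- The power series with absolutely summable weighted coefficients. -/
def weightedSummable : Submodule ℝ (MvPowerSeries ι ℝ) where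
  carrier := {f | Summable fun α => |coeff α f| * w.toFun α}
  zero_mem' := by simp
  add_mem' := by
    intro f g hf hg
    refine Summable.of_nonneg_of_le (fun α => mul_nonneg (abs_nonneg _) (w.pos α).le) (fun α => ?_)
      (Summable.add hf hg)
    rw [map_add, ← add_mul]
    exact mul_le_mul_of_nonneg_right (abs_add_le _ _) (w.pos α).le
  smul_mem' := by
    intro c f hf
    have := Summable.mul_left |c| hf
    refine this.congr fun α => ?_
    rw [map_smul, smul_eq_mul, abs_mul, mul_assoc]

lemma mem_weightedSummable {f : MvPowerSeries ι ℝ} :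
    f ∈ weightedSummable w ↔ Summable fun α => |coeff α f| * w.toFun α := Iff.rfl

/-- The weighted `ℓ¹` norm. -/
noncomputable def wnorm (f : MvPowerSeries ι ℝ) : ℝ := ∑' α, |coeff α f| * w.toFun α

/-- The weight of `γ` is at most the product of the weights of any two summands of `γ`, so the
coefficients of a product are dominated by the Cauchy product of the weighted coefficients. -/
lemma abs_coeff_mul_le [DecidableEq ι] (f g : MvPowerSeries ι ℝ) (γ : ι →₀ ℕ) :
    |coeff γ (f * g)| * w.toFun γ ≤ ∑ kl ∈ antidiagonal γ,
      (|coeff kl.1 f| * w.toFun kl.1) * (|coeff kl.2 g| * w.toFun kl.2) := by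
  rw [coeff_mul]
  calc _ ≤ (∑ kl ∈ antidiagonal γ, |coeff kl.1 f * coeff kl.2 g|) * w.toFun γ :=
        mul_le_mul_of_nonneg_right (abs_sum_le_sum_abs _ _) (w.pos γ).le
    _ ≤ _ := by
        rw [sum_mul]
        refine sum_le_sum fun kl hkl => ?_
        rw [HasAntidiagonal.mem_antidiagonal] at hkl
        rw [abs_mul]
        calc _ ≤ |coeff kl.1 f| * |coeff kl.2 g| * (w.toFun kl.1 * w.toFun kl.2) := by
              refine mul_le_mul_of_nonneg_left ?_ (by positivity)
              rw [← hkl]; exact w.map_add_le _ _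
          _ = _ := by ring

lemma summable_prod_mul {f g : MvPowerSeries ι ℝ} (hf : f ∈ weightedSummable w)
    (hg : g ∈ weightedSummable w) :
    Summable fun x : (ι →₀ ℕ) × (ι →₀ ℕ) =>
      (|coeff x.1 f| * w.toFun x.1) * (|coeff x.2 g| * w.toFun x.2) :=
  Summable.mul_of_nonneg (f := fun α => |coeff α f| * w.toFun α)
    (g := fun α => |coeff α g| * w.toFun α) hf hg
    (fun α => mul_nonneg (abs_nonneg _) (w.pos α).le)
    (fun α => mul_nonneg (abs_nonneg _) (w.pos α).le)

lemma mul_mem_weightedSummable {f g : MvPowerSeries ι ℝ} (hf : f ∈ weightedSummable w)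
    (hg : g ∈ weightedSummable w) : f * g ∈ weightedSummable w := by
  classical
  refine Summable.of_nonneg_of_le (fun α => mul_nonneg (abs_nonneg _) (w.pos α).le)
    (fun γ => abs_coeff_mul_le w f g γ)
    (summable_sum_mul_antidiagonal_of_summable_mul
      (f := fun α => |coeff α f| * w.toFun α) (g := fun α => |coeff α g| * w.toFun α)
      (summable_prod_mul w hf hg))

lemma wnorm_mul_le {f g : MvPowerSeries ι ℝ} (hf : f ∈ weightedSummable w)
    (hg : g ∈ weightedSummable w) : wnorm w (f * g) ≤ wnorm w f * wnorm w g := by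
  classical
  have h := summable_prod_mul w hf hg
  unfold wnorm
  rw [Summable.tsum_mul_tsum_eq_tsum_sum_antidiagonal hf hg h]
  exact Summable.tsum_le_tsum (fun γ => abs_coeff_mul_le w f g γ)
    (mul_mem_weightedSummable w hf hg)
    (summable_sum_mul_antidiagonal_of_summable_mul
      (f := fun α => |coeff α f| * w.toFun α) (g := fun α => |coeff α g| * w.toFun α) h)

lemma hasSum_wnorm_one : HasSum (fun α => |coeff α (1 : MvPowerSeries ι ℝ)| * w.toFun α) 1 := by
  classical
  convert hasSum_ite_eq (0 : ι →₀ ℕ) (1 : ℝ) using 2 with α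
  rw [coeff_one]
  split_ifs with h
  · simp [h, w.map_zero]
  · simp

/-- The algebra of power series with absolutely summable weighted coefficients. -/
noncomputable def weightedSubalgebra : Subalgebra ℝ (MvPowerSeries ι ℝ) :=
  (weightedSummable w).toSubalgebra (hasSum_wnorm_one w).summable
    fun _ _ hf hg => mul_mem_weightedSummable w hf hg

/-- The Banach algebra of power series with absolutely summable weighted coefficients. -/
def WSeries : Type _ := weightedSubalgebra w

noncomputable instance : CommRing (WSeries w) :=
  inferInstanceAs (CommRing (weightedSubalgebra w))

noncomputable instance : Algebra ℝ (WSeries w) :=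
  inferInstanceAs (Algebra ℝ (weightedSubalgebra w))

variable {w}

/-- The underlying formal power series. -/
noncomputable def WSeries.val : WSeries w →ₐ[ℝ] MvPowerSeries ι ℝ := (weightedSubalgebra w).val

lemma WSeries.val_injective : Function.Injective (WSeries.val (w := w)) := Subtype.val_injective

lemma WSeries.summable (f : WSeries w) : Summable fun α => |coeff α f.val| * w.toFun α := f.2

/-- The element of the Banach algebra given by a power series. -/
noncomputable def WSeries.mk (f : MvPowerSeries ι ℝ) (hf : f ∈ weightedSummable w) : WSeries w := ⟨f, hf⟩

@[simp] lemma WSeries.val_mk (f : MvPowerSeries ι ℝ) (hf : f ∈ weightedSummable w) :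
    (WSeries.mk f hf).val = f := rfl

/-- The weighted `ℓ¹` norm as a group norm. -/
noncomputable def WSeries.groupNorm : AddGroupNorm (WSeries w) where
  toFun f := wnorm w f.val
  map_zero' := by simp [wnorm]
  add_le' f g := by
    unfold wnorm
    rw [← Summable.tsum_add f.summable g.summable]
    refine Summable.tsum_le_tsum (fun α => ?_) (f + g).summable (f.summable.add g.summable)
    rw [map_add, map_add, ← add_mul]
    exact mul_le_mul_of_nonneg_right (abs_add_le _ _) (w.pos α).le
  neg' f := by simp [wnorm]
  eq_zero_of_map_eq_zero' f hf := by
    apply WSeries.val_injective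
    ext α
    have hs := f.summable.hasSum
    rw [show (∑' α, |coeff α f.val| * w.toFun α) = 0 from hf] at hs
    have h := (hasSum_zero_iff_of_nonneg
      (fun α => mul_nonneg (abs_nonneg (coeff α f.val)) (w.pos α).le)).1 hs
    have := congrFun h α
    simpa [(w.pos α).ne'] using this

noncomputable instance : NormedAddCommGroup (WSeries w) :=
  { AddGroupNorm.toNormedAddCommGroup (WSeries.groupNorm (w := w)) with
    toAddCommGroup := inferInstance }

noncomputable instance : NormedCommRing (WSeries w) :=
  { (inferInstance : NormedAddCommGroup (WSeries w)), (inferInstance : CommRing (WSeries w)) with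
    norm_mul_le := fun f g => wnorm_mul_le w f.2 g.2 }

lemma WSeries.norm_def (f : WSeries w) : ‖f‖ = ∑' α, |coeff α f.val| * w.toFun α := rfl

noncomputable instance : NormedAlgebra ℝ (WSeries w) where
  norm_smul_le c f := by
    rw [WSeries.norm_def, WSeries.norm_def, Real.norm_eq_abs, ← tsum_mul_left]
    apply le_of_eq
    congr 1
    ext α
    rw [map_smul, map_smul, smul_eq_mul, abs_mul, mul_assoc]

/-- The isometry of the algebra of weighted series with `ℓ¹`. -/
noncomputable def WSeries.toLp : WSeries w ≃ lp (fun _ : ι →₀ ℕ => ℝ) 1 where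
  toFun f := ⟨fun α => coeff α f.val * w.toFun α, by
    refine memℓp_gen ?_
    simpa [abs_mul, abs_of_pos (w.pos _)] using f.summable⟩
  invFun b := WSeries.mk (fun α => b α / w.toFun α) (by
    have h := (lp.memℓp b).summable (by simp)
    refine Summable.congr (f := fun α => ‖b α‖ ^ ENNReal.toReal 1) ?_ fun α => ?_
    · exact h
    change _ = |b α / w.toFun α| * w.toFun α
    rw [abs_div, abs_of_pos (w.pos α), div_mul_cancel₀ _ (w.pos α).ne']
    simp)
  left_inv f := by
    apply WSeries.val_injective
    ext α
    change coeff α f.val * w.toFun α / w.toFun α = _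
    rw [mul_div_cancel_right₀ _ (w.pos α).ne']
  right_inv b := by
    ext α
    change b α / w.toFun α * w.toFun α = _
    rw [div_mul_cancel₀ _ (w.pos α).ne']

lemma WSeries.isometry_toLp : Isometry (WSeries.toLp (w := w)) := by
  refine Isometry.of_dist_eq fun f g => ?_
  rw [dist_eq_norm, dist_eq_norm, WSeries.norm_def, lp.norm_eq_tsum_rpow (by simp)]
  simp only [ENNReal.toReal_one, Real.rpow_one, div_one]
  congr 1
  ext α
  have : (WSeries.toLp f - WSeries.toLp g : lp (fun _ : ι →₀ ℕ => ℝ) 1) α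
      = coeff α f.val * w.toFun α - coeff α g.val * w.toFun α := rfl
  rw [this, ← sub_mul, Real.norm_eq_abs, abs_mul, abs_of_pos (w.pos α), map_sub, map_sub]

/-- Completeness is what the Neumann series, the smoothness of inversion and the open mapping form
of the inverse function theorem will need. -/
instance : CompleteSpace (WSeries w) :=
  (IsometryEquiv.mk WSeries.toLp WSeries.isometry_toLp).completeSpace

/-- The tool for bounding operators that only move coefficients: if each coefficient of `f` comes
from a different coefficient of `g` at weighted cost at most `c`, then comparing the two sums term
by term gives the bound `c`. Injectivity is needed only on the set `s` off which `f` vanishes. -/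
lemma WSeries.norm_le_of_coeff_le {f g : MvPowerSeries ι ℝ} (hg : g ∈ weightedSummable w)
    {c : ℝ} (hc : 0 ≤ c) (σ : (ι →₀ ℕ) → (ι →₀ ℕ)) (s : Set (ι →₀ ℕ)) (hσ : Set.InjOn σ s)
    (h0 : ∀ α ∉ s, coeff α f = 0)
    (h1 : ∀ α ∈ s, |coeff α f| * w.toFun α ≤ c * (|coeff (σ α) g| * w.toFun (σ α))) :
    ∃ hf : f ∈ weightedSummable w, ‖WSeries.mk f hf‖ ≤ c * ‖WSeries.mk g hg‖ := by
  have hg' : Summable fun α => c * (|coeff α g| * w.toFun α) := Summable.mul_left c hg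
  have hs : Summable ((fun α => c * (|coeff α g| * w.toFun α)) ∘ fun α : s => σ α) :=
    hg'.comp_injective hσ.injective
  have key : ∀ α : s, |coeff (α : ι →₀ ℕ) f| * w.toFun α
      ≤ ((fun α => c * (|coeff α g| * w.toFun α)) ∘ fun α : s => σ α) α := fun α => h1 α α.2
  have hfs : Summable fun α : s => |coeff (α : ι →₀ ℕ) f| * w.toFun α :=
    Summable.of_nonneg_of_le (fun α => mul_nonneg (abs_nonneg _) (w.pos _).le) key hs
  have hsupp : Function.support (fun α => |coeff α f| * w.toFun α) ⊆ s := by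
    intro α hα
    by_contra h
    exact hα (by simp [h0 α h])
  have hf : f ∈ weightedSummable w := by
    rw [mem_weightedSummable]
    rw [← summable_subtype_and_compl (s := s)]
    refine ⟨hfs, ?_⟩
    convert summable_zero using 2 with α
    simp [h0 α α.2]
  refine ⟨hf, ?_⟩
  rw [WSeries.norm_def, WSeries.norm_def, WSeries.val_mk, WSeries.val_mk,
    ← tsum_subtype_eq_of_support_subset hsupp, ← tsum_mul_left]
  exact Summable.tsum_le_tsum_of_inj (fun α : s => σ α) hσ.injective
    (fun α _ => mul_nonneg hc (mul_nonneg (abs_nonneg _) (w.pos _).le)) key hfs hg'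

end WeightedSeries

/-! ### Evaluation of power series -/

section Evaluation

open Finset MvPowerSeries

variable {ι : Type*} [Fintype ι]

/-- The sum of a power series at a point. -/
noncomputable def evalSeries (f : MvPowerSeries ι ℝ) (y : ι → ℝ) : ℝ :=
  ∑' α, coeff α f * ∏ i, y i ^ α i

lemma prod_pow_le {y : ι → ℝ} {ρ : ℝ} (hy : ∀ i, |y i| ≤ ρ) (α : ι →₀ ℕ) :
    |∏ i, y i ^ α i| ≤ ρ ^ α.degree := by
  rw [abs_prod, Finsupp.degree_eq_sum, ← prod_pow_eq_pow_sum]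
  refine prod_le_prod (fun i _ => abs_nonneg _) fun i _ => ?_
  rw [abs_pow]
  exact pow_le_pow_left₀ (abs_nonneg _) (hy i) _

-- Differentiation multiplies a coefficient by at most its degree, and `(n + 1)(ρ'/ρ)ⁿ` is bounded,
-- so an arbitrarily small loss of radius pays for it.
omit [Fintype ι] in
lemma summable_pderiv (i : ι) {f : MvPowerSeries ι ℝ} {ρ ρ' : ℝ} (hρ' : 0 < ρ') (h : ρ' < ρ)
    (hf : Summable fun α => |coeff α f| * ρ ^ α.degree) :
    Summable fun α => |coeff α (pderiv ℝ i f)| * ρ' ^ α.degree := by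
  classical
  have hρ : 0 < ρ := hρ'.trans h
  have hb : ∃ C : ℝ, ∀ n : ℕ, ((n : ℝ) + 1) * (ρ' / ρ) ^ n ≤ C := by
    have h1 : Summable fun n : ℕ => ((n : ℝ) ^ 1) * (ρ' / ρ) ^ n :=
      summable_pow_mul_geometric_of_norm_lt_one 1
        (by rw [Real.norm_of_nonneg (by positivity)]; exact (div_lt_one hρ).2 h)
    have h2 : Summable fun n : ℕ => (ρ' / ρ) ^ n :=
      summable_geometric_of_lt_one (by positivity) ((div_lt_one hρ).2 h)
    have h3 := h1.add h2
    refine ⟨∑' n : ℕ, ((n : ℝ) ^ 1 * (ρ' / ρ) ^ n + (ρ' / ρ) ^ n), fun n => ?_⟩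
    refine le_trans (le_of_eq ?_) (h3.le_tsum n fun j _ => by positivity)
    ring
  obtain ⟨C, hC⟩ := hb
  have hinj : Function.Injective fun α : ι →₀ ℕ => α + Finsupp.single i 1 :=
    add_left_injective _
  refine Summable.of_nonneg_of_le (fun α => by positivity) (fun α => ?_)
    ((hf.comp_injective hinj).mul_left (C / ρ))
  rw [coeff_pderiv, abs_mul]
  have hn : |((α i : ℝ) + 1)| ≤ α.degree + 1 := by
    rw [abs_of_nonneg (by positivity)]
    have := Finsupp.le_degree i α
    gcongr
  have key : |((α i : ℝ) + 1)| * ρ' ^ α.degree ≤ C * ρ ^ α.degree := by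
    calc _ ≤ ((α.degree : ℝ) + 1) * ρ' ^ α.degree := by gcongr
      _ = (((α.degree : ℝ) + 1) * (ρ' / ρ) ^ α.degree) * ρ ^ α.degree := by
          rw [div_pow]; field_simp
      _ ≤ _ := by gcongr; exact hC _
  simp only [Function.comp]
  rw [map_add, Finsupp.degree_single, pow_succ]
  calc _ = |coeff (α + Finsupp.single i 1) f| * (|((α i : ℝ) + 1)| * ρ' ^ α.degree) := by ring
    _ ≤ |coeff (α + Finsupp.single i 1) f| * (C * ρ ^ α.degree) := by gcongr
    _ = _ := by field_simp

/-- The derivative of a monomial function. -/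
noncomputable def monomialDeriv (α : ι →₀ ℕ) (y : ι → ℝ) : (ι → ℝ) →L[ℝ] ℝ :=
  ∑ i, ((α i : ℝ) * ∏ j, y j ^ (α - Finsupp.single i 1 : ι →₀ ℕ) j) •
    (ContinuousLinearMap.proj i : (ι → ℝ) →L[ℝ] ℝ)

lemma hasFDerivAt_monomial (α : ι →₀ ℕ) (y : ι → ℝ) :
    HasFDerivAt (fun y : ι → ℝ => ∏ i, y i ^ α i) (monomialDeriv α y) y := by
  classical
  have h := HasFDerivAt.finsetProd (u := (univ : Finset ι)) (x := y)
    (g := fun i (y : ι → ℝ) => y i ^ α i) (𝕜 := ℝ)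
    (g' := fun i => (α i * y i ^ (α i - 1)) •
      (ContinuousLinearMap.proj i : (ι → ℝ) →L[ℝ] ℝ))
    (fun i _ => (((ContinuousLinearMap.proj i : (ι → ℝ) →L[ℝ] ℝ).hasFDerivAt (x := y)).pow
      (α i)).congr_fderiv (by simp [mul_smul]))
  refine h.congr_fderiv ?_
  unfold monomialDeriv
  refine sum_congr rfl fun i _ => ?_
  rw [smul_smul]
  congr 1
  rw [← mul_prod_erase univ _ (mem_univ i)]
  have : ∏ j ∈ univ.erase i, y j ^ (α - Finsupp.single i 1 : ι →₀ ℕ) j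
      = ∏ j ∈ univ.erase i, y j ^ α j := by
    refine prod_congr rfl fun j hj => ?_
    rw [Finsupp.tsub_apply, Finsupp.single_eq_of_ne (ne_of_mem_erase hj), tsub_zero]
  rw [this]
  simp
  ring

lemma hasSum_coeff_mul_monomialDeriv (i : ι) {f : MvPowerSeries ι ℝ} {ρ : ℝ}
    (hf : Summable fun α => |coeff α (pderiv ℝ i f)| * ρ ^ α.degree)
    {y : ι → ℝ} (hy : ∀ j, |y j| ≤ ρ) :
    HasSum (fun α : ι →₀ ℕ => coeff α f * ((α i : ℝ) * ∏ j, y j ^ (α - Finsupp.single i 1 : ι →₀ ℕ) j))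
      (evalSeries (pderiv ℝ i f) y) := by
  have hinj : Function.Injective fun α : ι →₀ ℕ => α + Finsupp.single i 1 :=
    add_left_injective _
  -- Reindexing by `α ↦ α + eᵢ` misses only the `α` with `αᵢ = 0`, whose terms carry the factor `αᵢ`
  -- and vanish; there the truncated exponent `α - eᵢ` is harmless.
  rw [← hinj.hasSum_iff]
  · have hs : Summable fun α => coeff α (pderiv ℝ i f) * ∏ j, y j ^ α j := by
      refine Summable.of_norm_bounded hf fun α => ?_
      rw [norm_mul]
      exact mul_le_mul_of_nonneg_left (prod_pow_le hy α) (norm_nonneg _)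
    convert! hs.hasSum using 2 with α
    rw [coeff_pderiv]
    simp
    ring
  · intro α hα
    have : α i = 0 := by
      by_contra h0
      refine hα ⟨α - Finsupp.single i 1, ?_⟩
      exact tsub_add_cancel_of_le (Finsupp.single_le_iff.2 (Nat.one_le_iff_ne_zero.2 h0))
    simp [this]

lemma norm_monomialDeriv_le (f : MvPowerSeries ι ℝ) {ρ : ℝ} {y : ι → ℝ}
    (hy : ∀ j, |y j| ≤ ρ) (α : ι →₀ ℕ) :
    ‖coeff α f • monomialDeriv α y‖ ≤
      ∑ i, |coeff α f| * (α i * ρ ^ (α - Finsupp.single i 1).degree) := by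
  unfold monomialDeriv
  rw [smul_sum]
  refine (norm_sum_le _ _).trans (sum_le_sum fun i _ => ?_)
  rw [norm_smul, norm_smul, Real.norm_eq_abs, Real.norm_eq_abs, abs_mul, Nat.abs_cast]
  have h1 : ‖(ContinuousLinearMap.proj i : (ι → ℝ) →L[ℝ] ℝ)‖ ≤ 1 :=
    ContinuousLinearMap.opNorm_le_bound _ zero_le_one fun x => by
      simpa using norm_le_pi_norm x i
  have h2 := prod_pow_le hy (α - Finsupp.single i 1)
  calc _ ≤ |coeff α f| * ((α i * |∏ j, y j ^ (α - Finsupp.single i 1 : ι →₀ ℕ) j|) * 1) := by gcongr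
    _ ≤ _ := by rw [mul_one]; gcongr

/-- Termwise differentiation on a slightly smaller ball of radius `ρ'`, where the derivatives of the
monomials have a summable majorant. -/
lemma hasFDerivAt_evalSeries {f : MvPowerSeries ι ℝ} {ρ : ℝ}
    (hf : Summable fun α => |coeff α f| * ρ ^ α.degree) {y : ι → ℝ} (hy : ‖y‖ < ρ) :
    HasFDerivAt (evalSeries f)
      (∑ i, evalSeries (pderiv ℝ i f) y • (ContinuousLinearMap.proj i : (ι → ℝ) →L[ℝ] ℝ)) y := by
  obtain ⟨ρ', h1, h2⟩ := exists_between hy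
  have hρ' : 0 < ρ' := (norm_nonneg _).trans_lt h1
  have hball : ∀ x ∈ Metric.ball (0 : ι → ℝ) ρ', ∀ j, |x j| ≤ ρ' := fun x hx j =>
    (norm_le_pi_norm x j).trans (mem_ball_zero_iff.1 hx).le
  have hd : ∀ i, Summable fun α => |coeff α (pderiv ℝ i f)| * ρ' ^ α.degree := fun i =>
    summable_pderiv i hρ' h2 hf
  have hs : ∀ i, Summable fun α : ι →₀ ℕ =>
      |coeff α f| * (α i * ρ' ^ (α - Finsupp.single i 1).degree) := by
    intro i
    -- At the point with all coordinates equal to `ρ'` the absolute values of the terms of the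
    -- differentiated series are exactly the majorant.
    have := (hasSum_coeff_mul_monomialDeriv i (hd i) (y := fun _ : ι => ρ')
      (fun j => (abs_of_pos hρ').le)).summable.norm
    refine this.congr fun α => ?_
    rw [norm_mul, norm_mul, prod_pow_eq_pow_sum, ← Finsupp.degree_eq_sum]
    simp [abs_of_pos hρ']
  have key := hasFDerivAt_tsum_of_isPreconnected (𝕜 := ℝ)
    (f := fun (α : ι →₀ ℕ) y => coeff α f * ∏ i, y i ^ α i)
    (f' := fun α y => coeff α f • monomialDeriv α y) (x := y) (x₀ := y)
    (summable_sum fun i (_ : i ∈ univ) => hs i)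
    Metric.isOpen_ball (convex_ball (0 : ι → ℝ) ρ').isPreconnected
    (fun α x _ => (hasFDerivAt_monomial α x).const_mul _)
    (fun α x hx => by simpa using norm_monomialDeriv_le f (hball x hx) α)
    (mem_ball_zero_iff.2 h1) ?_ (mem_ball_zero_iff.2 h1)
  · refine key.congr_fderiv ?_
    have hy' := hball y (mem_ball_zero_iff.2 h1)
    have : HasSum (fun α => coeff α f • monomialDeriv α y)
        (∑ i, evalSeries (pderiv ℝ i f) y •
          (ContinuousLinearMap.proj i : (ι → ℝ) →L[ℝ] ℝ)) := by
      simp only [monomialDeriv, smul_sum, smul_smul]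
      exact hasSum_sum fun i _ =>
        (hasSum_coeff_mul_monomialDeriv i (hd i) hy').smul_const _
    exact this.tsum_eq
  · refine Summable.of_norm_bounded hf fun α => ?_
    rw [norm_mul]
    exact mul_le_mul_of_nonneg_left
      (prod_pow_le (fun j => (norm_le_pi_norm y j).trans hy.le) α) (norm_nonneg _)

/-- The induction runs over all series and all radii at once, since the partial derivatives are
again sums of power series, but summable only for smaller radii. -/
lemma contDiffOn_evalSeries (n : ℕ) : ∀ {f : MvPowerSeries ι ℝ} {ρ : ℝ},
    Summable (fun α => |coeff α f| * ρ ^ α.degree) →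
    ContDiffOn ℝ n (evalSeries f) (Metric.ball 0 ρ) := by
  induction n with
  | zero =>
    intro f ρ hf
    rw [Nat.cast_zero, contDiffOn_zero]
    exact fun y hy =>
      (hasFDerivAt_evalSeries hf (mem_ball_zero_iff.1 hy)).continuousAt.continuousWithinAt
  | succ n ih =>
    intro f ρ hf
    push_cast
    rw [contDiffOn_succ_iff_hasFDerivWithinAt_of_uniqueDiffOn Metric.isOpen_ball.uniqueDiffOn]
    refine ⟨by simp, _, ?_, fun y hy =>
      (hasFDerivAt_evalSeries hf (mem_ball_zero_iff.1 hy)).hasFDerivWithinAt⟩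
    refine ContDiffOn.sum fun i _ => ContDiffOn.fun_smul ?_ contDiffOn_const
    intro y hy
    obtain ⟨ρ', h1, h2⟩ := exists_between (mem_ball_zero_iff.1 hy)
    have hρ' : 0 < ρ' := (norm_nonneg _).trans_lt h1
    exact ((ih (summable_pderiv i hρ' h2 hf)).contDiffAt
      (Metric.isOpen_ball.mem_nhds (mem_ball_zero_iff.2 h1))).contDiffWithinAt

end Evaluation

/-! ### The weight adapted to integration in one variable -/

section CauchyWeight

open Finset MvPowerSeries

variable {ι : Type*}

/-- The weight `r ^ α₀ / (|α| choose α₀)`. For it, `∂_a ∂₀⁻¹` is a bounded operator. -/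
noncomputable def cauchyWeight (i₀ : ι) {r : ℝ} (hr : 0 < r) : SubmultWeight ι where
  toFun α := r ^ α i₀ / (α.degree.choose (α i₀) : ℝ)
  pos α := div_pos (pow_pos hr _) (by exact_mod_cast Nat.choose_pos (Finsupp.le_degree i₀ α))
  map_zero := by simp
  map_add_le α β := by
    have h1 : (0 : ℝ) < α.degree.choose (α i₀) := by
      exact_mod_cast Nat.choose_pos (Finsupp.le_degree i₀ α)
    have h2 : (0 : ℝ) < β.degree.choose (β i₀) := by
      exact_mod_cast Nat.choose_pos (Finsupp.le_degree i₀ β)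
    rw [div_mul_div_comm, Finsupp.add_apply, pow_add]
    refine div_le_div_of_nonneg_left (by positivity) (by positivity) ?_
    rw [map_add]
    -- A single term of Vandermonde's identity.
    have : α.degree.choose (α i₀) * β.degree.choose (β i₀)
        ≤ (α.degree + β.degree).choose (α i₀ + β i₀) := by
      rw [Nat.add_choose_eq]
      exact single_le_sum (f := fun ij : ℕ × ℕ => α.degree.choose ij.1 * β.degree.choose ij.2)
        (fun _ _ => Nat.zero_le _) (a := (α i₀, β i₀)) (by simp)
    exact_mod_cast this

lemma cauchyWeight_apply (i₀ : ι) {r : ℝ} (hr : 0 < r) (α : ι →₀ ℕ) :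
    (cauchyWeight i₀ hr).toFun α = r ^ α i₀ / (α.degree.choose (α i₀) : ℝ) := rfl

/-- With `n = |γ|` and `k = γ₀` this is `(n choose k) ≤ (k + 1)(n + 1 choose k + 1)`; it bounds
`∂₀⁻¹` by `r`. -/
lemma cauchyWeight_shift_le (i₀ : ι) {r : ℝ} (hr : 0 < r) (γ : ι →₀ ℕ) :
    (cauchyWeight i₀ hr).toFun (γ + Finsupp.single i₀ 1) / (γ i₀ + 1)
      ≤ r * (cauchyWeight i₀ hr).toFun γ := by
  have h1 : (0 : ℝ) < γ.degree.choose (γ i₀) := by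
    exact_mod_cast Nat.choose_pos (Finsupp.le_degree i₀ γ)
  simp only [cauchyWeight_apply, map_add, Finsupp.degree_single, Finsupp.add_apply,
    Finsupp.single_eq_same]
  rw [div_div, ← mul_div_assoc, pow_succ, mul_comm r]
  refine div_le_div_of_nonneg_left (by positivity) h1 ?_
  have h2 : γ.degree.choose (γ i₀) ≤ (γ.degree + 1).choose (γ i₀ + 1) * (γ i₀ + 1) := by
    rw [Nat.choose_succ_succ]
    nlinarith [Nat.zero_le ((γ.degree).choose (γ i₀) * γ i₀),
      Nat.zero_le ((γ.degree).choose (γ i₀ + 1) * (γ i₀ + 1))]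
  exact_mod_cast h2

/-- The reason for the binomial coefficient in the weight. With `n = |γ|` and `k = γ₀`, the
inequality `γₐ + γ₀ ≤ n` gives `(γₐ + 1)(n + 1 choose k) ≤ (n + 1 - k)(n + 1 choose k) = (k + 1)(n +
1 choose k + 1)`. Thus the factor `γₐ + 1` produced by `∂ₐ` is absorbed by trading a power of `xₐ`
for a power of `x₀`. -/
lemma cauchyWeight_swap_le {i₀ a : ι} (ha : a ≠ i₀) {r : ℝ} (hr : 0 < r) (γ : ι →₀ ℕ) :
    (γ a + 1) / (γ i₀ + 1) * (cauchyWeight i₀ hr).toFun (γ + Finsupp.single i₀ 1)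
      ≤ r * (cauchyWeight i₀ hr).toFun (γ + Finsupp.single a 1) := by
  classical
  have hle : γ a + γ i₀ ≤ γ.degree := by
    have := Finsupp.le_degree a (γ.erase i₀)
    have h2 : γ = γ.erase i₀ + Finsupp.single i₀ (γ i₀) := (Finsupp.erase_add_single i₀ γ).symm
    have h3 : γ.degree = (γ.erase i₀).degree + γ i₀ := by
      conv_lhs => rw [h2]
      rw [map_add, Finsupp.degree_single]
    rw [Finsupp.erase_ne ha] at this
    omega
  have h1 : (0 : ℝ) < (γ.degree + 1).choose (γ i₀) := by
    exact_mod_cast Nat.choose_pos (by have := Finsupp.le_degree i₀ γ; omega)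
  have h2 : (0 : ℝ) < (γ.degree + 1).choose (γ i₀ + 1) := by
    exact_mod_cast Nat.choose_pos (by have := Finsupp.le_degree i₀ γ; omega)
  simp only [cauchyWeight_apply, map_add, Finsupp.degree_single, Finsupp.add_apply,
    Finsupp.single_eq_same, Finsupp.single_eq_of_ne (Ne.symm ha), add_zero]
  rw [div_mul_div_comm, ← mul_div_assoc, div_le_div_iff₀ (by positivity) h1]
  have h3 : (γ a + 1) * (γ.degree + 1).choose (γ i₀)
      ≤ (γ i₀ + 1) * (γ.degree + 1).choose (γ i₀ + 1) := by
    rw [mul_comm (γ i₀ + 1), Nat.choose_succ_right_eq, mul_comm]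
    exact Nat.mul_le_mul_left _ (by omega)
  have h3' : ((γ a : ℝ) + 1) * (γ.degree + 1).choose (γ i₀)
      ≤ (γ i₀ + 1) * (γ.degree + 1).choose (γ i₀ + 1) := by exact_mod_cast h3
  calc _ = (r * r ^ γ i₀) * (((γ a : ℝ) + 1) * (γ.degree + 1).choose (γ i₀)) := by ring
    _ ≤ (r * r ^ γ i₀) * ((γ i₀ + 1) * (γ.degree + 1).choose (γ i₀ + 1)) := by gcongr
    _ = _ := by ring

/-- Formal integration in the variable `i₀`. -/
noncomputable def antideriv (i₀ : ι) : MvPowerSeries ι ℝ →ₗ[ℝ] MvPowerSeries ι ℝ where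
  toFun f := fun β => if β i₀ = 0 then 0 else coeff (β - Finsupp.single i₀ 1) f / β i₀
  map_add' f g := by
    ext β
    change (if β i₀ = 0 then (0 : ℝ) else _) = (if β i₀ = 0 then (0 : ℝ) else _) +
      (if β i₀ = 0 then (0 : ℝ) else _)
    split_ifs
    · simp
    · rw [map_add, add_div]
  map_smul' c f := by
    ext β
    change (if β i₀ = 0 then (0 : ℝ) else _) = c * (if β i₀ = 0 then (0 : ℝ) else _)
    split_ifs
    · simp
    · rw [map_smul, smul_eq_mul, mul_div_assoc]

lemma coeff_antideriv (i₀ : ι) (f : MvPowerSeries ι ℝ) (β : ι →₀ ℕ) :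
    coeff β (antideriv i₀ f)
      = if β i₀ = 0 then 0 else coeff (β - Finsupp.single i₀ 1) f / β i₀ := rfl

lemma pderiv_antideriv_self (i₀ : ι) (f : MvPowerSeries ι ℝ) :
    pderiv ℝ i₀ (antideriv i₀ f) = f := by
  ext β
  rw [coeff_pderiv, coeff_antideriv]
  have : (β i₀ : ℝ) + 1 ≠ 0 := by positivity
  simp [this]

lemma pderiv_antideriv_of_ne {i₀ a : ι} (ha : a ≠ i₀) (f : MvPowerSeries ι ℝ) :
    pderiv ℝ a (antideriv i₀ f) = antideriv i₀ (pderiv ℝ a f) := by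
  ext β
  rw [coeff_pderiv, coeff_antideriv, coeff_antideriv]
  simp only [Finsupp.add_apply, Finsupp.single_eq_of_ne (Ne.symm ha), add_zero]
  split_ifs with h
  · simp
  · rw [coeff_pderiv]
    have h1 : Finsupp.single i₀ 1 ≤ β := Finsupp.single_le_iff.2 (Nat.one_le_iff_ne_zero.2 h)
    rw [tsub_add_eq_add_tsub h1, Finsupp.tsub_apply, Finsupp.single_eq_of_ne ha, tsub_zero]
    ring

/-- For `a = i₀` the two operators do not commute on all series, because `∂₀⁻¹∂₀` loses the part
independent of `x₀`; on the range of `∂₀⁻¹` that part is zero. -/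
lemma pderiv_antideriv_antideriv (i₀ a : ι) (f : MvPowerSeries ι ℝ) :
    pderiv ℝ a (antideriv i₀ (antideriv i₀ f)) = antideriv i₀ (pderiv ℝ a (antideriv i₀ f)) := by
  by_cases ha : a = i₀
  · subst ha; rw [pderiv_antideriv_self, pderiv_antideriv_self]
  · rw [pderiv_antideriv_of_ne ha]

/-! ### Integration and differentiation as operators on the weighted algebra -/

namespace WSeries

variable (i₀ : ι) {r : ℝ} {hr : 0 < r}

lemma exists_antideriv (f : WSeries (cauchyWeight i₀ hr)) :
    ∃ hf : antideriv i₀ f.val ∈ weightedSummable (cauchyWeight i₀ hr),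
      ‖mk _ hf‖ ≤ r * ‖f‖ := by
  refine norm_le_of_coeff_le (g := f.val) f.2 hr.le (fun β => β - Finsupp.single i₀ 1)
    {β | β i₀ ≠ 0} ?_ ?_ ?_
  · intro β hβ γ hγ h
    have h1 : Finsupp.single i₀ 1 ≤ β := Finsupp.single_le_iff.2 (Nat.one_le_iff_ne_zero.2 hβ)
    have h2 : Finsupp.single i₀ 1 ≤ γ := Finsupp.single_le_iff.2 (Nat.one_le_iff_ne_zero.2 hγ)
    exact (tsub_left_inj h1 h2).1 h
  · intro β hβ
    rw [coeff_antideriv, if_pos (not_not.1 hβ)]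
  · intro β hβ
    obtain ⟨γ, rfl⟩ : ∃ γ, β = γ + Finsupp.single i₀ 1 := ⟨β - Finsupp.single i₀ 1,
      (tsub_add_cancel_of_le (Finsupp.single_le_iff.2 (Nat.one_le_iff_ne_zero.2 hβ))).symm⟩
    rw [coeff_antideriv, if_neg hβ, add_tsub_cancel_right, abs_div]
    have h := cauchyWeight_shift_le i₀ hr γ
    simp only [Finsupp.add_apply, Finsupp.single_eq_same, Nat.cast_add, Nat.cast_one]
    rw [abs_of_pos (by positivity : (0 : ℝ) < (γ i₀ : ℝ) + 1)]
    calc _ = |coeff γ f.val| * ((cauchyWeight i₀ hr).toFun (γ + Finsupp.single i₀ 1)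
          / (γ i₀ + 1)) := by ring
      _ ≤ |coeff γ f.val| * (r * (cauchyWeight i₀ hr).toFun γ) := by gcongr
      _ = _ := by ring

lemma exists_pderiv_antideriv {a : ι} (ha : a ≠ i₀) (f : WSeries (cauchyWeight i₀ hr)) :
    ∃ hf : pderiv ℝ a (antideriv i₀ f.val) ∈ weightedSummable (cauchyWeight i₀ hr),
      ‖mk _ hf‖ ≤ r * ‖f‖ := by
  refine norm_le_of_coeff_le (g := f.val) f.2 hr.le
    (fun β => β - Finsupp.single i₀ 1 + Finsupp.single a 1) {β | β i₀ ≠ 0} ?_ ?_ ?_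
  · intro β hβ γ hγ h
    have h1 : Finsupp.single i₀ 1 ≤ β := Finsupp.single_le_iff.2 (Nat.one_le_iff_ne_zero.2 hβ)
    have h2 : Finsupp.single i₀ 1 ≤ γ := Finsupp.single_le_iff.2 (Nat.one_le_iff_ne_zero.2 hγ)
    exact (tsub_left_inj h1 h2).1 (add_right_cancel h)
  · intro β hβ
    rw [pderiv_antideriv_of_ne ha, coeff_antideriv, if_pos (not_not.1 hβ)]
  · intro β hβ
    obtain ⟨γ, rfl⟩ : ∃ γ, β = γ + Finsupp.single i₀ 1 := ⟨β - Finsupp.single i₀ 1,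
      (tsub_add_cancel_of_le (Finsupp.single_le_iff.2 (Nat.one_le_iff_ne_zero.2 hβ))).symm⟩
    rw [pderiv_antideriv_of_ne ha, coeff_antideriv, if_neg hβ, add_tsub_cancel_right, coeff_pderiv,
      abs_div, abs_mul]
    have h := cauchyWeight_swap_le ha hr γ
    simp only [Finsupp.add_apply, Finsupp.single_eq_same, Nat.cast_add, Nat.cast_one]
    rw [abs_of_pos (by positivity : (0 : ℝ) < (γ i₀ : ℝ) + 1),
      abs_of_pos (by positivity : (0 : ℝ) < (γ a : ℝ) + 1)]
    calc _ = |coeff (γ + Finsupp.single a 1) f.val| * ((γ a + 1) / (γ i₀ + 1) *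
          (cauchyWeight i₀ hr).toFun (γ + Finsupp.single i₀ 1)) := by ring
      _ ≤ |coeff (γ + Finsupp.single a 1) f.val| *
          (r * (cauchyWeight i₀ hr).toFun (γ + Finsupp.single a 1)) := by gcongr
      _ = _ := by ring

/-- Integration in the variable `i₀`, as a bounded operator. -/
noncomputable def integral : WSeries (cauchyWeight i₀ hr) →L[ℝ] WSeries (cauchyWeight i₀ hr) :=
  LinearMap.mkContinuous
    { toFun := fun f => mk _ (exists_antideriv i₀ f).1
      map_add' := fun f g => val_injective (by simp)
      map_smul' := fun c f => val_injective (by simp) } r fun f => (exists_antideriv i₀ f).2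

@[simp] lemma val_integral (f : WSeries (cauchyWeight i₀ hr)) :
    (integral i₀ f).val = antideriv i₀ f.val := rfl

open Classical in
/-- The operator `∂_a ∂_{i₀}⁻¹`, as a bounded operator. -/
noncomputable def derivIntegral (a : ι) :
    WSeries (cauchyWeight i₀ hr) →L[ℝ] WSeries (cauchyWeight i₀ hr) :=
  -- `∂₀∂₀⁻¹` is the identity. It is the only one of these operators that does not become small with
  -- `r`, and it carries the principal part of the equations.
  if ha : a = i₀ then ContinuousLinearMap.id ℝ _ else
  LinearMap.mkContinuous
    { toFun := fun f => mk _ (exists_pderiv_antideriv i₀ ha f).1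
      map_add' := fun f g => val_injective (by simp)
      map_smul' := fun c f => val_injective (by simp) } r
    fun f => (exists_pderiv_antideriv i₀ ha f).2

lemma derivIntegral_self : derivIntegral i₀ i₀ = ContinuousLinearMap.id ℝ
    (WSeries (cauchyWeight i₀ hr)) := dif_pos rfl

lemma val_derivIntegral (a : ι) (f : WSeries (cauchyWeight i₀ hr)) :
    (derivIntegral i₀ a f).val = pderiv ℝ a (antideriv i₀ f.val) := by
  unfold derivIntegral
  split_ifs with h
  · subst h; rw [pderiv_antideriv_self]; rfl
  · rfl

lemma norm_derivIntegral_le {a : ι} (ha : a ≠ i₀) :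
    ‖(derivIntegral i₀ a : WSeries (cauchyWeight i₀ hr) →L[ℝ] _)‖ ≤ r := by
  rw [derivIntegral, dif_neg ha]
  exact LinearMap.mkContinuous_norm_le _ hr.le _

lemma derivIntegral_integral (a : ι) (f : WSeries (cauchyWeight i₀ hr)) :
    derivIntegral i₀ a (integral i₀ f) = integral i₀ (derivIntegral i₀ a f) :=
  val_injective (by
    rw [val_derivIntegral, val_integral, val_integral, val_derivIntegral,
      pderiv_antideriv_antideriv])

lemma coeff_zero_integral (f : WSeries (cauchyWeight i₀ hr)) :
    coeff 0 (integral i₀ f).val = 0 := by simp [coeff_antideriv]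

lemma coeff_zero_derivIntegral {a : ι} (ha : a ≠ i₀) (f : WSeries (cauchyWeight i₀ hr)) :
    coeff 0 (derivIntegral i₀ a f).val = 0 := by
  rw [val_derivIntegral, pderiv_antideriv_of_ne ha]; simp [coeff_antideriv]

/-- `g` is the formal partial derivative of `f` in the variable `a`. -/
def IsPderiv {w : SubmultWeight ι} (a : ι) (f g : WSeries w) : Prop := pderiv ℝ a f.val = g.val

namespace IsPderiv

variable {w : SubmultWeight ι} {a : ι} {f f' g g' : WSeries w}

lemma add (hf : IsPderiv a f f') (hg : IsPderiv a g g') : IsPderiv a (f + g) (f' + g') := by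
  unfold IsPderiv at *; simp [hf, hg]

lemma mul (hf : IsPderiv a f f') (hg : IsPderiv a g g') :
    IsPderiv a (f * g) (f' * g + f * g') := by
  unfold IsPderiv at *
  rw [map_mul, Derivation.leibniz, hf, hg]
  simp only [map_add, map_mul, smul_eq_mul]
  ring

lemma smul (c : ℝ) (hf : IsPderiv a f f') : IsPderiv a (c • f) (c • f') := by
  unfold IsPderiv at *; simp [hf]

lemma algebraMap (c : ℝ) : IsPderiv a (algebraMap ℝ (WSeries w) c) 0 := by
  unfold IsPderiv; rw [AlgHom.commutes]; simp

lemma sum {κ : Type*} {s : Finset κ} {f f' : κ → WSeries w}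
    (h : ∀ k ∈ s, IsPderiv a (f k) (f' k)) : IsPderiv a (∑ k ∈ s, f k) (∑ k ∈ s, f' k) := by
  unfold IsPderiv at *
  rw [map_sum, map_sum, map_sum]
  exact sum_congr rfl h

end IsPderiv

lemma isPderiv_integral (a : ι) (f : WSeries (cauchyWeight i₀ hr)) :
    IsPderiv a (integral i₀ f) (derivIntegral i₀ a f) := (val_derivIntegral i₀ a f).symm

/-! ### Convergence and evaluation on a polydisc -/

section eval

variable [Fintype ι] {y : ι → ℝ}

-- As `r ≤ 1`, `r^{|α|} ≤ r^{α₀}`, and the binomial coefficient is at most `2^{|α|}`; hence all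
-- series of the algebra converge on the polydisc of radius `r/2`.
omit [Fintype ι] in
lemma pow_degree_le_cauchyWeight (hr1 : r ≤ 1) (α : ι →₀ ℕ) :
    (r / 2) ^ α.degree ≤ (cauchyWeight i₀ hr).toFun α := by
  rw [cauchyWeight_apply, div_pow]
  have h1 : (0 : ℝ) < α.degree.choose (α i₀) := by
    exact_mod_cast Nat.choose_pos (Finsupp.le_degree i₀ α)
  exact div_le_div₀ (by positivity)
    (pow_le_pow_of_le_one hr.le hr1 (Finsupp.le_degree i₀ α)) h1
    (by exact_mod_cast Nat.choose_le_two_pow _ _)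

variable {i₀}

omit [Fintype ι] in
lemma summable_pow_degree (hr1 : r ≤ 1) (f : WSeries (cauchyWeight i₀ hr)) :
    Summable fun α => |coeff α f.val| * (r / 2) ^ α.degree :=
  Summable.of_nonneg_of_le (fun α => by positivity)
    (fun α => mul_le_mul_of_nonneg_left (pow_degree_le_cauchyWeight i₀ hr1 α) (abs_nonneg _))
    f.summable

lemma summable_eval (hr1 : r ≤ 1) (hy : ∀ i, |y i| ≤ r / 2) (f : WSeries (cauchyWeight i₀ hr)) :
    Summable fun α => ‖coeff α f.val * ∏ i, y i ^ α i‖ := by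
  refine Summable.of_nonneg_of_le (fun α => norm_nonneg _) (fun α => ?_)
    (summable_pow_degree hr1 f)
  rw [norm_mul]
  exact mul_le_mul_of_nonneg_left (prod_pow_le hy α) (norm_nonneg _)

/-- Evaluation at a point of the polydisc of convergence. -/
noncomputable def eval (hr1 : r ≤ 1) (hy : ∀ i, |y i| ≤ r / 2) :
    WSeries (cauchyWeight i₀ hr) →ₐ[ℝ] ℝ where
  toFun f := evalSeries f.val y
  map_one' := by
    classical
    rw [map_one, evalSeries, tsum_eq_single 0]
    · simp
    · intro α hα; rw [coeff_one, if_neg hα, zero_mul]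
  map_mul' f g := by
    classical
    have hf := summable_eval hr1 hy f
    have hg := summable_eval hr1 hy g
    unfold evalSeries
    rw [Summable.tsum_mul_tsum_eq_tsum_sum_antidiagonal hf.of_norm hg.of_norm
      (summable_mul_of_summable_norm hf hg)]
    congr 1
    ext γ
    rw [map_mul, coeff_mul, sum_mul]
    refine sum_congr rfl fun kl hkl => ?_
    rw [HasAntidiagonal.mem_antidiagonal] at hkl
    rw [← hkl]
    simp only [Finsupp.add_apply, pow_add, prod_mul_distrib]
    ring
  map_zero' := by simp [evalSeries]
  map_add' f g := by
    unfold evalSeries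
    rw [← Summable.tsum_add (summable_eval hr1 hy f).of_norm (summable_eval hr1 hy g).of_norm]
    congr 1
    ext α
    rw [map_add, map_add, add_mul]
  commutes' c := by
    classical
    rw [AlgHom.commutes, evalSeries, tsum_eq_single 0]
    · simp [MvPowerSeries.algebraMap_apply]
    · intro α hα; rw [MvPowerSeries.algebraMap_apply, coeff_C, if_neg hα, zero_mul]

lemma evalSeries_zero (f : MvPowerSeries ι ℝ) : evalSeries f 0 = coeff 0 f := by
  classical
  rw [evalSeries, tsum_eq_single 0]
  · simp
  · intro α hα
    obtain ⟨i, hi⟩ := Finsupp.ne_iff.1 hα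
    rw [Finset.prod_eq_zero (mem_univ i) (by simpa using hi), mul_zero]

end eval

end WSeries

end CauchyWeight

/-! ### The curvature tensor as a polynomial in the jet of the metric -/

section JetCurvature

variable {ι : Type*}

section Linear

variable {M N : Type*} [AddCommGroup M] [Module ℝ M] [AddCommGroup N] [Module ℝ N]

/-- Christoffel symbols of the first kind, from the first derivatives `dG a i j = ∂_a G_{ij}`. -/
noncomputable def lowerChristoffel (dG : ι → ι → ι → M) (i j l : ι) : M :=
  (1 / 2 : ℝ) • (dG i j l + dG j i l - dG l i j)

/-- The part of the curvature tensor that is linear in the second derivatives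
`ddG a b i j = ∂_a ∂_b G_{ij}`. -/
noncomputable def linearCurv (ddG : ι → ι → ι → ι → M) (i j k l : ι) : M :=
  lowerChristoffel (ddG i) j k l - lowerChristoffel (ddG j) i k l

lemma map_linearCurv (φ : M →ₗ[ℝ] N) (ddG : ι → ι → ι → ι → M) (i j k l : ι) :
    φ (linearCurv ddG i j k l) = linearCurv (fun a b c d => φ (ddG a b c d)) i j k l := by
  simp [linearCurv, lowerChristoffel]

lemma linearCurv_add (D D' : ι → ι → ι → ι → M) (i j k l : ι) :
    linearCurv (fun a b c d => D a b c d + D' a b c d) i j k l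
      = linearCurv D i j k l + linearCurv D' i j k l := by
  simp only [linearCurv, lowerChristoffel]
  module

end Linear

variable {R : Type*} [CommRing R] [Algebra ℝ R]

/-- The part of the curvature tensor that is quadratic in the first derivatives. -/
noncomputable def quadraticCurv [Fintype ι] (Gi : Matrix ι ι R) (dG : ι → ι → ι → R)
    (i j k l : ι) : R :=
  -- Lowering the index under the derivative gives `G_{nl} ∂ᵢΓ_{jk}ⁿ = ∂ᵢΓ_{jk,l} - Γ_{jk}ⁿ
  -- ∂ᵢG_{nl}`. The last term is collected here with the product of Christoffel symbols.
  ∑ n, ∑ q, Gi n q * (lowerChristoffel dG j k q * (lowerChristoffel dG i n l - dG i n l)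
    - lowerChristoffel dG i k q * (lowerChristoffel dG j n l - dG j n l))

/-- The curvature tensor of a metric, from the inverse of the metric and its first and second
derivatives. -/
noncomputable def jetCurv [Fintype ι] (Gi : Matrix ι ι R) (dG : ι → ι → ι → R)
    (ddG : ι → ι → ι → ι → R) (i j k l : ι) : R :=
  linearCurv ddG i j k l + quadraticCurv Gi dG i j k l

variable {S : Type*} [CommRing S] [Algebra ℝ S]

lemma map_lowerChristoffel (φ : R →ₐ[ℝ] S) (dG : ι → ι → ι → R) (i j l : ι) :
    φ (lowerChristoffel dG i j l) = lowerChristoffel (fun a b c => φ (dG a b c)) i j l := by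
  simp [lowerChristoffel]

lemma map_jetCurv [Fintype ι] (φ : R →ₐ[ℝ] S) (Gi : Matrix ι ι R) (dG : ι → ι → ι → R)
    (ddG : ι → ι → ι → ι → R) (i j k l : ι) :
    φ (jetCurv Gi dG ddG i j k l) = jetCurv (Gi.map φ) (fun a b c => φ (dG a b c))
      (fun a b c d => φ (ddG a b c d)) i j k l := by
  simp [jetCurv, linearCurv, quadraticCurv, map_lowerChristoffel]

lemma lowerChristoffel_smul (c : ℝ) (dG : ι → ι → ι → R) (i j l : ι) :
    lowerChristoffel (fun a b d => c • dG a b d) i j l = c • lowerChristoffel dG i j l := by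
  simp only [lowerChristoffel]
  module

/-- The effect of the dilation `x ↦ c x` of coordinates: the expression has total degree two in
derivatives. -/
lemma jetCurv_smul [Fintype ι] (c : ℝ) (Gi : Matrix ι ι R) (dG : ι → ι → ι → R)
    (ddG : ι → ι → ι → ι → R) (i j k l : ι) :
    jetCurv Gi (fun a b d => c • dG a b d) (fun a b d e => (c ^ 2) • ddG a b d e) i j k l
      = (c ^ 2) • jetCurv Gi dG ddG i j k l := by
  simp only [jetCurv, linearCurv, quadraticCurv, lowerChristoffel_smul, smul_add, smul_sub,
    Finset.smul_sum]
  congr 1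
  refine Finset.sum_congr rfl fun n _ => Finset.sum_congr rfl fun q _ => ?_
  simp only [← smul_sub, smul_mul_assoc, mul_smul_comm, smul_smul, pow_two]

end JetCurvature

/-! ### The curvature of a metric in coordinates, computed from its jet -/

section Partials

variable {E : Type*} [NormedAddCommGroup E] [NormedSpace ℝ E] [FiniteDimensional ℝ E]

/-- `f` is differentiable at `y` with partial derivatives `f'`. -/
def HasPartials (f : E → ℝ) (f' : Idx E → ℝ) (y : E) : Prop :=
  DifferentiableAt ℝ f y ∧ ∀ a, partialDeriv a f y = f' a

namespace HasPartials

variable {f g : E → ℝ} {f' g' : Idx E → ℝ} {y : E}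

lemma mul (hf : HasPartials f f' y) (hg : HasPartials g g' y) :
    HasPartials (fun z => f z * g z) (fun a => f' a * g y + f y * g' a) y := by
  refine ⟨hf.1.fun_mul hg.1, fun a => ?_⟩
  rw [partialDeriv, fderiv_fun_mul hf.1 hg.1]
  beta_reduce
  rw [← hf.2, ← hg.2]
  simp [partialDeriv]
  ring

lemma add (hf : HasPartials f f' y) (hg : HasPartials g g' y) :
    HasPartials (fun z => f z + g z) (fun a => f' a + g' a) y := by
  refine ⟨hf.1.fun_add hg.1, fun a => ?_⟩
  rw [partialDeriv, fderiv_fun_add hf.1 hg.1]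
  beta_reduce
  rw [← hf.2, ← hg.2]
  rfl

lemma sub (hf : HasPartials f f' y) (hg : HasPartials g g' y) :
    HasPartials (fun z => f z - g z) (fun a => f' a - g' a) y := by
  refine ⟨hf.1.fun_sub hg.1, fun a => ?_⟩
  rw [partialDeriv, fderiv_fun_sub hf.1 hg.1]
  beta_reduce
  rw [← hf.2, ← hg.2]
  rfl

lemma const_smul (c : ℝ) (hf : HasPartials f f' y) :
    HasPartials (fun z => c • f z) (fun a => c • f' a) y := by
  refine ⟨hf.1.fun_const_smul c, fun a => ?_⟩
  rw [partialDeriv, fderiv_fun_const_smul hf.1]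
  beta_reduce
  rw [← hf.2]
  rfl

lemma sum {κ : Type*} {s : Finset κ} {f : κ → E → ℝ} {f' : κ → Idx E → ℝ}
    (h : ∀ k ∈ s, HasPartials (f k) (f' k) y) :
    HasPartials (fun z => ∑ k ∈ s, f k z) (fun a => ∑ k ∈ s, f' k a) y := by
  refine ⟨DifferentiableAt.fun_sum fun k hk => (h k hk).1, fun a => ?_⟩
  rw [partialDeriv, fderiv_fun_sum fun k hk => (h k hk).1, _root_.sum_apply]
  exact Finset.sum_congr rfl fun k hk => (h k hk).2 a

lemma congr_of_eventuallyEq (hf : HasPartials f f' y) (h : g =ᶠ[nhds y] f) :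
    HasPartials g f' y :=
  ⟨hf.1.congr_of_eventuallyEq h, fun a => by rw [← hf.2, partialDeriv, h.fderiv_eq]; rfl⟩

lemma of_differentiableAt (hf : DifferentiableAt ℝ f y) :
    HasPartials f (fun a => partialDeriv a f y) y := ⟨hf, fun _ => rfl⟩

lemma unique (hf : HasPartials f f' y) (hf' : HasPartials f g' y) (a : Idx E) : f' a = g' a := by
  rw [← hf.2, hf'.2]

end HasPartials

lemma christoffel_eq {G : E → Matrix (Idx E) (Idx E) ℝ} {z : E} {dG : Idx E → Idx E → Idx E → ℝ}
    (hdG : ∀ i j, HasPartials (fun z => G z i j) (fun a => dG a i j) z) (i j k : Idx E) :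
    christoffel G i j k z = ∑ l, (G z)⁻¹ k l * lowerChristoffel dG i j l := by
  rw [christoffel, Finset.mul_sum]
  refine Finset.sum_congr rfl fun l _ => ?_
  rw [(hdG _ _).2, (hdG _ _).2, (hdG _ _).2, lowerChristoffel, smul_eq_mul]
  ring

lemma sum_christoffel_mul {G : E → Matrix (Idx E) (Idx E) ℝ} {z : E}
    {dG : Idx E → Idx E → Idx E → ℝ}
    (hdG : ∀ i j, HasPartials (fun z => G z i j) (fun a => dG a i j) z)
    (hsymm : (G z)ᵀ = G z) (hdet : IsUnit (G z).det) (i j l : Idx E) :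
    ∑ n, christoffel G i j n z * G z n l = lowerChristoffel dG i j l := by
  simp only [christoffel_eq hdG, Finset.sum_mul]
  rw [Finset.sum_comm]
  have h : (G z)⁻¹ᵀ * G z = 1 := by
    rw [Matrix.transpose_nonsing_inv, hsymm, Matrix.nonsing_inv_mul _ hdet]
  have h2 : ∀ q, ∑ n, (G z)⁻¹ n q * G z n l = (1 : Matrix (Idx E) (Idx E) ℝ) q l := by
    intro q; rw [← h]; rfl
  calc _ = ∑ q, lowerChristoffel dG i j q * ∑ n, (G z)⁻¹ n q * G z n l := by
        refine Finset.sum_congr rfl fun q _ => ?_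
        rw [Finset.mul_sum]
        exact Finset.sum_congr rfl fun n _ => by ring
    _ = _ := by simp [h2, Matrix.one_apply]

-- The identity `Γ_{jk}ⁿG_{nl} = Γ_{jk,l}` is differentiated instead of the formula for `Γ_{jk}ⁿ`.
-- So the derivative of the inverse metric never has to be computed; its entries only have to be
-- differentiable.
open Filter Topology in
theorem curvTensorCoeff_eq_jetCurv {G : E → Matrix (Idx E) (Idx E) ℝ} {y : E}
    {dG : E → Idx E → Idx E → Idx E → ℝ} {ddG : Idx E → Idx E → Idx E → Idx E → ℝ}
    (hdG : ∀ᶠ z in 𝓝 y, ∀ i j, HasPartials (fun z => G z i j) (fun a => dG z a i j) z)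
    (hddG : ∀ a i j, HasPartials (fun z => dG z a i j) (fun b => ddG b a i j) y)
    (hsymm : ∀ᶠ z in 𝓝 y, (G z)ᵀ = G z) (hdet : ∀ᶠ z in 𝓝 y, IsUnit (G z).det)
    (hinv : ∀ i j, DifferentiableAt ℝ (fun z => (G z)⁻¹ i j) y) (i j k l : Idx E) :
    curvTensorCoeff G i j k l y = jetCurv (G y)⁻¹ (dG y) ddG i j k l := by
  have hdGy := hdG.self_of_nhds
  have hsy := hsymm.self_of_nhds
  have hdy := hdet.self_of_nhds
  have hlow : ∀ i j l, HasPartials (fun z => lowerChristoffel (dG z) i j l)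
      (fun b => lowerChristoffel (ddG b) i j l) y := fun i j l =>
    (((hddG _ _ _).add (hddG _ _ _)).sub (hddG _ _ _)).const_smul _
  have hchr : ∀ i j n, DifferentiableAt ℝ (christoffel G i j n) y := by
    intro i j n
    have h1 : DifferentiableAt ℝ
        (fun z => ∑ l, (G z)⁻¹ n l * lowerChristoffel (dG z) i j l) y :=
      DifferentiableAt.fun_sum fun q _ => (hinv n q).fun_mul (hlow i j q).1
    exact h1.congr_of_eventuallyEq (hdG.mono fun z hz => christoffel_eq hz i j n)
  -- The product rule for `Γ_{jk}ⁿ G_{nl}`, compared with the known partial derivatives of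
  -- `Γ_{jk,l}`.
  have key : ∀ a j k l, ∑ n, partialDeriv a (christoffel G j k n) y * G y n l
      = lowerChristoffel (ddG a) j k l - ∑ n, christoffel G j k n y * dG y a n l := by
    intro a j k l
    have h1 : HasPartials (fun z => ∑ n, christoffel G j k n z * G z n l)
        (fun a => ∑ n, (partialDeriv a (christoffel G j k n) y * G y n l
          + christoffel G j k n y * dG y a n l)) y :=
      HasPartials.sum fun n _ => (HasPartials.of_differentiableAt (hchr j k n)).mul (hdGy n l)
    have h2 := (hlow j k l).congr_of_eventuallyEq (g := fun z => ∑ n, christoffel G j k n z * G z n l)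
      (((hdG.and hsymm).and hdet).mono fun z hz => sum_christoffel_mul hz.1.1 hz.1.2 hz.2 j k l)
    have h3 := h1.unique h2 a
    simp only [Finset.sum_add_distrib] at h3
    linarith
  have key2 : ∀ i j k l, ∑ q, (∑ n, christoffel G j k n y * christoffel G i n q y) * G y q l
      = ∑ n, christoffel G j k n y * lowerChristoffel (dG y) i n l := by
    intro i j k l
    simp only [Finset.sum_mul]
    rw [Finset.sum_comm]
    refine Finset.sum_congr rfl fun n _ => ?_
    rw [← sum_christoffel_mul hdGy hsy hdy i n l, Finset.mul_sum]
    exact Finset.sum_congr rfl fun q _ => by ring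
  have e1 : curvTensorCoeff G i j k l y =
      ∑ n, partialDeriv i (christoffel G j k n) y * G y n l
      - ∑ n, partialDeriv j (christoffel G i k n) y * G y n l
      + (∑ q, (∑ n, christoffel G j k n y * christoffel G i n q y) * G y q l
        - ∑ q, (∑ n, christoffel G i k n y * christoffel G j n q y) * G y q l) := by
    simp only [curvTensorCoeff, curvOperatorCoeff, ← Finset.sum_sub_distrib,
      ← Finset.sum_add_distrib]
    refine Finset.sum_congr rfl fun n _ => ?_
    simp only [Finset.sum_sub_distrib]
    ring
  have e2 : quadraticCurv (G y)⁻¹ (dG y) i j k l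
      = ∑ n, christoffel G j k n y * (lowerChristoffel (dG y) i n l - dG y i n l)
        - ∑ n, christoffel G i k n y * (lowerChristoffel (dG y) j n l - dG y j n l) := by
    rw [quadraticCurv, ← Finset.sum_sub_distrib]
    refine Finset.sum_congr rfl fun n _ => ?_
    rw [christoffel_eq hdGy, christoffel_eq hdGy, Finset.sum_mul, Finset.sum_mul,
      ← Finset.sum_sub_distrib]
    exact Finset.sum_congr rfl fun q _ => by ring
  rw [e1, key, key, key2, key2, jetCurv, e2, linearCurv]
  simp only [mul_sub, Finset.sum_sub_distrib]
  ring

open Filter Topology in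
lemma partialDeriv_congr {f g : E → ℝ} {y : E} (h : f =ᶠ[𝓝 y] g) (i : Idx E) :
    partialDeriv i f y = partialDeriv i g y := by
  rw [partialDeriv, h.fderiv_eq, partialDeriv]

open Filter Topology in
lemma curvTensorCoeff_congr {G G' : E → Matrix (Idx E) (Idx E) ℝ} {y : E} (h : G =ᶠ[𝓝 y] G')
    (i j k l : Idx E) : curvTensorCoeff G i j k l y = curvTensorCoeff G' i j k l y := by
  have hc : ∀ i j k, christoffel G i j k =ᶠ[𝓝 y] christoffel G' i j k := by
    intro i j k
    filter_upwards [h.eventuallyEq_nhds] with z hz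
    have hp : ∀ a i j, partialDeriv a (fun z => G z i j) z = partialDeriv a (fun z => G' z i j) z :=
      fun a i j => partialDeriv_congr (hz.mono fun x hx => by simp [hx]) a
    simp only [christoffel, hp, hz.self_of_nhds]
  simp only [curvTensorCoeff, curvOperatorCoeff, h.self_of_nhds, partialDeriv_congr (hc _ _ _),
    (hc _ _ _).self_of_nhds]

end Partials

/-! ### Contractions of curvature arrays -/

section Contraction

variable {ι : Type*} [Fintype ι]

/-- The contraction `∑ C_{cj} C_{di} X_{ijcd}`. -/
def contr {R M : Type*} [CommRing R] [AddCommGroup M] [Module R M] (C : Matrix ι ι R)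
    (X : ι → ι → ι → ι → M) : M :=
  ∑ i, ∑ j, ∑ c, ∑ d, (C c j * C d i) • X i j c d

/-- A linear combination of contractions. -/
def contrComb {R M κ : Type*} [CommRing R] [AddCommGroup M] [Module R M] [Module ℝ M] [Fintype κ]
    (s : κ → ℝ) (C : κ → Matrix ι ι R) (X : ι → ι → ι → ι → M) : M :=
  ∑ k, s k • contr (C k) X

section Module

variable {M N : Type*} [AddCommGroup M] [Module ℝ M] [AddCommGroup N] [Module ℝ N]
  {κ : Type*} [Fintype κ] (s : κ → ℝ)

lemma map_contrComb (φ : M →ₗ[ℝ] N) (C : κ → Matrix ι ι ℝ) (X : ι → ι → ι → ι → M) :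
    φ (contrComb s C X) = contrComb s C (fun i j c d => φ (X i j c d)) := by
  simp [contrComb, contr]

lemma contrComb_add (C : κ → Matrix ι ι ℝ) (X X' : ι → ι → ι → ι → M) :
    contrComb s C (fun i j c d => X i j c d + X' i j c d)
      = contrComb s C X + contrComb s C X' := by
  simp [contrComb, contr, Finset.sum_add_distrib]

/-- The array `∑ᵤ Xᵤ vᵤ` is the image of an array with values in `τ → ℝ` under the linear map
sending the basis vectors to the `vᵤ`, and contractions commute with linear maps. -/
lemma contrComb_sum_smul {τ : Type*} [Fintype τ] (C : κ → Matrix ι ι ℝ)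
    (X : τ → ι → ι → ι → ι → ℝ) (v : τ → M) :
    contrComb s C (fun i j c d => ∑ u, X u i j c d • v u) = ∑ u, contrComb s C (X u) • v u := by
  let φ : (τ → ℝ) →ₗ[ℝ] M := ∑ u, (LinearMap.proj u : (τ → ℝ) →ₗ[ℝ] ℝ).smulRight (v u)
  have hφ : ∀ x, φ x = ∑ u, x u • v u := fun x => by simp [φ]
  have h1 := map_contrComb s φ C (fun i j c d u => X u i j c d)
  have h2 : ∀ u, contrComb s C (fun i j c d u => X u i j c d) u = contrComb s C (X u) := fun u =>
    map_contrComb s (LinearMap.proj u : (τ → ℝ) →ₗ[ℝ] ℝ) C (fun i j c d u => X u i j c d)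
  simp only [hφ, h2] at h1
  exact h1.symm

omit [Fintype ι] in
lemma linearCurv_sum_smul {τ : Type*} [Fintype τ] (X : τ → ι → ι → ι → ι → ℝ) (v : τ → M)
    (i j k l : ι) :
    linearCurv (fun a b c d => ∑ u, X u a b c d • v u) i j k l
      = ∑ u, linearCurv (X u) i j k l • v u := by
  have h : ∀ u, linearCurv (X u) i j k l • v u
      = linearCurv (fun a b c d => X u a b c d • v u) i j k l := fun u =>
    map_linearCurv (LinearMap.toSpanSingleton ℝ M (v u)) (X u) i j k l
  simp only [h]
  simp only [linearCurv, lowerChristoffel, ← Finset.smul_sum, Finset.sum_sub_distrib,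
    Finset.sum_add_distrib]

end Module

section Norm

variable {M : Type*} [NormedAddCommGroup M] [NormedSpace ℝ M] {κ : Type*} [Fintype κ]

omit [Fintype ι] in
lemma norm_linearCurv_le {D : ι → ι → ι → ι → M} {b : ℝ} (hD : ∀ i j k l, ‖D i j k l‖ ≤ b)
    (i j k l : ι) : ‖linearCurv D i j k l‖ ≤ 3 * b := by
  have h : ∀ a i j l, ‖lowerChristoffel (D a) i j l‖ ≤ 3 / 2 * b := by
    intro a i j l
    rw [lowerChristoffel, norm_smul]
    have h1 := norm_sub_le (D a i j l + D a j i l) (D a l i j)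
    have h2 := norm_add_le (D a i j l) (D a j i l)
    have := hD a i j l; have := hD a j i l; have := hD a l i j
    rw [Real.norm_of_nonneg (by norm_num)]
    linarith
  have := norm_sub_le (lowerChristoffel (D i) j k l) (lowerChristoffel (D j) i k l)
  have := h i j k l; have := h j i k l
  rw [linearCurv]
  linarith

/-- A bound for the norm of a linear combination of contractions. -/
noncomputable def contrBound (s : κ → ℝ) (C : κ → Matrix ι ι ℝ) : ℝ :=
  ∑ k, |s k| * ∑ i, ∑ j, ∑ c, ∑ d, |C k c j * C k d i|

lemma contrBound_nonneg (s : κ → ℝ) (C : κ → Matrix ι ι ℝ) : 0 ≤ contrBound s C := by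
  unfold contrBound; positivity

lemma norm_contrComb_le (s : κ → ℝ) (C : κ → Matrix ι ι ℝ) {X : ι → ι → ι → ι → M} {b : ℝ}
    (hX : ∀ i j c d, ‖X i j c d‖ ≤ b) : ‖contrComb s C X‖ ≤ contrBound s C * b := by
  unfold contrComb contrBound contr
  rw [Finset.sum_mul]
  refine (norm_sum_le _ _).trans (Finset.sum_le_sum fun k _ => ?_)
  rw [norm_smul, Real.norm_eq_abs, mul_assoc]
  refine mul_le_mul_of_nonneg_left ?_ (abs_nonneg _)
  simp only [Finset.sum_mul]
  refine (norm_sum_le _ _).trans (Finset.sum_le_sum fun i _ => ?_)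
  refine (norm_sum_le _ _).trans (Finset.sum_le_sum fun j _ => ?_)
  refine (norm_sum_le _ _).trans (Finset.sum_le_sum fun c _ => ?_)
  refine (norm_sum_le _ _).trans (Finset.sum_le_sum fun d _ => ?_)
  rw [norm_smul, Real.norm_eq_abs]
  exact mul_le_mul_of_nonneg_left (hX _ _ _ _) (abs_nonneg _)

end Norm

lemma map_contrComb_algHom {R S κ : Type*} [CommRing R] [Algebra ℝ R] [CommRing S] [Algebra ℝ S]
    [Fintype κ] (φ : R →ₐ[ℝ] S) (s : κ → ℝ) (C : κ → Matrix ι ι R) (X : ι → ι → ι → ι → R) :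
    φ (contrComb s C X) = contrComb s (fun k => (C k).map φ) (fun i j c d => φ (X i j c d)) := by
  simp [contrComb, contr]

end Contraction

/-! ### Smooth dependence of determinants and inverses on matrix entries -/

section MatrixSmooth

variable {P : Type*} [NormedAddCommGroup P] [NormedSpace ℝ P]
  {R : Type*} [NormedCommRing R] [NormedAlgebra ℝ R] {ι : Type*} [Fintype ι] [DecidableEq ι]
  {f : P → Matrix ι ι R} {p : P} {n : ℕ∞ω}

lemma contDiffAt_det (hf : ∀ i j, ContDiffAt ℝ n (fun q => f q i j) p) :
    ContDiffAt ℝ n (fun q => (f q).det) p := by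
  simp only [Matrix.det_apply']
  refine ContDiffAt.sum fun σ _ => ContDiffAt.mul contDiffAt_const ?_
  exact contDiffAt_prod fun i _ => hf _ _

lemma contDiffAt_adjugate (hf : ∀ i j, ContDiffAt ℝ n (fun q => f q i j) p) (i j : ι) :
    ContDiffAt ℝ n (fun q => (f q).adjugate i j) p := by
  simp only [Matrix.adjugate_apply]
  refine contDiffAt_det fun k l => ?_
  by_cases h : k = j
  · subst h; simpa using contDiffAt_const
  · simpa [Matrix.updateRow_apply, h] using hf k l

/-- Over a commutative Banach algebra the inverse is the adjugate, which is polynomial in the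
entries, times the inverse of the determinant, and inversion of ring elements is smooth at units. -/
lemma contDiffAt_matrix_inv [CompleteSpace R] (hf : ∀ i j, ContDiffAt ℝ n (fun q => f q i j) p)
    (hp : IsUnit (f p).det) (i j : ι) : ContDiffAt ℝ n (fun q => (f q)⁻¹ i j) p := by
  obtain ⟨u, hu⟩ := hp
  have h1 : ContDiffAt ℝ n (fun q => Ring.inverse (f q).det) p := by
    have h2 : ContDiffAt ℝ n Ring.inverse ((f p).det) := hu ▸ contDiffAt_ringInverse ℝ u
    exact h2.comp p (contDiffAt_det hf)
  simp only [Matrix.inv_def, Matrix.smul_apply, smul_eq_mul]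
  exact h1.mul (contDiffAt_adjugate hf i j)

end MatrixSmooth

/-! ### First-order calculus at the origin -/

section HasLin

variable {P : Type*} [NormedAddCommGroup P] [NormedSpace ℝ P]
  {Y : Type*} [NormedCommRing Y] [NormedAlgebra ℝ Y]

/-- `f` vanishes at the origin and is strictly differentiable there with derivative `L`. -/
def HasLin (f : P → Y) (L : P →L[ℝ] Y) : Prop := f 0 = 0 ∧ HasStrictFDerivAt f L 0

/-- `f` is strictly differentiable at the origin, with value `c` there. -/
def HasValue (f : P → Y) (c : Y) : Prop := f 0 = c ∧ ∃ L : P →L[ℝ] Y, HasStrictFDerivAt f L 0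

namespace HasLin

variable {f g : P → Y} {L L' : P →L[ℝ] Y}

lemma clm (L : P →L[ℝ] Y) : HasLin (fun p => L p) L := ⟨map_zero L, L.hasStrictFDerivAt⟩

lemma add (hf : HasLin f L) (hg : HasLin g L') : HasLin (fun p => f p + g p) (L + L') :=
  ⟨by simp [hf.1, hg.1], hf.2.fun_add hg.2⟩

lemma sub (hf : HasLin f L) (hg : HasLin g L') : HasLin (fun p => f p - g p) (L - L') :=
  ⟨by simp [hf.1, hg.1], hf.2.fun_sub hg.2⟩

lemma smul (c : ℝ) (hf : HasLin f L) : HasLin (fun p => c • f p) (c • L) :=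
  ⟨by simp [hf.1], hf.2.fun_const_smul c⟩

lemma sum {κ : Type*} {s : Finset κ} {f : κ → P → Y} {L : κ → P →L[ℝ] Y}
    (h : ∀ k ∈ s, HasLin (f k) (L k)) : HasLin (fun p => ∑ k ∈ s, f k p) (∑ k ∈ s, L k) :=
  ⟨Finset.sum_eq_zero fun k hk => (h k hk).1, HasStrictFDerivAt.fun_sum fun k hk => (h k hk).2⟩

/-- Quadratic terms do not contribute to the linearization at the origin. -/
lemma mul (hf : HasLin f L) (hg : HasLin g L') : HasLin (fun p => f p * g p) 0 :=
  ⟨by simp [hf.1], (hf.2.fun_mul hg.2).congr_fderiv (by ext; simp [hf.1, hg.1])⟩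

/-- As `f` vanishes at the origin, only the value of the coefficient `g` there enters, not its
derivative. -/
lemma value_mul {c : ℝ} (hg : HasValue g (algebraMap ℝ Y c)) (hf : HasLin f L) :
    HasLin (fun p => g p * f p) (c • L) := by
  obtain ⟨h0, L', hL'⟩ := hg
  refine ⟨by simp [hf.1], (hL'.fun_mul hf.2).congr_fderiv ?_⟩
  ext p
  simp [h0, hf.1, Algebra.smul_def]

end HasLin

namespace HasValue

variable {f g : P → Y} {c d : Y}

lemma const (c : Y) : HasValue (fun _ : P => c) c := ⟨rfl, 0, hasStrictFDerivAt_const _ _⟩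

lemma mul (hf : HasValue f c) (hg : HasValue g d) : HasValue (fun p => f p * g p) (c * d) := by
  obtain ⟨h, L, hL⟩ := hf
  obtain ⟨h', L', hL'⟩ := hg
  exact ⟨by simp [h, h'], _, hL.fun_mul hL'⟩

lemma sum {κ : Type*} {s : Finset κ} {f : κ → P → Y} {c : κ → Y}
    (h : ∀ k ∈ s, HasValue (f k) (c k)) :
    HasValue (fun p => ∑ k ∈ s, f k p) (∑ k ∈ s, c k) := by
  choose! L hL using fun k hk => (h k hk).2
  exact ⟨Finset.sum_congr rfl fun k hk => (h k hk).1, _, HasStrictFDerivAt.fun_sum hL⟩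

end HasValue

end HasLin

/-! ### The jet of a perturbed metric -/

section MetricJet

variable {ι : Type*} [Fintype ι] [DecidableEq ι] {R : Type*} [CommRing R] [Algebra ℝ R]

/-- A real matrix, viewed as a matrix over an `ℝ`-algebra. -/
abbrev constMatrix (R : Type*) [CommRing R] [Algebra ℝ R] (M : Matrix ι ι ℝ) : Matrix ι ι R :=
  M.map (algebraMap ℝ R)

/-- The metric `B + h + ¼ h B⁻¹ h`. -/
noncomputable def metricOf (B Bi : Matrix ι ι ℝ) (h : Matrix ι ι R) : Matrix ι ι R :=
  constMatrix R B + (h + (1 / 4 : ℝ) • (h * constMatrix R Bi * h))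

/-- First derivatives of `metricOf`. -/
noncomputable def metricD (Bi : Matrix ι ι ℝ) (h : Matrix ι ι R) (h1 : ι → Matrix ι ι R) (a : ι) :
    Matrix ι ι R :=
  h1 a + (1 / 4 : ℝ) • (h1 a * constMatrix R Bi * h + h * constMatrix R Bi * h1 a)

/-- Second derivatives of `metricOf`. -/
noncomputable def metricDD (Bi : Matrix ι ι ℝ) (h : Matrix ι ι R) (h1 : ι → Matrix ι ι R)
    (h2 : ι → ι → Matrix ι ι R) (b a : ι) : Matrix ι ι R :=
  h2 b a + (1 / 4 : ℝ) • ((h2 b a * constMatrix R Bi * h + h1 a * constMatrix R Bi * h1 b)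
    + (h1 b * constMatrix R Bi * h1 a + h * constMatrix R Bi * h2 b a))

/-- The coframe `1 + ½ B⁻¹ h`. -/
noncomputable def coframe (Bi : Matrix ι ι ℝ) (h : Matrix ι ι R) : Matrix ι ι R :=
  1 + (1 / 2 : ℝ) • (constMatrix R Bi * h)

/-- Expanding the left side yields `B + ½h + ½h + ¼ hB⁻¹h`; this explains the quadratic term in the
metric. That metric depends polynomially on `h` and comes with an explicit coframe, so no square
root has to be taken. -/
lemma coframe_metric {B Bi : Matrix ι ι ℝ} (hB : Bᵀ = B) (hBi : B * Bi = 1) {h : Matrix ι ι R}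
    (hh : hᵀ = h) :
    (coframe Bi h)ᵀ * constMatrix R B * coframe Bi h = metricOf B Bi h := by
  have hBi' : Biᵀ = Bi := by
    rw [← Matrix.inv_eq_right_inv hBi, Matrix.transpose_nonsing_inv, hB]
  have e1 : constMatrix R B * constMatrix R Bi = 1 := by
    rw [← Matrix.map_mul, hBi, Matrix.map_one _ (map_zero _) (map_one _)]
  have e2 : constMatrix R Bi * constMatrix R B = 1 := by
    rw [← Matrix.map_mul, mul_eq_one_comm.1 hBi, Matrix.map_one _ (map_zero _) (map_one _)]
  have e3 : (constMatrix R Bi)ᵀ = constMatrix R Bi := by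
    rw [constMatrix, ← Matrix.transpose_map, hBi']
  have e5 : ∀ X : Matrix ι ι R, constMatrix R B * (constMatrix R Bi * X) = X := by
    intro X; rw [← mul_assoc, e1, one_mul]
  unfold coframe metricOf
  rw [Matrix.transpose_add, Matrix.transpose_one, Matrix.transpose_smul, Matrix.transpose_mul, hh,
    e3]
  simp only [add_mul, mul_add, one_mul, mul_one, Matrix.smul_mul, Matrix.mul_smul, mul_assoc, e5, e2]
  module

variable {S : Type*} [CommRing S] [Algebra ℝ S]

omit [Fintype ι] [DecidableEq ι] in
lemma map_constMatrix (φ : R →ₐ[ℝ] S) (M : Matrix ι ι ℝ) :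
    (constMatrix R M).map φ = constMatrix S M := by
  ext; simp

omit [DecidableEq ι] in
lemma map_metricOf (φ : R →ₐ[ℝ] S) (B Bi : Matrix ι ι ℝ) (h : Matrix ι ι R) :
    (metricOf B Bi h).map φ = metricOf B Bi (h.map φ) := by
  ext i j
  simp [metricOf, Matrix.mul_apply]

lemma map_coframe (φ : R →ₐ[ℝ] S) (Bi : Matrix ι ι ℝ) (h : Matrix ι ι R) :
    (coframe Bi h).map φ = coframe Bi (h.map φ) := by
  ext i j
  simp [coframe, Matrix.mul_apply, Matrix.one_apply, apply_ite φ]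

section Calculus

variable {P : Type*} [NormedAddCommGroup P] [NormedSpace ℝ P]
  {Y : Type*} [NormedCommRing Y] [NormedAlgebra ℝ Y]

omit [DecidableEq ι] in
lemma hasLin_mul_const_mul {f g : P → Matrix ι ι Y} {L L' : ι → ι → P →L[ℝ] Y}
    (hf : ∀ i j, HasLin (fun p => f p i j) (L i j)) (hg : ∀ i j, HasLin (fun p => g p i j) (L' i j))
    (C : Matrix ι ι ℝ) (i j : ι) :
    HasLin (fun p => (f p * constMatrix Y C * g p) i j) 0 := by
  simp only [Matrix.mul_apply, Finset.sum_mul, Matrix.map_apply]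
  have : (0 : P →L[ℝ] Y) = ∑ _k : ι, ∑ _l : ι, 0 := by simp
  rw [this]
  refine HasLin.sum fun k _ => HasLin.sum fun l _ => ?_
  have h1 := (HasLin.value_mul (HasValue.const (algebraMap ℝ Y (C l k))) (hf i l)).mul (hg k j)
  simpa only [mul_comm (algebraMap ℝ Y (C l k))] using h1

variable {Bi : Matrix ι ι ℝ} {h : P → Matrix ι ι Y} {h1 : P → ι → Matrix ι ι Y}
  {h2 : P → ι → ι → Matrix ι ι Y} {L : ι → ι → P →L[ℝ] Y} {L1 : ι → ι → ι → P →L[ℝ] Y}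
  {L2 : ι → ι → ι → ι → P →L[ℝ] Y}

omit [DecidableEq ι] in
lemma hasLin_metricD (hh : ∀ i j, HasLin (fun p => h p i j) (L i j))
    (hh1 : ∀ a i j, HasLin (fun p => h1 p a i j) (L1 a i j)) (a i j : ι) :
    HasLin (fun p => metricD Bi (h p) (h1 p) a i j) (L1 a i j) := by
  have := (hh1 a i j).add (((hasLin_mul_const_mul (hh1 a) hh Bi i j).add
    (hasLin_mul_const_mul hh (hh1 a) Bi i j)).smul (1 / 4 : ℝ))
  refine ⟨this.1, this.2.congr_fderiv ?_⟩
  ext p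
  simp

omit [DecidableEq ι] in
lemma hasLin_metricDD (hh : ∀ i j, HasLin (fun p => h p i j) (L i j))
    (hh1 : ∀ a i j, HasLin (fun p => h1 p a i j) (L1 a i j))
    (hh2 : ∀ b a i j, HasLin (fun p => h2 p b a i j) (L2 b a i j)) (b a i j : ι) :
    HasLin (fun p => metricDD Bi (h p) (h1 p) (h2 p) b a i j) (L2 b a i j) := by
  have := (hh2 b a i j).add ((((hasLin_mul_const_mul (hh2 b a) hh Bi i j).add
    (hasLin_mul_const_mul (hh1 a) (hh1 b) Bi i j)).add
    ((hasLin_mul_const_mul (hh1 b) (hh1 a) Bi i j).add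
    (hasLin_mul_const_mul hh (hh2 b a) Bi i j))).smul (1 / 4 : ℝ))
  refine ⟨this.1, this.2.congr_fderiv ?_⟩
  ext p
  simp

omit [Fintype ι] [DecidableEq ι] in
lemma hasLin_lowerChristoffel {dG : P → ι → ι → ι → Y} {L1 : ι → ι → ι → P →L[ℝ] Y}
    (hd : ∀ a i j, HasLin (fun p => dG p a i j) (L1 a i j)) (i j l : ι) :
    HasLin (fun p => lowerChristoffel (dG p) i j l) (lowerChristoffel L1 i j l) :=
  (((hd _ _ _).add (hd _ _ _)).sub (hd _ _ _)).smul _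

-- The first derivatives of the metric vanish at the origin of parameter space, so the part
-- quadratic in them has zero derivative whatever the inverse metric does.
omit [DecidableEq ι] in
lemma hasLin_jetCurv {Gi : P → Matrix ι ι Y} {dG : P → ι → ι → ι → Y}
    {ddG : P → ι → ι → ι → ι → Y} {C : Matrix ι ι ℝ}
    (hGi : ∀ i j, HasValue (fun p => Gi p i j) (algebraMap ℝ Y (C i j)))
    (hd : ∀ a i j, HasLin (fun p => dG p a i j) (L1 a i j))
    (hdd : ∀ b a i j, HasLin (fun p => ddG p b a i j) (L2 b a i j)) (i j k l : ι) :
    HasLin (fun p => jetCurv (Gi p) (dG p) (ddG p) i j k l) (linearCurv L2 i j k l) := by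
  have hq : HasLin (fun p => quadraticCurv (Gi p) (dG p) i j k l) 0 := by
    have h0 : (0 : P →L[ℝ] Y) = ∑ n : ι, ∑ q : ι, C n q • (0 - 0) := by simp
    rw [h0]
    have hl := hasLin_lowerChristoffel hd
    exact HasLin.sum fun n _ => HasLin.sum fun q _ => (HasLin.value_mul (hGi n q)
      (((hl j k q).mul ((hl i n l).sub (hd i n l))).sub
        ((hl i k q).mul ((hl j n l).sub (hd j n l)))))
  have := ((hasLin_lowerChristoffel (fun a => hdd i a) j k l).sub
    (hasLin_lowerChristoffel (fun a => hdd j a) i k l)).add hq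
  rw [add_zero] at this
  exact this

-- The curvature vanishes at the origin of parameter space, so the contraction matrices may be
-- frozen at their values there.
omit [DecidableEq ι] in
lemma hasLin_contrComb {κ : Type*} [Fintype κ] (s : κ → ℝ) {K : P → κ → Matrix ι ι Y}
    {C : κ → Matrix ι ι ℝ} (hK : ∀ k i j, HasValue (fun p => K p k i j) (algebraMap ℝ Y (C k i j)))
    {X : P → ι → ι → ι → ι → Y} (hX : ∀ i j c d, HasLin (fun p => X p i j c d) (L2 i j c d)) :
    HasLin (fun p => contrComb s (K p) (X p)) (contrComb s C L2) := by
  refine HasLin.sum fun k _ => HasLin.smul _ ?_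
  refine HasLin.sum fun i _ => HasLin.sum fun j _ => HasLin.sum fun c _ => HasLin.sum fun d _ => ?_
  refine HasLin.value_mul ?_ (hX i j c d)
  rw [map_mul]
  exact (hK k c j).mul (hK k d i)

lemma coframe_eq_one (hh : ∀ i j, HasLin (fun p => h p i j) (L i j)) : coframe Bi (h 0) = 1 := by
  have h0 : h 0 = 0 := by ext i j; exact (hh i j).1
  simp [coframe, h0]

lemma contDiffAt_coframe {n : ℕ∞ω} (hh : ∀ i j, ContDiffAt ℝ n (fun p => h p i j) 0) (i j : ι) :
    ContDiffAt ℝ n (fun p => coframe Bi (h p) i j) 0 := by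
  simp only [coframe, Matrix.add_apply, Matrix.smul_apply, Matrix.mul_apply]
  exact contDiffAt_const.add
    ((ContDiffAt.sum fun k _ => contDiffAt_const.mul (hh k j)).const_smul _)

lemma hasValue_coframe_inv [CompleteSpace Y] (hh : ∀ i j, HasLin (fun p => h p i j) (L i j))
    (hc : ∀ i j, ContDiffAt ℝ 1 (fun p => h p i j) 0) (i j : ι) :
    HasValue (fun p => (coframe Bi (h p))⁻¹ i j) (algebraMap ℝ Y ((1 : Matrix ι ι ℝ) i j)) := by
  have h1 := coframe_eq_one (Bi := Bi) hh
  refine ⟨?_, _, (contDiffAt_matrix_inv (contDiffAt_coframe (Bi := Bi) hc)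
    (by rw [h1]; simp) i j).hasStrictFDerivAt one_ne_zero⟩
  change (coframe Bi (h 0))⁻¹ i j = _
  rw [h1, inv_one, Matrix.one_apply, Matrix.one_apply]
  split_ifs <;> simp

lemma hasValue_conj {F : P → Matrix ι ι Y}
    (hF : ∀ i j, HasValue (fun p => F p i j) (algebraMap ℝ Y ((1 : Matrix ι ι ℝ) i j)))
    (C : Matrix ι ι ℝ) (i j : ι) :
    HasValue (fun p => (F p * constMatrix Y C * (F p)ᵀ) i j) (algebraMap ℝ Y (C i j)) := by
  have e : algebraMap ℝ Y (C i j) = ∑ k, ∑ l,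
      algebraMap ℝ Y ((1 : Matrix ι ι ℝ) i l) * algebraMap ℝ Y (C l k) *
        algebraMap ℝ Y ((1 : Matrix ι ι ℝ) j k) := by
    simp only [← map_mul, ← map_sum]
    congr 1
    simp [Matrix.one_apply]
  rw [e]
  simp only [Matrix.mul_apply, Finset.sum_mul, Matrix.map_apply, Matrix.transpose_apply]
  exact HasValue.sum fun k _ => HasValue.sum fun l _ =>
    ((hF i l).mul (HasValue.const _)).mul (hF j k)

end Calculus

end MetricJet

/-! ### The perturbation of the flat metric -/

section Perturbation

open Finset

namespace WSeries

variable {ι : Type*} {w : SubmultWeight ι}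

/-- The coordinate function. -/
noncomputable def coordFn [DecidableEq ι] (w : SubmultWeight ι) (a : ι) : WSeries w :=
  mk (MvPowerSeries.X a) (by
    rw [mem_weightedSummable]
    refine summable_of_ne_finset_zero (s := {Finsupp.single a 1}) fun α hα => ?_
    rw [MvPowerSeries.coeff_X, if_neg (by simpa using hα)]
    simp)

lemma isPderiv_coordFn [DecidableEq ι] (c a : ι) :
    IsPderiv c (coordFn w a) (algebraMap ℝ (WSeries w) (if a = c then 1 else 0)) := by
  unfold IsPderiv
  rw [AlgHom.commutes, coordFn, val_mk]
  ext α
  rw [MvPowerSeries.coeff_pderiv, MvPowerSeries.coeff_X, MvPowerSeries.algebraMap_apply,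
    MvPowerSeries.coeff_C]
  by_cases h : a = c
  · subst h
    by_cases hα : α = 0
    · subst hα; simp
    · simp [hα]
  · have : α + Finsupp.single c 1 ≠ Finsupp.single a 1 := by
      intro h'
      have := DFunLike.congr_fun h' c
      simp [Finsupp.single_eq_of_ne (Ne.symm h)] at this
    simp [this, h]

/-- Entrywise formal partial derivatives. -/
def IsPderivM {m n : Type*} (a : ι) (M M' : Matrix m n (WSeries w)) : Prop :=
  ∀ i j, IsPderiv a (M i j) (M' i j)

namespace IsPderivM

variable {m : Type*} {a : ι} {M M' N N' : Matrix m m (WSeries w)}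

lemma add (hM : IsPderivM a M M') (hN : IsPderivM a N N') : IsPderivM a (M + N) (M' + N') :=
  fun i j => (hM i j).add (hN i j)

lemma smul (c : ℝ) (hM : IsPderivM a M M') : IsPderivM a (c • M) (c • M') :=
  fun i j => (hM i j).smul c

lemma mul [Fintype m] (hM : IsPderivM a M M') (hN : IsPderivM a N N') :
    IsPderivM a (M * N) (M' * N + M * N') := by
  intro i j
  simp only [Matrix.add_apply, Matrix.mul_apply, ← sum_add_distrib]
  exact IsPderiv.sum fun k _ => (hM i k).mul (hN k j)

lemma constMatrix (C : Matrix m m ℝ) : IsPderivM a (constMatrix (WSeries w) C) 0 :=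
  fun i j => IsPderiv.algebraMap (C i j)

lemma mul_const_mul [Fintype m] (hM : IsPderivM a M M') (hN : IsPderivM a N N')
    (C : Matrix m m ℝ) : IsPderivM a (M * CurvReal.constMatrix _ C * N)
      (M' * CurvReal.constMatrix _ C * N + M * CurvReal.constMatrix _ C * N') := by
  have := (hM.mul (constMatrix C)).mul hN
  simpa using this

end IsPderivM

variable [Fintype ι]

lemma isPderivM_metricOf (B Bi : Matrix ι ι ℝ) {h : Matrix ι ι (WSeries w)}
    {h1 : ι → Matrix ι ι (WSeries w)} (hh : ∀ a, IsPderivM a h (h1 a)) (a : ι) :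
    IsPderivM a (metricOf B Bi h) (metricD Bi h h1 a) := by
  have := (IsPderivM.constMatrix (a := a) (w := w) B).add
    ((hh a).add (((hh a).mul_const_mul (hh a) Bi).smul (1 / 4 : ℝ)))
  rwa [zero_add] at this

lemma isPderivM_metricD (Bi : Matrix ι ι ℝ) {h : Matrix ι ι (WSeries w)}
    {h1 : ι → Matrix ι ι (WSeries w)} {h2 : ι → ι → Matrix ι ι (WSeries w)}
    (hh : ∀ a, IsPderivM a h (h1 a)) (hh1 : ∀ b a, IsPderivM b (h1 a) (h2 b a)) (b a : ι) :
    IsPderivM b (metricD Bi h h1 a) (metricDD Bi h h1 h2 b a) :=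
  (hh1 b a).add ((((hh1 b a).mul_const_mul (hh b) Bi).add
    ((hh b).mul_const_mul (hh1 b a) Bi)).smul (1 / 4 : ℝ))

end WSeries

open WSeries

variable {ι : Type*} [Fintype ι] [DecidableEq ι]

/-- The quadratic field `-⅓ ∑ A_{jabk} x_a x_b`. -/
noncomputable def quadField (w : SubmultWeight ι) (A : ι → ι → ι → ι → ℝ) (j k : ι) : WSeries w :=
  (-1 / 3 : ℝ) • ∑ a, ∑ b, A j a b k • (coordFn w a * coordFn w b)

/-- First derivatives of `quadField`. -/
noncomputable def quadField1 (w : SubmultWeight ι) (A : ι → ι → ι → ι → ℝ) (c j k : ι) :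
    WSeries w :=
  (-1 / 3 : ℝ) • ∑ a, ∑ b, A j a b k •
    (algebraMap ℝ (WSeries w) (if a = c then 1 else 0) * coordFn w b
      + coordFn w a * algebraMap ℝ (WSeries w) (if b = c then 1 else 0))

/-- Second derivatives of `quadField`. -/
noncomputable def quadField2 (A : ι → ι → ι → ι → ℝ) (d c j k : ι) : ℝ :=
  (-1 / 3) * (A j c d k + A j d c k)

lemma isPderiv_quadField (w : SubmultWeight ι) (A : ι → ι → ι → ι → ℝ) (c j k : ι) :
    IsPderiv c (quadField w A j k) (quadField1 w A c j k) :=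
  (IsPderiv.sum fun a _ => IsPderiv.sum fun b _ =>
    ((isPderiv_coordFn c a).mul (isPderiv_coordFn c b)).smul _).smul _

lemma isPderiv_quadField1 (w : SubmultWeight ι) (A : ι → ι → ι → ι → ℝ) (d c j k : ι) :
    IsPderiv d (quadField1 w A c j k) (algebraMap ℝ _ (quadField2 A d c j k)) := by
  have h := (IsPderiv.sum (s := univ) fun a _ => IsPderiv.sum (s := univ) fun b _ =>
    ((((IsPderiv.algebraMap (w := w) (a := d) (if a = c then 1 else 0)).mul
      (isPderiv_coordFn d b)).add ((isPderiv_coordFn d a).mul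
        (IsPderiv.algebraMap (if b = c then 1 else 0)))).smul (A j a b k))).smul (-1 / 3 : ℝ)
  refine (congrArg (IsPderiv d _) ?_).mpr h
  simp only [zero_mul, zero_add, mul_zero, add_zero, ← map_mul, ← map_add, Algebra.smul_def,
    ← map_sum]
  congr 1
  simp [quadField2, mul_add, sum_add_distrib]

-- The factor `-⅓` is that of the metric in normal coordinates: after the pair symmetries are used,
-- the first Bianchi identity collects the terms into `A`.
omit [Fintype ι] [DecidableEq ι] in
lemma linearCurv_quadField2 {A : ι → ι → ι → ι → ℝ} (h1 : ∀ i j k l, A i j k l = -A j i k l)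
    (h2 : ∀ i j k l, A i j k l = A k l i j)
    (h3 : ∀ i j k l, A i j k l + A j k i l + A k i j l = 0) (i j k l : ι) :
    linearCurv (quadField2 A) i j k l = A i j k l := by
  simp only [linearCurv, lowerChristoffel, quadField2, smul_eq_mul]
  have e1 := h1 i j k l
  have e2 := h2 i j k l
  have e3 := h3 i j k l
  have f : ∀ i j k l, A i j k l = -A i j l k := fun i j k l => by
    rw [h2 i j k l, h1, h2 l k i j]
  have g : ∀ i j k l, A i j k l = A l k j i := fun i j k l => by rw [h2, h1, f, neg_neg]
  linarith [h1 i j k l, h1 j k i l, h1 k i j l, f i j k l, f j k i l, f k i j l, h2 i j k l,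
    h2 j k i l, h2 k i j l, g i j k l, g j k i l, g k i j l, h1 i j l k, h1 j k l i, h1 k i l j,
    h2 i j l k, h2 j k l i, h2 k i l j, g i j l k, g j k l i, g k i l j, h2 j i k l, h2 k j i l,
    h2 i k j l, h1 i k j l, f i k j l, f k j i l, f j i k l, g j i k l, g k j i l, g i k j l]

lemma quadField_symm (w : SubmultWeight ι) {A : ι → ι → ι → ι → ℝ}
    (h1 : ∀ i j k l, A i j k l = -A j i k l) (h2 : ∀ i j k l, A i j k l = A k l i j) (j k : ι) :
    quadField w A j k = quadField w A k j := by
  have g : ∀ i j k l, A i j k l = A l k j i := fun i j k l => by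
    rw [h2 i j k l, h1 k l i j, h2 l k i j, h1 i j l k, h2 j i l k, neg_neg]
  unfold quadField
  rw [sum_comm]
  congr 1
  refine sum_congr rfl fun a _ => sum_congr rfl fun b _ => ?_
  rw [g, mul_comm]

variable {τ : Type*} [Fintype τ]

section Fields

variable (i₀ : ι) {r : ℝ} {hr : 0 < r}

/-- The operator `(ε, U) ↦ ε q + ∑ c_u op U_u`. -/
noncomputable def fieldCLM {Y : Type*} [NormedCommRing Y] [NormedAlgebra ℝ Y] (q : Y)
    (op : Y →L[ℝ] Y) (c : τ → ℝ) : ℝ × (τ → Y) →L[ℝ] Y :=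
  (ContinuousLinearMap.fst ℝ ℝ (τ → Y)).smulRight q +
    ∑ u, c u • (op ∘L ContinuousLinearMap.proj u ∘L ContinuousLinearMap.snd ℝ ℝ (τ → Y))

lemma fieldCLM_apply {Y : Type*} [NormedCommRing Y] [NormedAlgebra ℝ Y] (q : Y)
    (op : Y →L[ℝ] Y) (c : τ → ℝ) (p : ℝ × (τ → Y)) :
    fieldCLM q op c p = p.1 • q + ∑ u, c u • op (p.2 u) := by
  simp [fieldCLM, _root_.sum_apply]

variable (A : ι → ι → ι → ι → ℝ) (H : τ → Matrix ι ι ℝ)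

/-- The perturbation `h_{jk} = ε q_{jk} + ∑ H^u_{jk} ∂₀⁻² U_u`. -/
noncomputable def pert (j k : ι) :
    ℝ × (τ → WSeries (cauchyWeight i₀ hr)) →L[ℝ] WSeries (cauchyWeight i₀ hr) :=
  fieldCLM (quadField _ A j k) (integral i₀ ∘L integral i₀) fun u => H u j k

/-- First derivatives of the perturbation. -/
noncomputable def pert1 (a j k : ι) :
    ℝ × (τ → WSeries (cauchyWeight i₀ hr)) →L[ℝ] WSeries (cauchyWeight i₀ hr) :=
  fieldCLM (quadField1 _ A a j k) (integral i₀ ∘L derivIntegral i₀ a) fun u => H u j k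

/-- Second derivatives of the perturbation. -/
noncomputable def pert2 (b a j k : ι) :
    ℝ × (τ → WSeries (cauchyWeight i₀ hr)) →L[ℝ] WSeries (cauchyWeight i₀ hr) :=
  fieldCLM (algebraMap ℝ _ (quadField2 A b a j k)) (derivIntegral i₀ b ∘L derivIntegral i₀ a)
    fun u => H u j k

variable {A H}

/-- Since `∂ₐ` and `∂₀⁻¹` commute on integrals, `∂ₐ∂₀⁻²U` can be written as `∂₀⁻¹(∂ₐ∂₀⁻¹U)`. In this
form it can be differentiated once more by a bounded operator. -/
lemma isPderiv_pert (p : ℝ × (τ → WSeries (cauchyWeight i₀ hr))) (a j k : ι) :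
    IsPderiv a (pert i₀ A H j k p) (pert1 i₀ A H a j k p) := by
  rw [pert, pert1, fieldCLM_apply, fieldCLM_apply]
  refine ((isPderiv_quadField _ A a j k).smul p.1).add (IsPderiv.sum fun u _ => ?_)
  refine IsPderiv.smul _ ?_
  have := isPderiv_integral i₀ a (integral i₀ (p.2 u))
  rwa [derivIntegral_integral] at this

lemma isPderiv_pert1 (p : ℝ × (τ → WSeries (cauchyWeight i₀ hr))) (b a j k : ι) :
    IsPderiv b (pert1 i₀ A H a j k p) (pert2 i₀ A H b a j k p) := by
  rw [pert1, pert2, fieldCLM_apply, fieldCLM_apply]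
  refine ((isPderiv_quadField1 _ A b a j k).smul p.1).add (IsPderiv.sum fun u _ => ?_)
  exact IsPderiv.smul _ (isPderiv_integral i₀ b _)

lemma pert_symm (h1 : ∀ i j k l, A i j k l = -A j i k l) (h2 : ∀ i j k l, A i j k l = A k l i j)
    (hH : ∀ u, (H u)ᵀ = H u) (p : ℝ × (τ → WSeries (cauchyWeight i₀ hr))) (j k : ι) :
    pert i₀ A H j k p = pert i₀ A H k j p := by
  have : ∀ u, H u j k = H u k j := fun u => by rw [← Matrix.transpose_apply (H u), hH]
  simp only [pert, fieldCLM_apply, this, quadField_symm _ h1 h2 j k]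

end Fields

end Perturbation

/-! ### Solving the prescribed curvature equations in the Banach algebra -/

section Solve

open Finset WSeries Filter Topology

variable {ι : Type*} [Fintype ι] [DecidableEq ι] {τ : Type*} [Fintype τ] [DecidableEq τ]
  {κ : Type*} [Fintype κ] (i₀ : ι) {r : ℝ} {hr : 0 < r}

/-- The coefficient array `dt² ⊗ H` of second derivatives concentrated in the direction `i₀`. -/
def secondDeriv (H : Matrix ι ι ℝ) (b a j k : ι) : ℝ := if b = i₀ ∧ a = i₀ then H j k else 0

-- One of the two factors differentiates in a direction other than `i₀` and has norm at most `r`;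
-- the other has norm at most `1`.
omit [Fintype ι] [DecidableEq ι] in
lemma norm_derivIntegral_derivIntegral_le {b a : ι} (h : ¬ (b = i₀ ∧ a = i₀)) (hr1 : r ≤ 1)
    (v : WSeries (cauchyWeight i₀ hr)) :
    ‖derivIntegral i₀ b (derivIntegral i₀ a v)‖ ≤ r * ‖v‖ := by
  by_cases hb : b = i₀
  · have ha : a ≠ i₀ := fun ha => h ⟨hb, ha⟩
    subst hb
    rw [derivIntegral_self]
    exact ContinuousLinearMap.le_of_opNorm_le _ (norm_derivIntegral_le _ ha) v
  · refine (ContinuousLinearMap.le_of_opNorm_le _ (norm_derivIntegral_le _ hb) _).trans ?_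
    refine mul_le_mul_of_nonneg_left ?_ hr.le
    by_cases ha : a = i₀
    · subst ha
      rw [derivIntegral_self]
      rfl
    · refine (ContinuousLinearMap.le_of_opNorm_le _ (norm_derivIntegral_le _ ha) v).trans ?_
      exact mul_le_of_le_one_left (norm_nonneg _) hr1

-- Only `∂₀²∂₀⁻² = id` survives as `r → 0`. Up to `O(r)` the second derivatives of the perturbation
-- are therefore those of `∑ᵤ Uᵤ Hᵘ` in the single direction `i₀`, as if the problem were an
-- ordinary differential equation in `x₀`.
omit [DecidableEq τ] in
lemma norm_pert2_sub_le (A : ι → ι → ι → ι → ℝ) (H : τ → Matrix ι ι ℝ) (hr1 : r ≤ 1)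
    (U : τ → WSeries (cauchyWeight i₀ hr)) (b a j k : ι) :
    ‖pert2 i₀ A H b a j k (0, U) - ∑ u, secondDeriv i₀ (H u) b a j k • U u‖
      ≤ r * (∑ u, ∑ j, ∑ k, |H u j k|) * ‖U‖ := by
  have hS : 0 ≤ ∑ u, ∑ j, ∑ k, |H u j k| := by positivity
  rw [pert2, fieldCLM_apply, zero_smul, zero_add, ← sum_sub_distrib]
  by_cases h : b = i₀ ∧ a = i₀
  · obtain ⟨rfl, rfl⟩ := h
    simp only [derivIntegral_self, secondDeriv]
    simp
    positivity
  · simp only [secondDeriv, if_neg h, zero_smul, sub_zero]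
    refine (norm_sum_le _ _).trans ?_
    rw [mul_sum, sum_mul]
    refine sum_le_sum fun u _ => ?_
    rw [norm_smul, Real.norm_eq_abs]
    have h1 : |H u j k| ≤ ∑ j, ∑ k, |H u j k| :=
      (single_le_sum (f := fun k => |H u j k|) (fun _ _ => abs_nonneg _) (mem_univ k)).trans
        (single_le_sum (f := fun j => ∑ k, |H u j k|) (fun _ _ => by positivity) (mem_univ j))
    have h2 : ‖derivIntegral i₀ b (derivIntegral i₀ a (U u))‖ ≤ r * ‖U‖ :=
      (norm_derivIntegral_derivIntegral_le i₀ h hr1 _).trans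
        (mul_le_mul_of_nonneg_left (norm_le_pi_norm U u) hr.le)
    calc _ ≤ (∑ j, ∑ k, |H u j k|) * (r * ‖U‖) := by
          apply mul_le_mul h1 h2 (norm_nonneg _) (by positivity)
      _ = _ := by ring

/-- The linearized equations. -/
noncomputable def linearization (A : ι → ι → ι → ι → ℝ) (H : τ → Matrix ι ι ℝ) (s : κ → ℝ)
    (C : κ → Matrix ι ι ℝ) :
    ℝ × (τ → WSeries (cauchyWeight i₀ hr)) →L[ℝ] WSeries (cauchyWeight i₀ hr) :=
  contrComb s C (linearCurv (pert2 i₀ A H))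

omit [DecidableEq ι] [DecidableEq τ] in
lemma linearization_apply (A : ι → ι → ι → ι → ℝ) (H : τ → Matrix ι ι ℝ) (s : κ → ℝ)
    (C : κ → Matrix ι ι ℝ) (p : ℝ × (τ → WSeries (cauchyWeight i₀ hr))) :
    linearization i₀ A H s C p
      = contrComb s C (linearCurv fun b a j k => pert2 i₀ A H b a j k p) := by
  let φ : (ℝ × (τ → WSeries (cauchyWeight i₀ hr)) →L[ℝ] WSeries (cauchyWeight i₀ hr)) →ₗ[ℝ]
    WSeries (cauchyWeight i₀ hr) := (ContinuousLinearMap.apply ℝ _ p).toLinearMap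
  change φ (contrComb s C (linearCurv (pert2 i₀ A H))) = _
  rw [map_contrComb]
  simp only [map_linearCurv]
  rfl

/-- The principal part of the second derivatives contributes exactly `U t`, because the matrices `H
u` are dual to the symbols. The remainder is estimated through the bounds for contractions and for
`linearCurv`. -/
lemma norm_linearization_sub_le (A : ι → ι → ι → ι → ℝ) (H : τ → Matrix ι ι ℝ) (s : κ → ℝ)
    (C : κ → Matrix ι ι ℝ) (t : τ)
    (hnorm : ∀ u, contrComb s C (linearCurv (secondDeriv i₀ (H u))) = if t = u then 1 else 0)
    (hr1 : r ≤ 1) (U : τ → WSeries (cauchyWeight i₀ hr)) :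
    ‖linearization i₀ A H s C (0, U) - U t‖
      ≤ contrBound s C * (3 * (r * (∑ u, ∑ j, ∑ k, |H u j k|) * ‖U‖)) := by
  have e1 : contrComb s C (linearCurv fun b a j k => ∑ u, secondDeriv i₀ (H u) b a j k • U u)
      = U t := by
    have : (linearCurv fun b a j k => ∑ u, secondDeriv i₀ (H u) b a j k • U u)
        = fun i j c d => ∑ u, linearCurv (secondDeriv i₀ (H u)) i j c d • U u := by
      ext1 i; ext1 j; ext1 c; ext1 d
      exact linearCurv_sum_smul _ _ _ _ _ _
    rw [this, contrComb_sum_smul]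
    simp [hnorm]
  have e2 : linearization i₀ A H s C (0, U) = U t + contrComb s C (linearCurv fun b a j k =>
      pert2 i₀ A H b a j k (0, U) - ∑ u, secondDeriv i₀ (H u) b a j k • U u) := by
    rw [linearization_apply, ← e1, ← contrComb_add]
    congr 1
    ext1 i; ext1 j; ext1 c; ext1 d
    rw [← linearCurv_add]
    simp
  rw [e2, add_sub_cancel_left]
  exact norm_contrComb_le s C (norm_linearCurv_le (norm_pert2_sub_le i₀ A H hr1 U))

/-- The linearization in `U` differs from the identity by an operator of norm at most `½`, hence is
invertible by a Neumann series. -/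
lemma surjective_linearization (A : ι → ι → ι → ι → ℝ) (H : τ → Matrix ι ι ℝ) (s : τ → κ → ℝ)
    (C : κ → Matrix ι ι ℝ)
    (hnorm : ∀ t u, contrComb (s t) C (linearCurv (secondDeriv i₀ (H u))) = if t = u then 1 else 0)
    (hr1 : r ≤ 1)
    (hsmall : ∀ t, contrBound (s t) C * (3 * (r * (∑ u, ∑ j, ∑ k, |H u j k|))) ≤ 1 / 2)
    (V : τ → WSeries (cauchyWeight i₀ hr)) :
    ∃ U : τ → WSeries (cauchyWeight i₀ hr), ∀ t, linearization i₀ A H (s t) C (0, U) = V t := by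
  let N : (τ → WSeries (cauchyWeight i₀ hr)) →L[ℝ] (τ → WSeries (cauchyWeight i₀ hr)) :=
    ContinuousLinearMap.pi fun t =>
      linearization i₀ A H (s t) C ∘L ContinuousLinearMap.inr ℝ ℝ _
  have hN : ‖1 - N‖ < 1 := by
    refine lt_of_le_of_lt (ContinuousLinearMap.opNorm_le_bound _ (by norm_num : (0 : ℝ) ≤ 1 / 2)
      fun U => ?_) (by norm_num)
    rw [pi_norm_le_iff_of_nonneg (by positivity)]
    intro t
    have h1 := norm_linearization_sub_le i₀ A H (s t) C t (hnorm t) hr1 U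
    have h2 : ((1 - N) U) t = -(linearization i₀ A H (s t) C (0, U) - U t) := by
      rw [neg_sub]; rfl
    rw [h2, norm_neg]
    refine h1.trans ?_
    calc _ = (contrBound (s t) C * (3 * (r * (∑ u, ∑ j, ∑ k, |H u j k|)))) * ‖U‖ := by ring
      _ ≤ _ := by gcongr; exact hsmall t
  have hu : IsUnit N := by
    have := (Units.oneSub (1 - N) hN).isUnit
    simpa using this
  obtain ⟨v, hv⟩ := hu
  refine ⟨(↑v⁻¹ : (τ → WSeries (cauchyWeight i₀ hr)) →L[ℝ] _) V, fun t => ?_⟩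
  have h3 : N ((↑v⁻¹ : (τ → WSeries (cauchyWeight i₀ hr)) →L[ℝ] _) V) = V := by
    rw [← mul_apply_eq_comp, ← hv, Units.mul_inv]; rfl
  exact congrFun h3 t

/-- The perturbation as a matrix. -/
noncomputable def pertM (A : ι → ι → ι → ι → ℝ) (H : τ → Matrix ι ι ℝ)
    (p : ℝ × (τ → WSeries (cauchyWeight i₀ hr))) : Matrix ι ι (WSeries (cauchyWeight i₀ hr)) :=
  Matrix.of fun j k => pert i₀ A H j k p

/-- The first derivatives of the perturbation as matrices. -/
noncomputable def pertM1 (A : ι → ι → ι → ι → ℝ) (H : τ → Matrix ι ι ℝ)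
    (p : ℝ × (τ → WSeries (cauchyWeight i₀ hr))) (a : ι) :
    Matrix ι ι (WSeries (cauchyWeight i₀ hr)) :=
  Matrix.of fun j k => pert1 i₀ A H a j k p

/-- The second derivatives of the perturbation as matrices. -/
noncomputable def pertM2 (A : ι → ι → ι → ι → ℝ) (H : τ → Matrix ι ι ℝ)
    (p : ℝ × (τ → WSeries (cauchyWeight i₀ hr))) (b a : ι) :
    Matrix ι ι (WSeries (cauchyWeight i₀ hr)) :=
  Matrix.of fun j k => pert2 i₀ A H b a j k p

/-- Conjugation of a constant matrix by the frame dual to `coframe`. -/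
noncomputable def frameConj {R : Type*} [CommRing R] [Algebra ℝ R] (Bi : Matrix ι ι ℝ)
    (h : Matrix ι ι R) (C : Matrix ι ι ℝ) : Matrix ι ι R :=
  (coframe Bi h)⁻¹ * constMatrix R C * ((coframe Bi h)⁻¹)ᵀ

/-- The curvature of the perturbed metric. -/
noncomputable def pertCurv (Bi : Matrix ι ι ℝ) (A : ι → ι → ι → ι → ℝ) (H : τ → Matrix ι ι ℝ)
    (p : ℝ × (τ → WSeries (cauchyWeight i₀ hr))) :
    ι → ι → ι → ι → WSeries (cauchyWeight i₀ hr) :=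
  -- The inverse of `ΘᵀBΘ` is `Θ⁻¹B⁻¹Θ⁻ᵀ`, so the inverse metric is itself a conjugate of a constant
  -- matrix by the frame.
  jetCurv (frameConj Bi (pertM i₀ A H p) Bi)
    (fun a => metricD Bi (pertM i₀ A H p) (pertM1 i₀ A H p) a)
    (fun b a => metricDD Bi (pertM i₀ A H p) (pertM1 i₀ A H p) (pertM2 i₀ A H p) b a)

omit [DecidableEq τ] in
lemma hasLin_pertCurv_contr (Bi : Matrix ι ι ℝ) (A : ι → ι → ι → ι → ℝ) (H : τ → Matrix ι ι ℝ)
    (s : κ → ℝ) (C : κ → Matrix ι ι ℝ) :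
    HasLin (fun p : ℝ × (τ → WSeries (cauchyWeight i₀ hr)) =>
      contrComb s (fun k => frameConj Bi (pertM i₀ A H p) (C k)) (pertCurv i₀ Bi A H p))
      (linearization i₀ A H s C) := by
  have h0 : ∀ i j, HasLin (fun p : ℝ × (τ → WSeries (cauchyWeight i₀ hr)) =>
    pertM i₀ A H p i j) (pert i₀ A H i j) := fun i j => HasLin.clm (pert i₀ A H i j)
  have h1 : ∀ a i j, HasLin (fun p : ℝ × (τ → WSeries (cauchyWeight i₀ hr)) =>
    pertM1 i₀ A H p a i j) (pert1 i₀ A H a i j) :=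
    fun a i j => HasLin.clm (pert1 i₀ A H a i j)
  have h2 : ∀ b a i j, HasLin (fun p : ℝ × (τ → WSeries (cauchyWeight i₀ hr)) =>
    pertM2 i₀ A H p b a i j) (pert2 i₀ A H b a i j) :=
    fun b a i j => HasLin.clm (pert2 i₀ A H b a i j)
  have hc : ∀ i j, ContDiffAt ℝ 1 (fun p : ℝ × (τ → WSeries (cauchyWeight i₀ hr)) =>
    pertM i₀ A H p i j) 0 := fun i j => (pert i₀ A H i j).contDiff.contDiffAt
  have hF := hasValue_coframe_inv (Bi := Bi) h0 hc
  have hK := fun C => hasValue_conj hF C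
  exact hasLin_contrComb s (fun k => hK (C k))
    (hasLin_jetCurv (hK Bi) (hasLin_metricD h0 h1) (hasLin_metricDD h0 h1 h2))

/-- A Cauchy–Kovalevskaya theorem. The equations `Φₜ(ε, U) = ε cₜ` hold at the origin, and the map
`(ε, U) ↦ (ε, Φ - εc)` has a surjective strict derivative there. It therefore maps neighbourhoods
onto neighbourhoods and attains `(ε, 0)` for some small `ε > 0`. No uniqueness is needed. -/
theorem exists_pert_solution (Bi : Matrix ι ι ℝ) (A : ι → ι → ι → ι → ℝ) (H : τ → Matrix ι ι ℝ)
    (s : τ → κ → ℝ) (C : κ → Matrix ι ι ℝ)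
    (hnorm : ∀ t u, contrComb (s t) C (linearCurv (secondDeriv i₀ (H u))) = if t = u then 1 else 0)
    (c : τ → ℝ) :
    ∃ (r : ℝ) (hr : 0 < r) (_ : r ≤ 1) (p : ℝ × (τ → WSeries (cauchyWeight i₀ hr))), 0 < p.1 ∧
      IsUnit (coframe Bi (pertM i₀ A H p)).det ∧
      ∀ t, contrComb (s t) (fun k => frameConj Bi (pertM i₀ A H p) (C k)) (pertCurv i₀ Bi A H p)
        = algebraMap ℝ _ (p.1 * c t) := by
  set Hb := ∑ u, ∑ j, ∑ k, |H u j k| with hHb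
  have hHb0 : 0 ≤ Hb := by positivity
  set Cb := ∑ t, contrBound (s t) C with hCb
  have hCt : ∀ t, contrBound (s t) C ≤ Cb := fun t =>
    single_le_sum (f := fun t => contrBound (s t) C) (fun t _ => contrBound_nonneg _ _) (mem_univ t)
  have hCb0 : 0 ≤ Cb := sum_nonneg fun t _ => contrBound_nonneg _ _
  have hd : 0 < 1 + 6 * Cb * Hb := by positivity
  obtain ⟨r, hr, hr1, hsm⟩ : ∃ r : ℝ, 0 < r ∧ r ≤ 1 ∧ Cb * (3 * (r * Hb)) ≤ 1 / 2 := by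
    -- With this `r` the bound becomes `3CbHb / (1 + 6CbHb) ≤ ½`; the summand `1` keeps `r ≤ 1` and
    -- the denominator positive.
    refine ⟨1 / (1 + 6 * Cb * Hb), by positivity, ?_, ?_⟩
    · rw [div_le_one hd]; nlinarith [mul_nonneg hCb0 hHb0]
    · rw [show Cb * (3 * (1 / (1 + 6 * Cb * Hb) * Hb)) = (3 * Cb * Hb) / (1 + 6 * Cb * Hb) by
        field_simp, div_le_iff₀ hd]
      linarith
  refine ⟨r, hr, hr1, ?_⟩
  have hsmall : ∀ t, contrBound (s t) C * (3 * (r * (∑ u, ∑ j, ∑ k, |H u j k|))) ≤ 1 / 2 :=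
    fun t => (mul_le_mul_of_nonneg_right (hCt t) (by positivity)).trans hsm
  let Y := WSeries (cauchyWeight i₀ hr)
  let Φ : τ → ℝ × (τ → Y) → Y := fun t p =>
    contrComb (s t) (fun k => frameConj Bi (pertM i₀ A H p) (C k)) (pertCurv i₀ Bi A H p)
  let e : τ → ℝ × (τ → Y) →L[ℝ] Y := fun t =>
    (ContinuousLinearMap.fst ℝ ℝ (τ → Y)).smulRight (algebraMap ℝ Y (c t))
  have hΦ : ∀ t, HasLin (fun p => Φ t p - e t p) (linearization i₀ A H (s t) C - e t) := fun t =>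
    (hasLin_pertCurv_contr i₀ Bi A H (s t) C).sub (HasLin.clm (e t))
  let Ψ : ℝ × (τ → Y) → ℝ × (τ → Y) := fun p => (p.1, fun t => Φ t p - e t p)
  let Ψ' : ℝ × (τ → Y) →L[ℝ] ℝ × (τ → Y) := (ContinuousLinearMap.fst ℝ ℝ (τ → Y)).prod
    (ContinuousLinearMap.pi fun t => linearization i₀ A H (s t) C - e t)
  have hΨ : HasStrictFDerivAt Ψ Ψ' 0 :=
    (ContinuousLinearMap.fst ℝ ℝ (τ → Y)).hasStrictFDerivAt.prodMk
      (hasStrictFDerivAt_pi.2 fun t => (hΦ t).2)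
  have hsurj : Ψ'.range = ⊤ := by
    rw [LinearMap.range_eq_top]
    rintro ⟨ε, V⟩
    -- The component `ε` is prescribed by the target, so its contribution is moved to the right-hand
    -- side before solving for `U`.
    obtain ⟨U, hU⟩ := surjective_linearization i₀ A H s C hnorm hr1 hsmall
      (fun t => V t - (linearization i₀ A H (s t) C (ε, 0) - e t (ε, 0)))
    refine ⟨(ε, U), Prod.ext rfl (funext fun t => ?_)⟩
    change linearization i₀ A H (s t) C (ε, U) - e t (ε, U) = V t
    have e1 : ((ε, U) : ℝ × (τ → Y)) = (ε, 0) + (0, U) := by simp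
    have e2 : e t (0, U) = 0 := by simp [e]
    rw [e1, map_add, map_add, hU, e2]
    abel
  have hΨ0 : Ψ 0 = 0 := Prod.ext rfl (funext fun t => (hΦ t).1)
  have hmap := hΨ.map_nhds_eq_of_surj hsurj
  rw [hΨ0] at hmap
  have hW : {p : ℝ × (τ → Y) | IsUnit (coframe Bi (pertM i₀ A H p)).det} ∈ 𝓝 0 := by
    have h0 : ∀ i j, HasLin (fun p : ℝ × (τ → Y) => pertM i₀ A H p i j) (pert i₀ A H i j) :=
      fun i j => HasLin.clm (pert i₀ A H i j)
    have hdet : ContDiffAt ℝ 0 (fun p : ℝ × (τ → Y) => (coframe Bi (pertM i₀ A H p)).det) 0 :=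
      contDiffAt_det (contDiffAt_coframe fun i j => (pert i₀ A H i j).contDiff.contDiffAt)
    have h1 : (coframe Bi (pertM i₀ A H (0 : ℝ × (τ → Y)))).det = 1 := by
      rw [coframe_eq_one h0, Matrix.det_one]
    exact hdet.continuousAt.preimage_mem_nhds (Units.isOpen.mem_nhds (by rw [h1]; exact isUnit_one))
  have him : Ψ '' {p | IsUnit (coframe Bi (pertM i₀ A H p)).det} ∈ 𝓝 0 := by
    rw [← hmap]; exact image_mem_map hW
  have hcurve : Tendsto (fun ε : ℝ => ((ε, 0) : ℝ × (τ → Y))) (𝓝[>] 0) (𝓝 0) := by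
    have : Continuous fun ε : ℝ => ((ε, 0) : ℝ × (τ → Y)) := by fun_prop
    exact (this.tendsto 0).mono_left nhdsWithin_le_nhds
  -- The image of the parameters with invertible coframe is a neighbourhood of `0`, so it contains
  -- `(ε, 0)` for small positive `ε`. The positive sign is what later permits a real dilation.
  obtain ⟨ε, hε, hε0⟩ := ((hcurve.eventually him).and self_mem_nhdsWithin).exists
  obtain ⟨p, hp, hpε⟩ := hε
  have hp1 : p.1 = ε := congrArg Prod.fst hpε
  refine ⟨p, hp1 ▸ hε0, hp, fun t => ?_⟩
  have h2 : Φ t p - e t p = 0 := congrFun (congrArg Prod.snd hpε) t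
  rw [sub_eq_zero] at h2
  refine h2.trans ?_
  simp [e, Algebra.smul_def]
  rfl

end Solve

/-! ### Passing from power series to functions -/

section Real

open Finset WSeries Filter Topology

section MapConj

variable {ι : Type*} [Fintype ι] [DecidableEq ι] {R S : Type*} [CommRing R] [Algebra ℝ R]
  [CommRing S] [Algebra ℝ S]

lemma map_matrix_inv (φ : R →ₐ[ℝ] S) {M : Matrix ι ι R} (hM : IsUnit M.det) :
    M⁻¹.map φ = (M.map φ)⁻¹ := by
  refine (Matrix.inv_eq_right_inv ?_).symm
  rw [← Matrix.map_mul, Matrix.mul_nonsing_inv _ hM, Matrix.map_one _ (map_zero _) (map_one _)]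

lemma map_frameConj (φ : R →ₐ[ℝ] S) (Bi C : Matrix ι ι ℝ) {h : Matrix ι ι R}
    (hM : IsUnit (coframe Bi h).det) :
    (frameConj Bi h C).map φ = frameConj Bi (h.map φ) C := by
  rw [frameConj, frameConj, Matrix.map_mul, Matrix.map_mul, map_constMatrix, Matrix.transpose_map,
    map_matrix_inv φ hM, map_coframe]

omit [Fintype ι] [DecidableEq ι] in
lemma constMatrix_real (M : Matrix ι ι ℝ) : constMatrix ℝ M = M := by ext; simp

end MapConj

variable {E : Type*} [NormedAddCommGroup E] [NormedSpace ℝ E] [FiniteDimensional ℝ E]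

/-- The scaled coordinates of a point. -/
noncomputable def scaledCoord (lam : ℝ) : E →L[ℝ] (Idx E → ℝ) :=
  lam • ((coordBasis E).equivFun.toContinuousLinearEquiv : E →L[ℝ] (Idx E → ℝ))

lemma scaledCoord_basis (lam : ℝ) (a i : Idx E) :
    scaledCoord lam (coordBasis E a) i = lam * if a = i then 1 else 0 := by
  simp [scaledCoord, Finsupp.single_apply]

variable {i₀ : Idx E} {r : ℝ} {hr : 0 < r}

lemma hasPartials_evalSeries (hr1 : r ≤ 1) (lam : ℝ) {f : WSeries (cauchyWeight i₀ hr)}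
    {f' : Idx E → WSeries (cauchyWeight i₀ hr)} (hf : ∀ a, IsPderiv a f (f' a)) {y : E}
    (hy : ‖scaledCoord lam y‖ < r / 2) :
    HasPartials (fun z => evalSeries f.val (scaledCoord lam z))
      (fun a => lam • evalSeries (f' a).val (scaledCoord lam y)) y := by
  have h := (hasFDerivAt_evalSeries (summable_pow_degree hr1 f) hy).comp y
    (scaledCoord (E := E) lam).hasFDerivAt
  refine ⟨h.differentiableAt, fun a => ?_⟩
  have h2 : fderiv ℝ (fun z => evalSeries f.val (scaledCoord lam z)) y = _ := h.fderiv
  rw [partialDeriv, h2]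
  have h3 : ∀ i, MvPowerSeries.pderiv ℝ i f.val = (f' i).val := hf
  simp only [h3, ContinuousLinearMap.comp_apply, _root_.sum_apply, _root_.smul_apply,
    ContinuousLinearMap.proj_apply, scaledCoord_basis, smul_eq_mul]
  simp [mul_comm]

lemma map_pertCurv {ι τ : Type*} [Fintype ι] [DecidableEq ι] [Fintype τ] {i₀ : ι} {r : ℝ}
    {hr : 0 < r} {S : Type*} [CommRing S] [Algebra ℝ S]
    (φ : WSeries (cauchyWeight i₀ hr) →ₐ[ℝ] S) (Bi : Matrix ι ι ℝ) (A : ι → ι → ι → ι → ℝ)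
    (H : τ → Matrix ι ι ℝ) (p : ℝ × (τ → WSeries (cauchyWeight i₀ hr))) (i j k l : ι) :
    φ (pertCurv i₀ Bi A H p i j k l) = jetCurv ((frameConj Bi (pertM i₀ A H p) Bi).map φ)
      (fun a i j => φ (metricD Bi (pertM i₀ A H p) (pertM1 i₀ A H p) a i j))
      (fun b a i j => φ (metricDD Bi (pertM i₀ A H p) (pertM1 i₀ A H p) (pertM2 i₀ A H p) b a i j))
      i j k l :=
  map_jetCurv φ _ _ _ i j k l

lemma contDiffOn_evalSeries_scaledCoord (hr1 : r ≤ 1) (lam : ℝ) (f : WSeries (cauchyWeight i₀ hr)) :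
    ContDiffOn ℝ ∞ (fun z : E => evalSeries f.val (scaledCoord lam z))
      {z | ‖scaledCoord lam z‖ < r / 2} := by
  have h1 : ContDiffOn ℝ ∞ (evalSeries f.val) (Metric.ball 0 (r / 2)) :=
    contDiffOn_infty.2 fun n => contDiffOn_evalSeries n (summable_pow_degree hr1 f)
  refine h1.comp (scaledCoord (E := E) lam).contDiff.contDiffOn fun z hz => ?_
  simpa using hz

variable {τ : Type*} [Fintype τ] [DecidableEq τ] {κ : Type*} [Fintype κ]
  {B Bi : Matrix (Idx E) (Idx E) ℝ} {A : Idx E → Idx E → Idx E → Idx E → ℝ}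
  {H : τ → Matrix (Idx E) (Idx E) ℝ} {p : ℝ × (τ → WSeries (cauchyWeight i₀ hr))}

-- Evaluation at a point of the polydisc is an algebra homomorphism turning formal into actual
-- partial derivatives, up to one factor `lam` for each derivative. All identities proved for series
-- therefore pass to functions, with total factor `lam²` in the curvature.
omit [DecidableEq τ] in
lemma curvTensorCoeff_evalSeries (hr1 : r ≤ 1) (hB : Bᵀ = B) (hBi : B * Bi = 1)
    (hA1 : ∀ i j k l, A i j k l = -A j i k l) (hA2 : ∀ i j k l, A i j k l = A k l i j)
    (hH : ∀ u, (H u)ᵀ = H u) (hdet : IsUnit (coframe Bi (pertM i₀ A H p)).det) (lam : ℝ)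
    {Θ : E → Matrix (Idx E) (Idx E) ℝ}
    (hΘ : ∀ y, Θ y = coframe Bi ((pertM i₀ A H p).map
      fun f => evalSeries f.val (scaledCoord lam y)))
    {y : E} (hy : ‖scaledCoord lam y‖ < r / 2) (i j k l : Idx E) :
    curvTensorCoeff (fun z => (Θ z)ᵀ * B * Θ z) i j k l y
      = lam ^ 2 * evalSeries (pertCurv i₀ Bi A H p i j k l).val (scaledCoord lam y) := by
  have hU : ∀ᶠ z in 𝓝 y, ‖scaledCoord lam z‖ < r / 2 :=
    ((scaledCoord (E := E) lam).continuous.norm.tendsto y).eventually (gt_mem_nhds hy)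
  have hbd : ∀ {z : E}, ‖scaledCoord lam z‖ < r / 2 → ∀ i, |scaledCoord lam z i| ≤ r / 2 :=
    fun hz i => (norm_le_pi_norm _ i).trans hz.le
  have hhs : (pertM i₀ A H p)ᵀ = pertM i₀ A H p := by
    ext j k; exact (pert_symm i₀ hA1 hA2 hH p j k).symm
  have hG : ∀ z, ‖scaledCoord lam z‖ < r / 2 → (Θ z)ᵀ * B * Θ z
      = (metricOf B Bi (pertM i₀ A H p)).map fun f => evalSeries f.val (scaledCoord lam z) := by
    intro z hz
    have e : ((metricOf B Bi (pertM i₀ A H p)).map fun f => evalSeries f.val (scaledCoord lam z))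
        = metricOf B Bi ((pertM i₀ A H p).map fun f => evalSeries f.val (scaledCoord lam z)) :=
      map_metricOf (eval hr1 (hbd hz)) B Bi (pertM i₀ A H p)
    rw [e, ← coframe_metric hB hBi, constMatrix_real, hΘ]
    rw [← Matrix.transpose_map, hhs]
  -- A unit of the algebra of series is sent to a unit of `ℝ` by every evaluation.
  have hdetΘ : ∀ z, ‖scaledCoord lam z‖ < r / 2 → IsUnit (Θ z).det := by
    intro z hz
    have e : (coframe Bi (pertM i₀ A H p)).map (eval hr1 (hbd hz)) = Θ z := by
      rw [map_coframe, hΘ]; rfl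
    rw [← e, ← AlgHom.mapMatrix_apply, ← AlgHom.map_det]
    exact hdet.map _
  have hBdet : IsUnit B.det := by
    rw [← Matrix.isUnit_iff_isUnit_det]
    exact IsUnit.of_mul_eq_one _ hBi
  have hdetG : ∀ z, ‖scaledCoord lam z‖ < r / 2 → IsUnit ((Θ z)ᵀ * B * Θ z).det := by
    intro z hz
    rw [Matrix.det_mul, Matrix.det_mul, Matrix.det_transpose]
    exact ((hdetΘ z hz).mul hBdet).mul (hdetΘ z hz)
  have hd1 : ∀ a, IsPderivM a (pertM i₀ A H p) (pertM1 i₀ A H p a) :=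
    fun a j k => isPderiv_pert i₀ p a j k
  have hd2 : ∀ b a, IsPderivM b (pertM1 i₀ A H p a) (pertM2 i₀ A H p b a) :=
    fun b a j k => isPderiv_pert1 i₀ p b a j k
  have hdG : ∀ z, ‖scaledCoord lam z‖ < r / 2 → ∀ i j, HasPartials
      (fun z => ((Θ z)ᵀ * B * Θ z) i j) (fun a => lam • evalSeries
        (metricD Bi (pertM i₀ A H p) (pertM1 i₀ A H p) a i j).val (scaledCoord lam z)) z := by
    intro z hz i j
    have h1 := hasPartials_evalSeries hr1 lam
      (fun a => isPderivM_metricOf B Bi hd1 a i j) hz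
    refine h1.congr_of_eventuallyEq ?_
    have hU' : ∀ᶠ z in 𝓝 z, ‖scaledCoord lam z‖ < r / 2 :=
      ((scaledCoord (E := E) lam).continuous.norm.tendsto z).eventually (gt_mem_nhds hz)
    filter_upwards [hU'] with x hx
    rw [hG x hx]
    rfl
  have hddG : ∀ a i j, HasPartials (fun z => lam • evalSeries
      (metricD Bi (pertM i₀ A H p) (pertM1 i₀ A H p) a i j).val (scaledCoord lam z))
      (fun b => lam ^ 2 • evalSeries (metricDD Bi (pertM i₀ A H p) (pertM1 i₀ A H p)
        (pertM2 i₀ A H p) b a i j).val (scaledCoord lam y)) y := by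
    intro a i j
    have h1 := (hasPartials_evalSeries hr1 lam
      (fun b => isPderivM_metricD Bi hd1 hd2 b a i j) hy).const_smul lam
    simpa only [smul_smul, ← pow_two] using h1
  have hinv : ∀ i j, DifferentiableAt ℝ (fun z => ((Θ z)ᵀ * B * Θ z)⁻¹ i j) y := by
    intro i j
    have hc : ∀ i j, ContDiffAt ℝ 1 (fun z => ((Θ z)ᵀ * B * Θ z) i j) y := by
      intro i j
      have h1 := ((contDiffOn_evalSeries_scaledCoord hr1 lam
        (metricOf B Bi (pertM i₀ A H p) i j)).contDiffAt (x := y) hU).of_le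
        (show (1 : ℕ∞ω) ≤ ∞ by exact_mod_cast le_top)
      refine h1.congr_of_eventuallyEq ?_
      filter_upwards [hU] with x hx
      rw [hG x hx]
      rfl
    exact (contDiffAt_matrix_inv hc (hdetG y hy) i j).differentiableAt one_ne_zero
  have hGs : ∀ z, ((Θ z)ᵀ * B * Θ z)ᵀ = (Θ z)ᵀ * B * Θ z := fun z => by
    rw [Matrix.transpose_mul, Matrix.transpose_mul, Matrix.transpose_transpose, hB, mul_assoc]
  rw [curvTensorCoeff_eq_jetCurv (hU.mono hdG) hddG (Eventually.of_forall hGs) (hU.mono hdetG)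
    hinv, jetCurv_smul, smul_eq_mul]
  congr 1
  have e1 : evalSeries (pertCurv i₀ Bi A H p i j k l).val (scaledCoord lam y)
      = eval hr1 (hbd hy) (pertCurv i₀ Bi A H p i j k l) := rfl
  rw [e1, map_pertCurv, map_frameConj _ _ _ hdet]
  refine congrArg (fun Gi => jetCurv Gi _ _ i j k l) ?_
  have e2 : (pertM i₀ A H p).map (eval hr1 (hbd hy))
      = (pertM i₀ A H p).map fun f => evalSeries f.val (scaledCoord lam y) := rfl
  have hBiinv : Bi = B⁻¹ := (Matrix.inv_eq_right_inv hBi).symm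
  rw [frameConj, constMatrix_real, e2, ← hΘ, hBiinv, Matrix.mul_inv_rev, Matrix.mul_inv_rev,
    Matrix.transpose_nonsing_inv, mul_assoc]

omit [FiniteDimensional ℝ E] [DecidableEq τ] in
lemma eval_zero_coordFn (a : Idx E) : evalSeries (coordFn (cauchyWeight i₀ hr) a).val 0 = 0 := by
  rw [evalSeries_zero, coordFn, val_mk, MvPowerSeries.coeff_X, if_neg]
  exact fun h => one_ne_zero (Finsupp.single_eq_zero.1 h.symm)

omit [FiniteDimensional ℝ E] [DecidableEq τ] in
lemma eval_zero_pertM (hr1 : r ≤ 1) (j k : Idx E) :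
    evalSeries (pertM i₀ A H p j k).val 0 = 0 := by
  have hb : ∀ i : Idx E, |(0 : Idx E → ℝ) i| ≤ r / 2 := fun i => by simp; positivity
  have hX : ∀ a, eval hr1 hb (coordFn (cauchyWeight i₀ hr) a) = 0 := eval_zero_coordFn
  have hI : ∀ f : WSeries (cauchyWeight i₀ hr), eval hr1 hb (integral i₀ f) = 0 := fun f =>
    (evalSeries_zero _).trans (coeff_zero_integral i₀ f)
  change eval hr1 hb (pertM i₀ A H p j k) = 0
  simp only [pertM, Matrix.of_apply, pert, fieldCLM_apply, map_add, map_smul,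
    map_sum, ContinuousLinearMap.comp_apply, hI, quadField, map_mul, hX]
  simp

-- At the origin `h` and its first derivatives vanish, so the curvature is linear in the second
-- derivatives: `εA` plus `Uᵤ(0)` times the curvatures of the `Hᵘ`. By duality the equations at the
-- origin read `ε sₜ(A) + Uₜ(0) = ε sₜ(A)`, whence `U(0) = 0`.
omit [FiniteDimensional ℝ E] in
lemma eval_zero_pertCurv (hr1 : r ≤ 1)
    (hA1 : ∀ i j k l, A i j k l = -A j i k l) (hA2 : ∀ i j k l, A i j k l = A k l i j)
    (hA3 : ∀ i j k l, A i j k l + A j k i l + A k i j l = 0)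
    (s : τ → κ → ℝ) (C : κ → Matrix (Idx E) (Idx E) ℝ)
    (hnorm : ∀ t u, contrComb (s t) C (linearCurv (secondDeriv i₀ (H u))) = if t = u then 1 else 0)
    (hdet : IsUnit (coframe Bi (pertM i₀ A H p)).det)
    (hsol : ∀ t, contrComb (s t) (fun k => frameConj Bi (pertM i₀ A H p) (C k))
      (pertCurv i₀ Bi A H p) = algebraMap ℝ _ (p.1 * contrComb (s t) C A)) (i j k l : Idx E) :
    evalSeries (pertCurv i₀ Bi A H p i j k l).val 0 = p.1 * A i j k l := by
  have hb : ∀ i : Idx E, |(0 : Idx E → ℝ) i| ≤ r / 2 := fun i => by simp; positivity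
  set φ : WSeries (cauchyWeight i₀ hr) →ₐ[ℝ] ℝ := eval hr1 hb with hφ
  have hφ0 : ∀ f, φ f = MvPowerSeries.coeff 0 f.val := fun f => evalSeries_zero f.val
  have hX : ∀ a, φ (coordFn _ a) = 0 := eval_zero_coordFn
  have hI : ∀ f, φ (integral i₀ f) = 0 := fun f => by rw [hφ0, coeff_zero_integral]
  have h0 : (pertM i₀ A H p).map φ = 0 := Matrix.ext fun j k => eval_zero_pertM hr1 j k
  have h1 : ∀ a j k, φ (pertM1 i₀ A H p a j k) = 0 := by
    intro a j k
    simp only [pertM1, Matrix.of_apply, pert1, fieldCLM_apply, map_add, map_smul,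
      map_sum, ContinuousLinearMap.comp_apply, hI, quadField1, map_mul, hX]
    simp
  -- For `a ≠ i₀` the constant term of `∂ₐ∂₀⁻¹f` is zero, so among the second derivatives of `∂₀⁻²U`
  -- only the pure `x₀` one can be nonzero at the origin.
  have h2 : ∀ b a j k, φ (pertM2 i₀ A H p b a j k) = p.1 * quadField2 A b a j k
      + ∑ u, secondDeriv i₀ (H u) b a j k * φ (p.2 u) := by
    intro b a j k
    simp only [pertM2, Matrix.of_apply, pert2, fieldCLM_apply, map_add, map_smul, map_sum,
      ContinuousLinearMap.comp_apply, AlgHom.commutes, smul_eq_mul, Algebra.algebraMap_self,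
      RingHom.id_apply]
    congr 1
    refine sum_congr rfl fun u _ => ?_
    by_cases hb : b = i₀
    · by_cases ha : a = i₀
      · subst hb; subst ha
        simp [secondDeriv, derivIntegral_self]
      · subst hb
        rw [derivIntegral_self, ContinuousLinearMap.id_apply, hφ0 (derivIntegral b a _),
          coeff_zero_derivIntegral _ ha, secondDeriv, if_neg (fun h => ha h.2)]
        simp
    · rw [hφ0 (derivIntegral i₀ b _), coeff_zero_derivIntegral _ hb, secondDeriv,
        if_neg (fun h => hb h.1)]
      simp
  have hcurv : ∀ i j k l, φ (pertCurv i₀ Bi A H p i j k l) = p.1 * A i j k l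
      + ∑ u, linearCurv (secondDeriv i₀ (H u)) i j k l * φ (p.2 u) := by
    intro i j k l
    have hmul : ∀ (M N : Matrix (Idx E) (Idx E) (WSeries (cauchyWeight i₀ hr))) i j,
        (∀ i j, φ (N i j) = 0) → φ ((M * N) i j) = 0 := fun M N i j hN => by
      simp [Matrix.mul_apply, hN]
    have hmul' : ∀ (M N K : Matrix (Idx E) (Idx E) (WSeries (cauchyWeight i₀ hr))) i j,
        (∀ i j, φ (M i j) = 0) → φ ((M * N * K) i j) = 0 := fun M N K i j hN => by
      simp [Matrix.mul_apply, hN]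
    have h0' : ∀ i j, φ (pertM i₀ A H p i j) = 0 := fun i j => congrFun (congrFun h0 i) j
    have hD : ∀ a i j, φ (metricD Bi (pertM i₀ A H p) (pertM1 i₀ A H p) a i j) = 0 := by
      intro a i j
      simp only [metricD, Matrix.add_apply, Matrix.smul_apply, map_add, map_smul, h1,
        hmul _ _ _ _ h0', hmul' _ _ _ _ _ h0']
      simp
    have hDD : ∀ b a i j, φ (metricDD Bi (pertM i₀ A H p) (pertM1 i₀ A H p) (pertM2 i₀ A H p)
        b a i j) = φ (pertM2 i₀ A H p b a i j) := by
      intro b a i j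
      simp only [metricDD, Matrix.add_apply, Matrix.smul_apply, map_add, map_smul,
        hmul _ _ _ _ h0', hmul' _ _ _ _ _ h0', hmul _ _ _ _ (h1 _)]
      simp
    rw [map_pertCurv]
    simp only [hD, hDD, h2]
    rw [jetCurv, linearCurv_add]
    have hq : ∀ Gi : Matrix (Idx E) (Idx E) ℝ, quadraticCurv Gi (fun _ _ _ => (0 : ℝ)) i j k l = 0 := by
      intro Gi; simp [quadraticCurv, lowerChristoffel]
    rw [hq, add_zero]
    congr 1
    · have := map_linearCurv (LinearMap.mulLeft ℝ p.1) (quadField2 A) i j k l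
      rw [linearCurv_quadField2 hA1 hA2 hA3] at this
      exact this.symm
    · exact linearCurv_sum_smul (fun u => secondDeriv i₀ (H u)) (fun u => φ (p.2 u)) i j k l
  have hU : ∀ u, φ (p.2 u) = 0 := by
    intro t
    have h3 := congrArg φ (hsol t)
    rw [map_contrComb_algHom, AlgHom.commutes] at h3
    have h4 : ∀ C, (frameConj Bi (pertM i₀ A H p) C).map φ = C := by
      intro C
      rw [map_frameConj φ _ _ hdet, h0, frameConj]
      simp [coframe, constMatrix_real]
    simp only [h4, hcurv] at h3
    rw [contrComb_add] at h3
    have h5 := map_contrComb (s t) (LinearMap.mulLeft ℝ p.1) C A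
    have h6 := contrComb_sum_smul (s t) C (fun u => linearCurv (secondDeriv i₀ (H u)))
      (fun u => φ (p.2 u))
    simp only [smul_eq_mul, hnorm] at h6
    simp only [LinearMap.mulLeft_apply] at h5
    rw [h6, ← h5] at h3
    simpa using h3
  have := hcurv i j k l
  simp only [hU, mul_zero, sum_const_zero, add_zero] at this
  exact this

/-- The power series solution is dilated by `lam` with `lam² ε = 1`. This multiplies the curvature
by `ε⁻¹`, so both the prescribed contractions and the curvature at the origin lose their factor `ε`.
-/
theorem exists_coframe (i₀ : Idx E) (hB : Bᵀ = B) (hBi : B * Bi = 1)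
    (hA1 : ∀ i j k l, A i j k l = -A j i k l) (hA2 : ∀ i j k l, A i j k l = A k l i j)
    (hA3 : ∀ i j k l, A i j k l + A j k i l + A k i j l = 0) (hH : ∀ u, (H u)ᵀ = H u)
    (s : τ → κ → ℝ) (C : κ → Matrix (Idx E) (Idx E) ℝ)
    (hnorm : ∀ t u, contrComb (s t) C (linearCurv (secondDeriv i₀ (H u))) =
      if t = u then 1 else 0) :
    ∃ δ > 0, ∃ Θ : E → Matrix (Idx E) (Idx E) ℝ, Θ 0 = 1 ∧
      (∀ i j, ContDiffOn ℝ ∞ (fun y => Θ y i j) (Metric.ball 0 δ)) ∧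
      (∀ y ∈ Metric.ball (0 : E) δ, IsUnit (Θ y).det) ∧
      (∀ y ∈ Metric.ball (0 : E) δ, ∀ t,
        contrComb (s t) (fun k => (Θ y)⁻¹ * C k * ((Θ y)⁻¹)ᵀ) (fun i j k l =>
          curvTensorCoeff (fun z => (Θ z)ᵀ * B * Θ z) i j k l y) = contrComb (s t) C A) ∧
      ∀ i j k l, curvTensorCoeff (fun z => (Θ z)ᵀ * B * Θ z) i j k l 0 = A i j k l := by
  obtain ⟨r, hr, hr1, p, hp, hdet, hsol⟩ :=
    exists_pert_solution i₀ Bi A H s C hnorm fun t => contrComb (s t) C A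
  obtain ⟨lam, hlam⟩ : ∃ lam : ℝ, lam ^ 2 * p.1 = 1 := by
    refine ⟨(√p.1)⁻¹, ?_⟩
    rw [inv_pow, Real.sq_sqrt hp.le, inv_mul_cancel₀ hp.ne']
  have hopen : {z : E | ‖scaledCoord lam z‖ < r / 2} ∈ 𝓝 0 := by
    refine ((scaledCoord (E := E) lam).continuous.norm.tendsto 0).eventually (gt_mem_nhds ?_)
    simp [hr]
  obtain ⟨δ, hδ, hball⟩ := Metric.mem_nhds_iff.1 hopen
  have hbd : ∀ {z : E}, z ∈ Metric.ball (0 : E) δ → ∀ i, |scaledCoord lam z i| ≤ r / 2 :=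
    fun hz i => (norm_le_pi_norm _ i).trans (le_of_lt (hball hz))
  let Θ : E → Matrix (Idx E) (Idx E) ℝ := fun y => coframe Bi ((pertM i₀ A H p).map
      fun f => evalSeries f.val (scaledCoord lam y))
  have hΘmap : ∀ y (hy : y ∈ Metric.ball (0 : E) δ),
      (coframe Bi (pertM i₀ A H p)).map (eval hr1 (hbd hy)) = Θ y := fun y hy => map_coframe _ _ _
  have hcurv := fun y (hy : y ∈ Metric.ball (0 : E) δ) =>
    curvTensorCoeff_evalSeries hr1 hB hBi hA1 hA2 hH hdet lam (Θ := Θ) (fun _ => rfl) (hball hy)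
  refine ⟨δ, hδ, Θ, ?_, ?_, ?_, ?_, ?_⟩
  · have h0 := hΘmap 0 (Metric.mem_ball_self hδ)
    have hz : (pertM i₀ A H p).map (fun f => evalSeries f.val (scaledCoord lam (0 : E))) = 0 := by
      ext j k
      have : evalSeries (pertM i₀ A H p j k).val (0 : Idx E → ℝ) = 0 := eval_zero_pertM hr1 j k
      simpa using this
    change coframe Bi _ = 1
    rw [hz]
    simp [coframe]
  · intro i j
    exact (contDiffOn_evalSeries_scaledCoord hr1 lam
      (coframe Bi (pertM i₀ A H p) i j)).mono hball |>.congr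
      fun y hy => by rw [← hΘmap y hy]; rfl
  · intro y hy
    rw [← hΘmap y hy, ← AlgHom.mapMatrix_apply, ← AlgHom.map_det]
    exact hdet.map _
  · intro y hy t
    simp only [hcurv y hy]
    have h1 := congrArg (eval hr1 (hbd hy)) (hsol t)
    rw [map_contrComb_algHom, AlgHom.commutes] at h1
    have h2 : ∀ k, (frameConj Bi (pertM i₀ A H p) (C k)).map (eval hr1 (hbd hy))
        = (Θ y)⁻¹ * C k * ((Θ y)⁻¹)ᵀ := by
      intro k
      rw [map_frameConj _ _ _ hdet, frameConj, constMatrix_real, ← map_coframe, hΘmap y hy]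
    simp only [h2] at h1
    have h3 := map_contrComb (s t) (LinearMap.mulLeft ℝ (lam ^ 2))
      (fun k => (Θ y)⁻¹ * C k * ((Θ y)⁻¹)ᵀ)
      (fun i j k l => eval hr1 (hbd hy) (pertCurv i₀ Bi A H p i j k l))
    rw [h1] at h3
    simp only [LinearMap.mulLeft_apply, Algebra.algebraMap_self, RingHom.id_apply, ← mul_assoc,
      hlam, one_mul] at h3
    exact h3.symm
  · intro i j k l
    rw [hcurv 0 (Metric.mem_ball_self hδ), map_zero,
      eval_zero_pertCurv hr1 hA1 hA2 hA3 s C hnorm hdet hsol, ← mul_assoc, hlam, one_mul]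

end Real

/-! ### The symbols of the scalar curvatures -/

section Symbol

open Finset

variable {ι : Type*} [Fintype ι] [DecidableEq ι] {i₀ : ι}

/-- The symbol of a contraction in the direction `dx⁰`: of the four terms of the linearized
curvature two give the quadratic form `(CHC)₀₀` and two the trace term, each with factor `½`. When
`C` is skew, as for `τ⋆`, the trace term disappears. -/
lemma contr_linearCurv_secondDeriv (C : Matrix ι ι ℝ) {H : Matrix ι ι ℝ} (hH : Hᵀ = H) :
    contr C (linearCurv (secondDeriv i₀ H))
      = (C * H * C) i₀ i₀ - C i₀ i₀ * (C * H).trace := by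
  have hs : ∀ i j, H i j = H j i := fun i j => congrFun (congrFun hH j) i
  have e : ∀ i j c d, linearCurv (secondDeriv i₀ H) i j c d
      = (1 / 2) * ((if i = i₀ then 1 else 0) * (if c = i₀ then 1 else 0) * H j d)
        - (1 / 2) * ((if i = i₀ then 1 else 0) * (if d = i₀ then 1 else 0) * H j c)
        - (1 / 2) * ((if j = i₀ then 1 else 0) * (if c = i₀ then 1 else 0) * H i d)
        + (1 / 2) * ((if j = i₀ then 1 else 0) * (if d = i₀ then 1 else 0) * H i c) := by
    intro i j c d
    simp only [linearCurv, lowerChristoffel, secondDeriv, ite_and, smul_eq_mul]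
    split_ifs <;> ring
  simp only [contr, smul_eq_mul, e, mul_add, mul_sub, sum_add_distrib, sum_sub_distrib]
  simp only [ite_mul, mul_ite, one_mul, zero_mul, mul_zero, sum_ite_eq', mem_univ,
    if_true, sum_const_zero, sum_ite_irrel]
  have h1 : ∑ j, ∑ d, C i₀ j * C d i₀ * (1 / 2 * H j d) = (1 / 2) * (C * H * C) i₀ i₀ := by
    simp only [Matrix.mul_apply, sum_mul, mul_sum]
    rw [sum_comm]
    exact sum_congr rfl fun _ _ => sum_congr rfl fun _ _ => by ring
  have h2 : ∑ i, ∑ c, C c i₀ * C i₀ i * (1 / 2 * H i c) = (1 / 2) * (C * H * C) i₀ i₀ := by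
    rw [← h1]
    exact sum_congr rfl fun _ _ => sum_congr rfl fun _ _ => by ring
  have h3 : ∑ j, ∑ c, C c j * C i₀ i₀ * (1 / 2 * H j c)
      = (1 / 2) * (C i₀ i₀ * (C * H).trace) := by
    simp only [Matrix.mul_apply, Matrix.trace, Matrix.diag_apply, mul_sum]
    rw [sum_comm]
    exact sum_congr rfl fun _ _ => sum_congr rfl fun _ _ => by ring
  have h4 : ∑ i, ∑ d, C i₀ i₀ * C d i * (1 / 2 * H i d)
      = (1 / 2) * (C i₀ i₀ * (C * H).trace) := by
    rw [← h3]
    exact sum_congr rfl fun _ _ => sum_congr rfl fun _ _ => by ring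
  rw [h1, h2, h3, h4]
  ring

end Symbol

/-! ### Hyper structures as matrices and independence of the symbols of `τ` and `τ⋆` -/

section Hyper

open Finset

variable {ι : Type*} [Fintype ι] [DecidableEq ι]

/-- The matrices `L₀, L₁, L₂` satisfy the identities of a hyper Hermitian structure
(`σ = (1, 1, 1)`) or of a hyper para Hermitian structure (`σ = (1, -1, -1)`) for the Gram
matrix `G`. -/
structure IsHyperMatrix (σ : Fin 3 → ℝ) (G : Matrix ι ι ℝ) (L : Fin 3 → Matrix ι ι ℝ) : Prop where
  sq : ∀ a, L a * L a = -σ a • (1 : Matrix ι ι ℝ)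
  compat : ∀ a, (L a)ᵀ * G * L a = σ a • G
  mul : L 0 * L 1 = L 2
  mul_rev : L 1 * L 0 = -L 2

namespace IsHyperMatrix

variable {σ : Fin 3 → ℝ} {G Gi : Matrix ι ι ℝ} {L : Fin 3 → Matrix ι ι ℝ}

/-- All the identities are invariant under a change of frame; with `P` the coframe at a point this
gives the hyper structure of the manifold there. -/
lemma conj (h : IsHyperMatrix σ G L) {P : Matrix ι ι ℝ} (hP : IsUnit P.det) :
    IsHyperMatrix σ (Pᵀ * G * P) (fun a => P⁻¹ * L a * P) := by
  have e : ∀ X Y : Matrix ι ι ℝ, P⁻¹ * X * P * (P⁻¹ * Y * P) = P⁻¹ * (X * Y) * P := by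
    intro X Y
    rw [show P⁻¹ * X * P * (P⁻¹ * Y * P) = P⁻¹ * X * (P * P⁻¹) * Y * P by
      simp only [Matrix.mul_assoc], Matrix.mul_nonsing_inv _ hP, Matrix.mul_one]
    simp only [Matrix.mul_assoc]
  refine ⟨fun a => ?_, fun a => ?_, ?_, ?_⟩
  · rw [e, h.sq, Matrix.mul_smul, Matrix.smul_mul, Matrix.mul_one, Matrix.nonsing_inv_mul _ hP]
  · have h1 : Pᵀ * (P⁻¹)ᵀ = 1 := by
      rw [← Matrix.transpose_mul, Matrix.nonsing_inv_mul _ hP, Matrix.transpose_one]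
    have h2 : (P⁻¹ * L a * P)ᵀ * (Pᵀ * G * P) * (P⁻¹ * L a * P)
        = Pᵀ * ((L a)ᵀ * ((P * P⁻¹)ᵀ * G * (P * P⁻¹)) * L a) * P := by
      simp only [Matrix.transpose_mul, Matrix.mul_assoc]
    rw [h2, Matrix.mul_nonsing_inv _ hP, Matrix.transpose_one, Matrix.one_mul, Matrix.mul_one,
      h.compat, Matrix.mul_smul, Matrix.smul_mul]
  · rw [e, h.mul]
  · rw [e, h.mul_rev, Matrix.mul_neg, Matrix.neg_mul]

lemma mul_two_zero (h : IsHyperMatrix σ G L) (h0 : σ 0 = 1) : L 2 * L 0 = L 1 := by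
  rw [← neg_eq_iff_eq_neg.2 h.mul_rev, Matrix.neg_mul, Matrix.mul_assoc, h.sq, h0]
  simp

/-- Multiplying `LᵀGL = σG` by `L` on the right and using `L² = -σ` gives `LᵀG = -GL`, for either
sign: Hermitian and para Hermitian structures are both skew for the form. -/
lemma transpose_mul_inv (h : IsHyperMatrix σ G L) (hσ : ∀ a, σ a * σ a = 1) (hG : Gᵀ = G)
    (hGi : G * Gi = 1) (a : Fin 3) : (L a * Gi)ᵀ = -(L a * Gi) := by
  have hGi' : Gi * G = 1 := mul_eq_one_comm.1 hGi
  have hGit : Giᵀ = Gi := by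
    have : Giᵀ * G = 1 := by
      rw [← hG, ← Matrix.transpose_mul, hGi, Matrix.transpose_one]
    calc Giᵀ = Giᵀ * (G * Gi) := by rw [hGi, Matrix.mul_one]
      _ = Gi := by rw [← Matrix.mul_assoc, this, Matrix.one_mul]
  have h1 : (L a)ᵀ * G = -(G * L a) := by
    have h2 : (L a)ᵀ * G * L a * L a = σ a • (G * L a) := by rw [h.compat, Matrix.smul_mul]
    rw [Matrix.mul_assoc _ (L a), h.sq, Matrix.mul_smul, Matrix.mul_one] at h2
    have h3 := congrArg (fun X => σ a • X) h2
    simp only [smul_smul, hσ, one_smul, mul_neg] at h3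
    rw [← h3, neg_smul, one_smul, neg_neg]
  calc (L a * Gi)ᵀ = Gi * ((L a)ᵀ * G) * Gi := by
        rw [Matrix.transpose_mul, hGit, Matrix.mul_assoc, Matrix.mul_assoc, hGi, Matrix.mul_one]
    _ = -(Gi * G * (L a * Gi)) := by
        rw [h1]; simp only [Matrix.mul_neg, Matrix.neg_mul, Matrix.mul_assoc]
    _ = _ := by rw [hGi', Matrix.one_mul]

lemma mul_inv_apply_self (h : IsHyperMatrix σ G L) (hσ : ∀ a, σ a * σ a = 1) (hG : Gᵀ = G)
    (hGi : G * Gi = 1) (a : Fin 3) (i : ι) : (L a * Gi) i i = 0 := by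
  have := congrFun (congrFun (h.transpose_mul_inv hσ hG hGi a) i) i
  rw [Matrix.transpose_apply, Matrix.neg_apply] at this
  linarith

end IsHyperMatrix

/-- The coefficients of `τ` and `τ⋆` in terms of contractions. -/
def scalarCoeff (σ : Fin 3 → ℝ) : Fin 2 → Fin 4 → ℝ := ![![1, 0, 0, 0], ![0, σ 0, σ 1, σ 2]]

/-- The matrices of the contractions which define `τ` and `τ⋆`. -/
def scalarMatrix (Gi : Matrix ι ι ℝ) (L : Fin 3 → Matrix ι ι ℝ) : Fin 4 → Matrix ι ι ℝ :=
  ![Gi, L 0 * Gi, L 1 * Gi, L 2 * Gi]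

omit [DecidableEq ι] in
lemma contrComb_scalarCoeff_zero (σ : Fin 3 → ℝ) (Gi : Matrix ι ι ℝ) (L : Fin 3 → Matrix ι ι ℝ)
    (X : ι → ι → ι → ι → ℝ) :
    contrComb (scalarCoeff σ 0) (scalarMatrix Gi L) X = contr Gi X := by
  simp [contrComb, scalarCoeff, scalarMatrix, Fin.sum_univ_four]

omit [DecidableEq ι] in
lemma contrComb_scalarCoeff_one (σ : Fin 3 → ℝ) (Gi : Matrix ι ι ℝ) (L : Fin 3 → Matrix ι ι ℝ)
    (X : ι → ι → ι → ι → ℝ) :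
    contrComb (scalarCoeff σ 1) (scalarMatrix Gi L) X
      = σ 0 * contr (L 0 * Gi) X + σ 1 * contr (L 1 * Gi) X + σ 2 * contr (L 2 * Gi) X := by
  simp [contrComb, scalarCoeff, scalarMatrix, Fin.sum_univ_four]

/-- Two symmetric matrices on which the symbols of `τ` and `τ⋆` in a direction are linearly
independent. -/
theorem IsHyperMatrix.exists_dual_symbols {σ : Fin 3 → ℝ} {G Gi : Matrix ι ι ℝ}
    {L : Fin 3 → Matrix ι ι ℝ} (h : IsHyperMatrix σ G L) (hσ : ∀ a, σ a * σ a = 1)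
    (hσ0 : σ 0 = 1) (hG : Gᵀ = G) (hGi : G * Gi = 1) {i₀ : ι} (hi : Gi i₀ i₀ ≠ 0)
    (hcard : 4 < Fintype.card ι) :
    ∃ H : Fin 2 → Matrix ι ι ℝ, (∀ u, (H u)ᵀ = H u) ∧
      ∀ t u, contrComb (scalarCoeff σ t) (scalarMatrix Gi L)
        (linearCurv (secondDeriv i₀ (H u))) = if t = u then 1 else 0 := by
  have hGi' : Gi * G = 1 := mul_eq_one_comm.1 hGi
  set K : Fin 3 → Matrix ι ι ℝ := fun a => L a * Gi with hK
  have hKs : ∀ a, (K a)ᵀ = -K a := h.transpose_mul_inv hσ hG hGi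
  have hK0 : ∀ a, K a i₀ i₀ = 0 := fun a => h.mul_inv_apply_self hσ hG hGi a i₀
  have hKG : ∀ a, K a * G = L a := fun a => by
    rw [hK]; simp only; rw [Matrix.mul_assoc, hGi', Matrix.mul_one]
  set β := Gi i₀ i₀ with hβ
  set S : Matrix ι ι ℝ := Matrix.single i₀ i₀ 1 with hS
  -- Because `K 0` is skew, `W = (L 0)ᵀ S (L 0)`, the square of the covector `dx⁰ ∘ J₁`. The symbol
  -- of `τ` sees its trace, while the quadratic term of `τ` and the `J₂`, `J₃` terms of `τ⋆` vanish
  -- on it.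
  set W : Matrix ι ι ℝ := -(G * K 0 * S * (K 0 * G)) with hW
  have hSx : ∀ X Y : Matrix ι ι ℝ, (X * S * Y) i₀ i₀ = X i₀ i₀ * Y i₀ i₀ := by
    intro X Y
    simp [hS, Matrix.mul_apply, Matrix.single_apply, ite_and, sum_ite_eq]
  have htr : ∀ X Y : Matrix ι ι ℝ, (X * S * Y).trace = (Y * X) i₀ i₀ := by
    intro X Y
    rw [Matrix.trace_mul_comm, ← Matrix.mul_assoc, hS, Matrix.trace_mul_single]
    simp
  have hWs : Wᵀ = W := by
    rw [hW]
    simp only [Matrix.transpose_neg, Matrix.transpose_mul, hKs, hG, hS, Matrix.transpose_single,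
      Matrix.mul_neg, Matrix.neg_mul, neg_neg, Matrix.mul_assoc]
  have hK00 : ∀ a, (K a * G * K a) i₀ i₀ = -(σ a * β) := by
    intro a
    rw [hKG, hK]; simp only
    rw [← Matrix.mul_assoc, h.sq, Matrix.smul_mul, Matrix.one_mul, Matrix.smul_apply, smul_eq_mul,
      hβ]
    ring
  have hK10 : (K 1 * G * K 0) i₀ i₀ = 0 := by
    rw [hKG, hK]; simp only
    rw [← Matrix.mul_assoc, h.mul_rev, Matrix.neg_mul, Matrix.neg_apply]
    simpa using hK0 2
  have hK20 : (K 2 * G * K 0) i₀ i₀ = 0 := by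
    rw [hKG, hK]; simp only
    rw [← Matrix.mul_assoc, h.mul_two_zero hσ0]
    exact hK0 1
  have hKW : ∀ a, (K a * W * K a) i₀ i₀ = -((K a * G * K 0) i₀ i₀ * (K 0 * G * K a) i₀ i₀) := by
    intro a
    rw [← hSx, hW]
    simp only [Matrix.mul_neg, Matrix.neg_mul, Matrix.mul_assoc, Matrix.neg_apply]
  have hGW : (Gi * W * Gi) i₀ i₀ = 0 := by
    have : Gi * W * Gi = -((Gi * G) * K 0 * S * (K 0 * (G * Gi))) := by
      rw [hW]; simp only [Matrix.mul_neg, Matrix.neg_mul, Matrix.mul_assoc]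
    rw [this, hGi, hGi', Matrix.one_mul, Matrix.mul_one, Matrix.neg_apply, hSx, hK0]
    simp
  have htW : (Gi * W).trace = β := by
    have : Gi * W = -((Gi * G) * K 0 * S * (K 0 * G)) := by
      rw [hW]; simp only [Matrix.mul_neg, Matrix.mul_assoc]
    rw [this, hGi', Matrix.one_mul, Matrix.trace_neg, htr, hK00, hσ0]
    ring
  -- The two symbols on the span of `G` and `W` form the matrix with rows `((1 - n)β, -β²)` and
  -- `(-3β, -β²)`.
  have key : ∀ x y : ℝ, (x • G + y • W)ᵀ = x • G + y • W ∧
      contrComb (scalarCoeff σ 0) (scalarMatrix Gi L) (linearCurv (secondDeriv i₀ (x • G + y • W)))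
        = x * ((1 - Fintype.card ι) * β) - y * β ^ 2 ∧
      contrComb (scalarCoeff σ 1) (scalarMatrix Gi L) (linearCurv (secondDeriv i₀ (x • G + y • W)))
        = -3 * x * β - y * β ^ 2 := by
    intro x y
    have hsym : (x • G + y • W)ᵀ = x • G + y • W := by
      rw [Matrix.transpose_add, Matrix.transpose_smul, Matrix.transpose_smul, hG, hWs]
    have hlin : ∀ X : Matrix ι ι ℝ, (X * (x • G + y • W) * X) i₀ i₀
        = x * (X * G * X) i₀ i₀ + y * (X * W * X) i₀ i₀ := by
      intro X
      simp [Matrix.mul_add, Matrix.add_mul]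
    refine ⟨hsym, ?_, ?_⟩
    · rw [contrComb_scalarCoeff_zero, contr_linearCurv_secondDeriv _ hsym, hlin, hGi', hGW,
        Matrix.mul_add, Matrix.trace_add, Matrix.mul_smul, Matrix.mul_smul, Matrix.trace_smul,
        Matrix.trace_smul, hGi', htW, Matrix.trace_one, Matrix.one_mul, ← hβ]
      simp only [smul_eq_mul]
      ring
    · have hc : ∀ a, contr (L a * Gi) (linearCurv (secondDeriv i₀ (x • G + y • W)))
          = x * (-(σ a * β)) - y * ((K a * G * K 0) i₀ i₀ * (K 0 * G * K a) i₀ i₀) := by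
        intro a
        rw [contr_linearCurv_secondDeriv _ hsym]
        change (K a * (x • G + y • W) * K a) i₀ i₀ - K a i₀ i₀ * (K a * (x • G + y • W)).trace = _
        rw [hlin, hK0, hK00, hKW]
        ring
      rw [contrComb_scalarCoeff_one, hc, hc, hc, hK10, hK20, hK00]
      have h0 := hσ 0
      have h1 := hσ 1
      have h2 := hσ 2
      rw [hσ0]
      linear_combination (-x * β) * h1 + (-x * β) * h2
  have hm : (Fintype.card ι : ℝ) - 4 ≠ 0 := by
    have : (4 : ℝ) < Fintype.card ι := by exact_mod_cast hcard
    exact (sub_pos.2 this).ne'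
  set n : ℝ := (Fintype.card ι : ℝ)
  -- These coefficients are the columns of the inverse of that matrix, whose determinant is `(n -
  -- 4)β³`.
  refine ⟨![(-1 / ((n - 4) * β)) • G + (3 / ((n - 4) * β ^ 2)) • W,
    (1 / ((n - 4) * β)) • G + (-(n - 1) / ((n - 4) * β ^ 2)) • W], ?_, ?_⟩
  · intro u
    fin_cases u
    · exact (key _ _).1
    · exact (key _ _).1
  · intro t u
    fin_cases t <;> fin_cases u
    · refine (key _ _).2.1.trans ?_
      simp only [Fin.zero_eta, if_true]
      field_simp
      ring
    · refine (key _ _).2.1.trans ?_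
      simp only [Fin.zero_eta, Fin.mk_one, zero_ne_one, if_false]
      field_simp
      ring
    · refine (key _ _).2.2.trans ?_
      simp only [Fin.zero_eta, Fin.mk_one, one_ne_zero, if_false]
      field_simp
      ring
    · refine (key _ _).2.2.trans ?_
      simp only [Fin.mk_one, if_true]
      field_simp
      ring

end Hyper

/-! ### Manifolds covered by a single chart -/

section SingleChart

open Bundle

variable {E : Type*} [NormedAddCommGroup E] [NormedSpace ℝ E]
  {M : Type*} [TopologicalSpace M] [ChartedSpace E M]

lemma extChartAt_eq_of_chartAt_eq (hc : ∀ p q : M, chartAt E p = chartAt E q) (p q : M) :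
    extChartAt 𝓘(ℝ, E) p = extChartAt 𝓘(ℝ, E) q := by
  rw [extChartAt, hc p q, extChartAt]

lemma mem_extChartAt_source_of_chartAt_eq (hc : ∀ p q : M, chartAt E p = chartAt E q) (p q : M) :
    q ∈ (extChartAt 𝓘(ℝ, E) p).source := by
  rw [extChartAt_eq_of_chartAt_eq hc p q]; exact mem_extChartAt_source q

omit [NormedSpace ℝ E] in
lemma mem_chartAt_source_of_chartAt_eq (hc : ∀ p q : M, chartAt E p = chartAt E q) (p q : M) :
    q ∈ (chartAt E p).source := by
  rw [hc p q]; exact mem_chart_source E q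

variable [IsManifold 𝓘(ℝ, E) ∞ M]

/-- The tangent space at `q` is identified with `E` through the preferred chart at `q`. When all
preferred charts coincide, the derivative of the chart is the identity of `E` everywhere. -/
lemma mfderiv_extChartAt_of_chartAt_eq (hc : ∀ p q : M, chartAt E p = chartAt E q) (p q : M)
    (v : TangentSpace 𝓘(ℝ, E) q) :
    (mfderiv 𝓘(ℝ, E) 𝓘(ℝ, E) (extChartAt 𝓘(ℝ, E) p) q v : E) = v := by
  have : IsManifold 𝓘(ℝ, E) 1 M := IsManifold.of_le (n := ∞) (by exact_mod_cast le_top)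
  rw [extChartAt_eq_of_chartAt_eq hc p q, mfderiv_extChartAt_self]
  rfl

lemma mfderiv_extChartAt_symm_of_chartAt_eq (hc : ∀ p q : M, chartAt E p = chartAt E q) (p : M)
    {y : E} (hy : y ∈ (extChartAt 𝓘(ℝ, E) p).target) (v : E) :
    (mfderiv 𝓘(ℝ, E) 𝓘(ℝ, E) (extChartAt 𝓘(ℝ, E) p).symm y v : E) = v := by
  have : IsManifold 𝓘(ℝ, E) 1 M := IsManifold.of_le (n := ∞) (by exact_mod_cast le_top)
  have h := mfderiv_extChartAt_comp_mfderivWithin_extChartAt_symm (I := 𝓘(ℝ, E)) hy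
  have h2 := congrArg (fun L => L v) h
  have h3 := mfderiv_extChartAt_of_chartAt_eq hc p ((extChartAt 𝓘(ℝ, E) p).symm y)
    (mfderivWithin 𝓘(ℝ, E) 𝓘(ℝ, E) (extChartAt 𝓘(ℝ, E) p).symm (Set.range 𝓘(ℝ, E)) y v)
  have h4 : mfderivWithin 𝓘(ℝ, E) 𝓘(ℝ, E) (extChartAt 𝓘(ℝ, E) p).symm (Set.range 𝓘(ℝ, E)) y
      = mfderiv 𝓘(ℝ, E) 𝓘(ℝ, E) (extChartAt 𝓘(ℝ, E) p).symm y := by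
    rw [modelWithCornersSelf_coe, Set.range_id, mfderivWithin_univ]
  rw [← h4]
  exact h3.symm.trans h2

lemma continuousLinearMapAt_of_chartAt_eq (hc : ∀ p q : M, chartAt E p = chartAt E q) (p q : M)
    (v : TangentSpace 𝓘(ℝ, E) q) :
    haveI : IsManifold 𝓘(ℝ, E) 1 M := IsManifold.of_le (n := ∞) (by exact_mod_cast le_top)
    (trivializationAt E (TangentSpace 𝓘(ℝ, E)) p).continuousLinearMapAt ℝ q v = v := by
  have : IsManifold 𝓘(ℝ, E) 1 M := IsManifold.of_le (n := ∞) (by exact_mod_cast le_top)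
  rw [TangentBundle.continuousLinearMapAt_trivializationAt
    (mem_chartAt_source_of_chartAt_eq hc p q)]
  exact mfderiv_extChartAt_of_chartAt_eq hc p q v

lemma symmL_of_chartAt_eq (hc : ∀ p q : M, chartAt E p = chartAt E q) (p q : M) (v : E) :
    haveI : IsManifold 𝓘(ℝ, E) 1 M := IsManifold.of_le (n := ∞) (by exact_mod_cast le_top)
    (trivializationAt E (TangentSpace 𝓘(ℝ, E)) p).symmL ℝ q v = (v : E) := by
  have : IsManifold 𝓘(ℝ, E) 1 M := IsManifold.of_le (n := ∞) (by exact_mod_cast le_top)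
  rw [TangentBundle.symmL_trivializationAt (mem_chartAt_source_of_chartAt_eq hc p q),
    modelWithCornersSelf_coe, Set.range_id, mfderivWithin_univ]
  exact mfderiv_extChartAt_symm_of_chartAt_eq hc p
    ((extChartAt 𝓘(ℝ, E) p).map_source (mem_extChartAt_source_of_chartAt_eq hc p q)) v

/-- All trivializations of the tangent bundle are the identity, so a section of the endomorphism
bundle is smooth once it is smooth as a function with values in `E →L[ℝ] E`. -/
lemma contMDiff_endomorphism_of_chartAt_eq (hc : ∀ p q : M, chartAt E p = chartAt E q)
    {F : M → E →L[ℝ] E} (hF : ContMDiff 𝓘(ℝ, E) 𝓘(ℝ, E →L[ℝ] E) ∞ F) :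
    ContMDiff 𝓘(ℝ, E) (𝓘(ℝ, E).prod 𝓘(ℝ, E →L[ℝ] E)) ∞
      (fun p ↦ TotalSpace.mk' (E →L[ℝ] E)
        (E := fun p : M => TangentSpace 𝓘(ℝ, E) p →L[ℝ] TangentSpace 𝓘(ℝ, E) p) p (F p)) := by
  intro p
  rw [contMDiffAt_hom_bundle]
  refine ⟨contMDiffAt_id, ?_⟩
  convert! hF p
  rename_i q
  ext v
  exact (congrArg (fun u : E => ((trivializationAt E (TangentSpace 𝓘(ℝ, E)) p).continuousLinearMapAt
    ℝ q (F q u) : E)) (symmL_of_chartAt_eq hc p q v)).trans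
    (continuousLinearMapAt_of_chartAt_eq hc p q (F q v))

lemma contMDiff_bilin_of_chartAt_eq (hc : ∀ p q : M, chartAt E p = chartAt E q)
    {F : M → E →L[ℝ] E →L[ℝ] ℝ} (hF : ContMDiff 𝓘(ℝ, E) 𝓘(ℝ, E →L[ℝ] E →L[ℝ] ℝ) ∞ F) :
    ContMDiff 𝓘(ℝ, E) (𝓘(ℝ, E).prod 𝓘(ℝ, E →L[ℝ] E →L[ℝ] ℝ)) ∞
      (fun p ↦ TotalSpace.mk' (E →L[ℝ] E →L[ℝ] ℝ)
        (E := fun p : M => TangentSpace 𝓘(ℝ, E) p →L[ℝ] TangentSpace 𝓘(ℝ, E) p →L[ℝ] ℝ)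
        p (F p)) := by
  intro p
  rw [contMDiffAt_hom_bundle]
  refine ⟨contMDiffAt_id, ?_⟩
  convert! hF p
  rename_i q
  ext v w
  have hq : q ∈ (trivializationAt E (TangentSpace 𝓘(ℝ, E)) p).baseSet :=
    mem_chartAt_source_of_chartAt_eq hc p q
  have hs : ∀ v : E, (trivializationAt E (TangentSpace 𝓘(ℝ, E)) p).symm q v = v := fun v =>
    ((trivializationAt E (TangentSpace 𝓘(ℝ, E)) p).symmL_apply hq v).symm.trans
      (symmL_of_chartAt_eq hc p q v)
  refine (inCoordinates_apply_eq₂ (E₃ := Bundle.Trivial M ℝ)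
    (F₃ := ℝ) (ϕ := F q) hq hq (Set.mem_univ _)).trans ?_
  have ht : ∀ c : ℝ, (trivializationAt ℝ (Bundle.Trivial M ℝ) p).linearMapAt ℝ q c = c :=
    fun c => by simp
  exact (ht _).trans <| (congrArg (fun u : E => F q u _) (hs v)).trans (congrArg (F q v) (hs w))

end SingleChart

/-! ### Hyper structures and scalar curvatures in a basis -/

section Basis

open Finset Module

variable {V : Type*} [AddCommGroup V] [Module ℝ V]

/-- The common form of the definitions of hyper Hermitian (`σ = (1, 1, 1)`) and hyper para Hermitian
(`σ = (1, -1, -1)`) structures. -/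
structure IsHyperStructure (σ : Fin 3 → ℝ) (B : LinearMap.BilinForm ℝ V) (J : Fin 3 → V →ₗ[ℝ] V) :
    Prop where
  sq : ∀ a x, J a (J a x) = -σ a • x
  compat : ∀ a x y, B (J a x) (J a y) = σ a * B x y
  mul : ∀ x, J 0 (J 1 x) = J 2 x
  mul_rev : ∀ x, J 1 (J 0 x) = -J 2 x

lemma isHyperStructure_hermitian_iff {B : LinearMap.BilinForm ℝ V} {J : Fin 3 → V →ₗ[ℝ] V} :
    IsHyperStructure ![1, 1, 1] B J ↔ IsHyperHermitianStructure B J := by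
  constructor
  · intro h
    refine ⟨fun a => ⟨fun x => ?_, fun x y => ?_⟩, h.mul, h.mul_rev⟩
    · have := h.sq a x
      fin_cases a <;> simpa using this
    · have := h.compat a x y
      fin_cases a <;> simpa using this
  · intro h
    refine ⟨fun a x => ?_, fun a x y => ?_, h.mul, h.mul_rev⟩
    · have := (h.hermitian a).sq x
      fin_cases a <;> simpa using this
    · have := (h.hermitian a).compat x y
      fin_cases a <;> simpa using this

lemma isHyperStructure_paraHermitian_iff {B : LinearMap.BilinForm ℝ V} {J : Fin 3 → V →ₗ[ℝ] V} :
    IsHyperStructure ![1, -1, -1] B J ↔ IsHyperParaHermitianStructure B J := by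
  constructor
  · intro h
    refine ⟨⟨fun x => ?_, fun x y => ?_⟩, ⟨fun x => ?_, fun x y => ?_⟩,
      ⟨fun x => ?_, fun x y => ?_⟩, h.mul, h.mul_rev⟩
    · simpa using h.sq 0 x
    · simpa using h.compat 0 x y
    · simpa using h.sq 1 x
    · simpa using h.compat 1 x y
    · simpa using h.sq 2 x
    · simpa using h.compat 2 x y
  · intro h
    refine ⟨fun a x => ?_, fun a x y => ?_, h.mul, h.mul_rev⟩
    · fin_cases a
      · simpa using h.hermitian.sq x
      · simpa using h.para_one.sq x
      · simpa using h.para_two.sq x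
    · fin_cases a
      · simpa using h.hermitian.compat x y
      · simpa using h.para_one.compat x y
      · simpa using h.para_two.compat x y

variable {ι : Type*} [Fintype ι] [DecidableEq ι] (e : Basis ι ℝ V) {B : LinearMap.BilinForm ℝ V}

lemma isHyperMatrix_iff {σ : Fin 3 → ℝ} {J : Fin 3 → V →ₗ[ℝ] V} :
    IsHyperMatrix σ (LinearMap.BilinForm.toMatrix e B) (fun a => LinearMap.toMatrix e e (J a))
      ↔ IsHyperStructure σ B J := by
  have hsq : ∀ a, (LinearMap.toMatrix e e (J a) * LinearMap.toMatrix e e (J a)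
      = -σ a • (1 : Matrix ι ι ℝ)) ↔ ∀ x, J a (J a x) = -σ a • x := by
    intro a
    rw [← LinearMap.toMatrix_comp, ← LinearMap.toMatrix_id e, ← map_smul,
      (LinearMap.toMatrix e e).injective.eq_iff, LinearMap.ext_iff]
    rfl
  have hco : ∀ a, ((LinearMap.toMatrix e e (J a))ᵀ * LinearMap.BilinForm.toMatrix e B
      * LinearMap.toMatrix e e (J a) = σ a • LinearMap.BilinForm.toMatrix e B)
      ↔ ∀ x y, B (J a x) (J a y) = σ a * B x y := by
    intro a
    rw [← LinearMap.BilinForm.toMatrix_comp, ← map_smul,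
      (LinearMap.BilinForm.toMatrix e).injective.eq_iff, LinearMap.ext_iff₂]
    rfl
  have hm : LinearMap.toMatrix e e (J 0) * LinearMap.toMatrix e e (J 1)
      = LinearMap.toMatrix e e (J 2) ↔ ∀ x, J 0 (J 1 x) = J 2 x := by
    rw [← LinearMap.toMatrix_comp, (LinearMap.toMatrix e e).injective.eq_iff, LinearMap.ext_iff]
    rfl
  have hr : LinearMap.toMatrix e e (J 1) * LinearMap.toMatrix e e (J 0)
      = -LinearMap.toMatrix e e (J 2) ↔ ∀ x, J 1 (J 0 x) = -J 2 x := by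
    rw [← LinearMap.toMatrix_comp, ← map_neg, (LinearMap.toMatrix e e).injective.eq_iff,
      LinearMap.ext_iff]
    rfl
  exact ⟨fun h => ⟨fun a => (hsq a).1 (h.sq a), fun a => (hco a).1 (h.compat a), hm.1 h.mul,
      hr.1 h.mul_rev⟩,
    fun h => ⟨fun a => (hsq a).2 (h.sq a), fun a => (hco a).2 (h.compat a), hm.2 h.mul,
      hr.2 h.mul_rev⟩⟩

lemma invGram_eq : invGram e B = (LinearMap.BilinForm.toMatrix e B)⁻¹ := by
  rw [invGram]
  congr 1
  ext i j
  rw [LinearMap.BilinForm.toMatrix_apply, Matrix.of_apply]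

lemma scalarCurv_eq_contr (hB : (invGram e B)ᵀ = invGram e B) (A : V → V → V → V → ℝ) :
    scalarCurv e B A = contr (invGram e B) fun i j k l => A (e i) (e j) (e k) (e l) := by
  have hs : ∀ i j, invGram e B i j = invGram e B j i := fun i j => congrFun (congrFun hB j) i
  simp only [scalarCurv, contr, smul_eq_mul]
  refine sum_congr rfl fun i _ => sum_congr rfl fun j _ => sum_congr rfl fun k _ =>
    sum_congr rfl fun l _ => ?_
  rw [hs i l, hs j k, mul_comm (invGram e B l i)]

omit [DecidableEq ι] in
lemma sum_comm_pairs (f : ι → ι → ι → ι → ℝ) :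
    ∑ k, ∑ l, ∑ c, ∑ d, f k l c d = ∑ c, ∑ d, ∑ k, ∑ l, f k l c d := by
  simp only [sum_comm (s := univ) (f := fun l c => ∑ d, f _ l c d)]
  rw [sum_comm]
  refine sum_congr rfl fun c _ => ?_
  rw [sum_congr rfl fun k _ => sum_comm (f := fun l d => f k l c d), sum_comm]

/-- The two factors `J` in the last slots are absorbed into the two inverse metrics, so `τ⋆` is the
same contraction as `τ` with `ε⁻¹` replaced by `Jε⁻¹`. -/
lemma starScalarCurv_eq_contr (hB : (invGram e B)ᵀ = invGram e B) {A : V → V → V → V → ℝ}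
    {R : ι → ι → ι → ι → ℝ} (hA : ∀ x y z w, A x y z w = ∑ i, ∑ j, ∑ k, ∑ l,
      e.repr x i * e.repr y j * e.repr z k * e.repr w l * R i j k l) (J : V →ₗ[ℝ] V) :
    starScalarCurv e B A J = contr (LinearMap.toMatrix e e J * invGram e B) R := by
  have hs : ∀ i j, invGram e B i j = invGram e B j i := fun i j => congrFun (congrFun hB j) i
  set L := LinearMap.toMatrix e e J with hL
  have hJ : ∀ k c, e.repr (J (e k)) c = L c k := fun k c => (LinearMap.toMatrix_apply _ _ _ _ _).symm
  have hAJ : ∀ i j k l, A (e i) (e j) (J (e k)) (J (e l))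
      = ∑ c, ∑ d, L c k * L d l * R i j c d := by
    intro i j k l
    rw [hA]
    simp only [hJ, Basis.repr_self, Finsupp.single_apply, ite_mul, one_mul, zero_mul,
      sum_ite_irrel, sum_const_zero, sum_ite_eq, mem_univ, if_true]
  simp only [starScalarCurv, contr, smul_eq_mul, hAJ, Matrix.mul_apply]
  refine sum_congr rfl fun i _ => sum_congr rfl fun j _ => ?_
  simp only [mul_sum, sum_mul]
  rw [sum_comm_pairs]
  refine sum_congr rfl fun c _ => sum_congr rfl fun d _ => ?_
  rw [sum_comm]
  refine sum_congr rfl fun l _ => sum_congr rfl fun k _ => ?_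
  rw [hs i l, hs j k]
  ring

end Basis

/-! ### Metrics and endomorphism fields given by matrix-valued functions -/

section MatrixFields

open Finset Module Filter Topology

variable {E : Type*} [NormedAddCommGroup E] [NormedSpace ℝ E] [FiniteDimensional ℝ E]

/-- The continuous bilinear form on the coordinate space with a given Gram matrix. -/
noncomputable def bilinOf (G : Matrix (Idx E) (Idx E) ℝ) : E →L[ℝ] E →L[ℝ] ℝ :=
  LinearMap.toContinuousBilinearMap (Matrix.toBilin (coordBasis E) G)

/-- The continuous endomorphism of the coordinate space with a given matrix. -/
noncomputable def endOf (L : Matrix (Idx E) (Idx E) ℝ) : E →L[ℝ] E :=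
  LinearMap.toContinuousLinearMap (Matrix.toLin (coordBasis E) (coordBasis E) L)

lemma bilinOf_apply (G : Matrix (Idx E) (Idx E) ℝ) (v w : E) :
    bilinOf G v w = Matrix.toBilin (coordBasis E) G v w := rfl

lemma endOf_apply (L : Matrix (Idx E) (Idx E) ℝ) (v : E) :
    endOf L v = Matrix.toLin (coordBasis E) (coordBasis E) L v := rfl

lemma bilinOf_symm {G : Matrix (Idx E) (Idx E) ℝ} (hs : Gᵀ = G) (v w : E) :
    bilinOf G v w = bilinOf G w v := by
  rw [bilinOf_apply, bilinOf_apply, Matrix.toBilin_apply, Matrix.toBilin_apply, sum_comm]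
  refine sum_congr rfl fun i _ => sum_congr rfl fun j _ => ?_
  conv_lhs => rw [← hs, Matrix.transpose_apply]
  ring

lemma eq_zero_of_bilinOf {G : Matrix (Idx E) (Idx E) ℝ} (hn : IsUnit G.det) {v : E}
    (hv : ∀ w, bilinOf G v w = 0) : v = 0 := by
  have h1 : (Matrix.toBilin (coordBasis E) G).Nondegenerate := by
    rw [Matrix.nondegenerate_toBilin_iff, Matrix.nondegenerate_iff_det_ne_zero]
    exact hn.ne_zero
  exact h1.1 v hv

lemma contDiffOn_bilinOf {G : E → Matrix (Idx E) (Idx E) ℝ} {s : Set E} {n : ℕ∞ω}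
    (hG : ∀ i j, ContDiffOn ℝ n (fun y => G y i j) s) :
    ContDiffOn ℝ n (fun y => bilinOf (G y)) s := by
  refine contDiffOn_clm_apply.2 fun v => contDiffOn_clm_apply.2 fun w => ?_
  simp only [bilinOf_apply, Matrix.toBilin_apply]
  exact ContDiffOn.sum fun i _ => ContDiffOn.sum fun j _ =>
    (contDiffOn_const.mul (hG i j)).mul contDiffOn_const

lemma contDiffOn_endOf {L : E → Matrix (Idx E) (Idx E) ℝ} {s : Set E} {n : ℕ∞ω}
    (hL : ∀ i j, ContDiffOn ℝ n (fun y => L y i j) s) :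
    ContDiffOn ℝ n (fun y => endOf (L y)) s := by
  refine contDiffOn_clm_apply.2 fun v => ?_
  simp only [endOf_apply, Matrix.toLin_apply, Matrix.mulVec, dotProduct]
  exact ContDiffOn.sum fun i _ => (ContDiffOn.sum fun j _ =>
    (hL i j).mul contDiffOn_const).smul contDiffOn_const

variable {M : Type*} [TopologicalSpace M] [ChartedSpace E M] [IsManifold 𝓘(ℝ, E) ∞ M]

omit [FiniteDimensional ℝ E] [IsManifold 𝓘(ℝ, E) ∞ M] in
lemma contMDiff_comp_extChartAt {F : Type*} [NormedAddCommGroup F] [NormedSpace ℝ F]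
    (hc : ∀ p q : M, chartAt E p = chartAt E q) (x₀ : M) {f : E → F}
    (hf : ContDiffOn ℝ ∞ f (extChartAt 𝓘(ℝ, E) x₀).target) :
    ContMDiff 𝓘(ℝ, E) 𝓘(ℝ, F) ∞ fun p => f (extChartAt 𝓘(ℝ, E) x₀ p) := by
  have h1 : ContMDiff 𝓘(ℝ, E) 𝓘(ℝ, E) ∞ (extChartAt 𝓘(ℝ, E) x₀) := by
    intro p
    rw [extChartAt_eq_of_chartAt_eq hc x₀ p]
    exact contMDiffAt_extChartAt
  exact hf.contMDiffOn.comp_contMDiff h1 fun p =>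
    (extChartAt 𝓘(ℝ, E) x₀).map_source (mem_extChartAt_source_of_chartAt_eq hc x₀ p)

/-- The metric with given coefficients on a manifold covered by one chart. -/
noncomputable def metricOfMatrix (hc : ∀ p q : M, chartAt E p = chartAt E q) (x₀ : M)
    (G : E → Matrix (Idx E) (Idx E) ℝ)
    (hG : ∀ i j, ContDiffOn ℝ ∞ (fun y => G y i j) (extChartAt 𝓘(ℝ, E) x₀).target)
    (hs : ∀ y, (G y)ᵀ = G y) (hn : ∀ y ∈ (extChartAt 𝓘(ℝ, E) x₀).target, IsUnit (G y).det) :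
    PseudoRiemannianMetric E M where
  inner p := bilinOf (E := E) (G (extChartAt 𝓘(ℝ, E) x₀ p))
  symm _ v w := bilinOf_symm (hs _) v w
  nondegenerate p v hv := eq_zero_of_bilinOf (hn _ ((extChartAt 𝓘(ℝ, E) x₀).map_source
    (mem_extChartAt_source_of_chartAt_eq hc x₀ p))) (v := v) hv
  contMDiff := contMDiff_bilin_of_chartAt_eq hc
    (contMDiff_comp_extChartAt hc x₀ (contDiffOn_bilinOf hG))

/-- The field of endomorphisms with given matrices on a manifold covered by one chart. -/
noncomputable def endOfMatrix (hc : ∀ p q : M, chartAt E p = chartAt E q) (x₀ : M)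
    (L : E → Matrix (Idx E) (Idx E) ℝ)
    (hL : ∀ i j, ContDiffOn ℝ ∞ (fun y => L y i j) (extChartAt 𝓘(ℝ, E) x₀).target) :
    EndomorphismField E M where
  toFun p := endOf (E := E) (L (extChartAt 𝓘(ℝ, E) x₀ p))
  contMDiff := contMDiff_endomorphism_of_chartAt_eq hc
    (contMDiff_comp_extChartAt hc x₀ (contDiffOn_endOf hL))

variable {hc : ∀ p q : M, chartAt E p = chartAt E q} {x₀ : M}

lemma toMatrix_endAt_endOfMatrix {L : E → Matrix (Idx E) (Idx E) ℝ}
    {hL : ∀ i j, ContDiffOn ℝ ∞ (fun y => L y i j) (extChartAt 𝓘(ℝ, E) x₀).target} (p : M) :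
    LinearMap.toMatrix (PseudoRiemannianMetric.tangentBasis p)
      (PseudoRiemannianMetric.tangentBasis p) ((endOfMatrix hc x₀ L hL).endAt p)
      = L (extChartAt 𝓘(ℝ, E) x₀ p) :=
  LinearMap.toMatrix_toLin (coordBasis E) (coordBasis E) _

variable {G : E → Matrix (Idx E) (Idx E) ℝ}
  {hG : ∀ i j, ContDiffOn ℝ ∞ (fun y => G y i j) (extChartAt 𝓘(ℝ, E) x₀).target}
  {hs : ∀ y, (G y)ᵀ = G y} {hn : ∀ y ∈ (extChartAt 𝓘(ℝ, E) x₀).target, IsUnit (G y).det}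

lemma toMatrix_form_metricOfMatrix (p : M) :
    LinearMap.BilinForm.toMatrix (PseudoRiemannianMetric.tangentBasis p)
      ((metricOfMatrix hc x₀ G hG hs hn).form p) = G (extChartAt 𝓘(ℝ, E) x₀ p) :=
  LinearMap.BilinForm.toMatrix_toBilin (coordBasis E) _

lemma coeffInChart_metricOfMatrix (p : M) {y : E} (hy : y ∈ (extChartAt 𝓘(ℝ, E) x₀).target) :
    (metricOfMatrix hc x₀ G hG hs hn).coeffInChart p y = G y := by
  have hp := extChartAt_eq_of_chartAt_eq hc p x₀
  rw [PseudoRiemannianMetric.coeffInChart, hp]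
  ext i j
  have h := mfderiv_extChartAt_symm_of_chartAt_eq hc x₀ hy
  have h1 : bilinOf (G y) (coordBasis E i) (coordBasis E j) = G y i j := by
    rw [bilinOf_apply, ← LinearMap.BilinForm.toMatrix_apply, LinearMap.BilinForm.toMatrix_toBilin]
  rw [← h1]
  change bilinOf (G (extChartAt 𝓘(ℝ, E) x₀ ((extChartAt 𝓘(ℝ, E) x₀).symm y))) _ _ = _
  rw [(extChartAt 𝓘(ℝ, E) x₀).right_inv hy]
  exact congrArg₂ (fun v w : E => bilinOf (G y) v w) (h _) (h _)

lemma curvature_metricOfMatrix (p : M) (x y z w : TangentSpace 𝓘(ℝ, E) p) :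
    (metricOfMatrix hc x₀ G hG hs hn).curvature p x y z w = ∑ i, ∑ j, ∑ k, ∑ l,
      (PseudoRiemannianMetric.tangentBasis p).repr x i *
      (PseudoRiemannianMetric.tangentBasis p).repr y j *
      (PseudoRiemannianMetric.tangentBasis p).repr z k *
      (PseudoRiemannianMetric.tangentBasis p).repr w l *
      curvTensorCoeff G i j k l (extChartAt 𝓘(ℝ, E) x₀ p) := by
  have ht : ∀ v i, tangentCoord (extChartAt 𝓘(ℝ, E) p) p v i
      = (PseudoRiemannianMetric.tangentBasis p).repr v i := by
    intro v i
    exact congrArg (fun u : E => (coordBasis E).coord i u)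
      (mfderiv_extChartAt_of_chartAt_eq hc p p v)
  -- The coefficients in the chart agree with `G` only on the chart's target; it is a neighbourhood
  -- of the point, and the curvature depends only on the germ.
  have hev : (metricOfMatrix hc x₀ G hG hs hn).coeffInChart p
      =ᶠ[𝓝 (extChartAt 𝓘(ℝ, E) x₀ p)] G := by
    have hp : (extChartAt 𝓘(ℝ, E) x₀).target ∈ 𝓝 (extChartAt 𝓘(ℝ, E) x₀ p) := by
      rw [extChartAt_eq_of_chartAt_eq hc x₀ p]
      exact extChartAt_target_mem_nhds p
    filter_upwards [hp] with y hy
    exact coeffInChart_metricOfMatrix p hy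
  rw [PseudoRiemannianMetric.curvature]
  simp only [ht]
  rw [extChartAt_eq_of_chartAt_eq hc p x₀]
  simp only [fun i j k l => curvTensorCoeff_congr hev i j k l]

end MatrixFields

/-! ### Realization -/

section Realization

open Finset Module Filter Topology

/-- The inclusion into `E` is the preferred chart at every point, so coordinates are the points
themselves. -/
lemma exists_chartedSpace_ball {E : Type*} [NormedAddCommGroup E] [NormedSpace ℝ E] {δ : ℝ}
    (hδ : 0 < δ) :
    ∃ (_ : ChartedSpace E (Metric.ball (0 : E) δ))
      (_ : IsManifold 𝓘(ℝ, E) ∞ (Metric.ball (0 : E) δ)),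
      (∀ p q : Metric.ball (0 : E) δ, chartAt E p = chartAt E q) ∧
      (∀ p q : Metric.ball (0 : E) δ, extChartAt 𝓘(ℝ, E) p q = (q : E)) ∧
      ∀ p : Metric.ball (0 : E) δ, (extChartAt 𝓘(ℝ, E) p).target = Metric.ball 0 δ := by
  have he : IsOpenEmbedding (Subtype.val : Metric.ball (0 : E) δ → E) :=
    Metric.isOpen_ball.isOpenEmbedding_subtypeVal
  have : Nonempty (Metric.ball (0 : E) δ) := ⟨⟨0, Metric.mem_ball_self hδ⟩⟩
  let _ := he.singletonChartedSpace
  refine ⟨inferInstance, he.isManifold_singleton, fun _ _ => rfl, fun p q => rfl, fun p => ?_⟩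
  rw [extChartAt_target]
  have : (chartAt E p).target = Metric.ball 0 δ := by
    change (he.toOpenPartialHomeomorph _).target = _
    rw [Topology.IsOpenEmbedding.toOpenPartialHomeomorph_target, Subtype.range_coe]
  rw [this]
  simp

section Basis

variable {V : Type*} [AddCommGroup V] [Module ℝ V]

lemma exists_orthogonal_basis_of_finrank_eq [FiniteDimensional ℝ V] {B : LinearMap.BilinForm ℝ V}
    (hB : ∀ x y, B x y = B y x) {n : ℕ} (hn : finrank ℝ V = n) :
    ∃ b : Basis (Fin n) ℝ V, ∀ i j, i ≠ j → B (b i) (b j) = 0 := by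
  subst hn
  obtain ⟨v, hv⟩ := LinearMap.BilinForm.exists_orthogonal_basis (B := B) ⟨hB⟩
  exact ⟨v, fun i j hij => hv hij⟩

variable {ι : Type*} [Fintype ι] [DecidableEq ι]

omit [DecidableEq ι] in
lemma multilinear_eq_sum (b : Basis ι ℝ V) (A : V →ₗ[ℝ] V →ₗ[ℝ] V →ₗ[ℝ] V →ₗ[ℝ] ℝ)
    (x y z w : V) : A x y z w = ∑ i, ∑ j, ∑ k, ∑ l,
      b.repr x i * b.repr y j * b.repr z k * b.repr w l * A (b i) (b j) (b k) (b l) := by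
  have h1 : ∀ x y z w, A x y z w = ∑ i, b.repr x i * A (b i) y z w := by
    intro x y z w
    conv_lhs => rw [← b.sum_repr x]
    simp only [map_sum, map_smul, LinearMap.sum_apply, LinearMap.smul_apply, smul_eq_mul]
  have h2 : ∀ x y z w, A x y z w = ∑ i, b.repr y i * A x (b i) z w := by
    intro x y z w
    conv_lhs => rw [← b.sum_repr y]
    simp only [map_sum, map_smul, LinearMap.sum_apply, LinearMap.smul_apply, smul_eq_mul]
  have h3 : ∀ x y z w, A x y z w = ∑ i, b.repr z i * A x y (b i) w := by
    intro x y z w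
    conv_lhs => rw [← b.sum_repr z]
    simp only [map_sum, map_smul, LinearMap.sum_apply, LinearMap.smul_apply, smul_eq_mul]
  have h4 : ∀ x y z w, A x y z w = ∑ i, b.repr w i * A x y z (b i) := by
    intro x y z w
    conv_lhs => rw [← b.sum_repr w]
    simp only [map_sum, map_smul, smul_eq_mul]
  rw [h1]
  refine sum_congr rfl fun i _ => ?_
  rw [h2, mul_sum]
  refine sum_congr rfl fun j _ => ?_
  rw [h3, mul_sum, mul_sum]
  refine sum_congr rfl fun k _ => ?_
  rw [h4, mul_sum, mul_sum, mul_sum]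
  refine sum_congr rfl fun l _ => ?_
  ring

omit [Fintype ι] [DecidableEq ι] in
lemma repr_equiv_refl {W : Type*} [AddCommGroup W] [Module ℝ W] (b : Basis ι ℝ V) (e : Basis ι ℝ W)
    (x : V) (i : ι) : e.repr (b.equiv e (Equiv.refl _) x) i = b.repr x i := by
  have h : (e.coord i).comp (b.equiv e (Equiv.refl _)).toLinearMap = b.coord i := by
    refine b.ext fun j => ?_
    simp
  exact LinearMap.congr_fun h x

end Basis

/-- Since `P⁻¹(LG⁻¹)P⁻ᵀ = (P⁻¹LP)(P⁻¹G⁻¹P⁻ᵀ)`, the conjugated contraction matrices are those of the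
moved metric and structure. This identifies the contractions prescribed for the coframe with the
geometric `τ` and `τ⋆`. -/
lemma scalarMatrix_conj {ι : Type*} [Fintype ι] [DecidableEq ι] {P Gi : Matrix ι ι ℝ}
    (hP : IsUnit P.det) (L : Fin 3 → Matrix ι ι ℝ) (k : Fin 4) :
    P⁻¹ * scalarMatrix Gi L k * (P⁻¹)ᵀ
      = scalarMatrix (P⁻¹ * Gi * (P⁻¹)ᵀ) (fun a => P⁻¹ * L a * P) k := by
  have h : ∀ X : Matrix ι ι ℝ, P⁻¹ * (X * Gi) * (P⁻¹)ᵀ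
      = P⁻¹ * X * P * (P⁻¹ * Gi * (P⁻¹)ᵀ) := by
    intro X
    rw [show P⁻¹ * X * P * (P⁻¹ * Gi * (P⁻¹)ᵀ) = P⁻¹ * X * (P * P⁻¹) * Gi * (P⁻¹)ᵀ by
      simp only [Matrix.mul_assoc], Matrix.mul_nonsing_inv _ hP, Matrix.mul_one]
    simp only [Matrix.mul_assoc]
  fin_cases k
  · rfl
  · exact h _
  · exact h _
  · exact h _

/-- Both cases at once, the signs `σ` recording which of the `J a` are Hermitian and which para
Hermitian. -/
theorem exists_realization {E : Type} [NormedAddCommGroup E] [NormedSpace ℝ E]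
    [FiniteDimensional ℝ E] {V : Type*} [AddCommGroup V] [Module ℝ V] [FiniteDimensional ℝ V]
    (hE : finrank ℝ V = finrank ℝ E) (hm : 4 < finrank ℝ E) {B : LinearMap.BilinForm ℝ V}
    {A : V →ₗ[ℝ] V →ₗ[ℝ] V →ₗ[ℝ] V →ₗ[ℝ] ℝ} (hA : IsCurvatureModel B A)
    {J : Fin 3 → V →ₗ[ℝ] V} {σ : Fin 3 → ℝ} (hσ : ∀ a, σ a * σ a = 1) (hσ0 : σ 0 = 1)
    (hJ : IsHyperStructure σ B J) :
    ∃ (M : Type) (_ : TopologicalSpace M) (_ : ChartedSpace E M) (_ : IsManifold 𝓘(ℝ, E) ∞ M)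
      (g : PseudoRiemannianMetric E M) (𝒥 : Fin 3 → EndomorphismField E M) (P : M),
      T2Space M ∧ SecondCountableTopology M ∧ ConnectedSpace M ∧
      (∀ p, IsHyperStructure σ (g.form p) (fun a => (𝒥 a).endAt p)) ∧
      g.RealizesAt 𝒥 P B J A ∧
      (∃ c : ℝ, ∀ p, g.scalarCurvature p = c) ∧
      (∃ c : ℝ, ∀ p, ∑ a, σ a * starScalarCurv (PseudoRiemannianMetric.tangentBasis p) (g.form p)
        (g.curvature p) ((𝒥 a).endAt p) = c) := by
  -- In an orthogonal basis the inverse Gram matrix is diagonal with nonzero entries, so every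
  -- coordinate direction is non-null, whatever the signature. The basis is indexed by the
  -- coordinates of `E`.
  obtain ⟨b, hb⟩ := exists_orthogonal_basis_of_finrank_eq hA.symm hE
  set Bm := LinearMap.BilinForm.toMatrix b B with hBm
  set Lm := fun a => LinearMap.toMatrix b b (J a) with hLm
  have hL : IsHyperMatrix σ Bm Lm := (isHyperMatrix_iff b).2 hJ
  have hBs : Bmᵀ = Bm := by
    ext i j
    rw [Matrix.transpose_apply, hBm, LinearMap.BilinForm.toMatrix_apply,
      LinearMap.BilinForm.toMatrix_apply, hA.symm]
  have hBd : Bm = Matrix.diagonal fun i => B (b i) (b i) := by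
    ext i j
    rw [hBm, LinearMap.BilinForm.toMatrix_apply, Matrix.diagonal_apply]
    split_ifs with h
    · rw [h]
    · exact hb i j h
  have hBu : ∀ i, B (b i) (b i) ≠ 0 := by
    intro i h0
    refine b.ne_zero i (hA.nondegenerate _ fun y => ?_)
    rw [← b.sum_repr y, map_sum]
    refine sum_eq_zero fun j _ => ?_
    rw [map_smul]
    by_cases h : i = j
    · rw [← h, h0, smul_zero]
    · rw [hb i j h, smul_zero]
  set Bi := Matrix.diagonal fun i => (B (b i) (b i))⁻¹ with hBi'
  have hBi : Bm * Bi = 1 := by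
    rw [hBd, Matrix.diagonal_mul_diagonal, ← Matrix.diagonal_one]
    exact congrArg _ (funext fun i => mul_inv_cancel₀ (hBu i))
  have hBinv : Bm⁻¹ = Bi := Matrix.inv_eq_right_inv hBi
  have hBdet : IsUnit Bm.det := by
    rw [← Matrix.isUnit_iff_isUnit_det]
    exact IsUnit.of_mul_eq_one _ hBi
  let i₀ : Idx E := ⟨0, by omega⟩
  obtain ⟨H, hH, hnorm⟩ := hL.exists_dual_symbols hσ hσ0 hBs hBi (i₀ := i₀)
    (by rw [hBi', Matrix.diagonal_apply_eq]; exact inv_ne_zero (hBu _)) (by simpa using hm)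
  obtain ⟨δ, hδ, Θ, hΘ0, hΘc, hΘd, hconst, hcurv⟩ := exists_coframe
    (A := fun i j k l => A (b i) (b j) (b k) (b l)) i₀ hBs hBi
    (fun i j k l => hA.curvature.antisymm _ _ _ _) (fun i j k l => hA.curvature.pair_symm _ _ _ _)
    (fun i j k l => hA.curvature.bianchi _ _ _ _) hH (scalarCoeff σ) (scalarMatrix Bi Lm) hnorm
  set G : E → Matrix (Idx E) (Idx E) ℝ := fun y => (Θ y)ᵀ * Bm * Θ y with hGdef
  set L : Fin 3 → E → Matrix (Idx E) (Idx E) ℝ := fun a y => (Θ y)⁻¹ * Lm a * Θ y with hLdef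
  have hGs : ∀ y, (G y)ᵀ = G y := fun y => by
    rw [hGdef]
    simp only [Matrix.transpose_mul, Matrix.transpose_transpose, hBs, Matrix.mul_assoc]
  have hmulc : ∀ {X Y : E → Matrix (Idx E) (Idx E) ℝ},
      (∀ i j, ContDiffOn ℝ ∞ (fun y => X y i j) (Metric.ball 0 δ)) →
      (∀ i j, ContDiffOn ℝ ∞ (fun y => Y y i j) (Metric.ball 0 δ)) →
      ∀ i j, ContDiffOn ℝ ∞ (fun y => (X y * Y y) i j) (Metric.ball 0 δ) := by
    intro X Y hX hY i j
    simp only [Matrix.mul_apply]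
    exact ContDiffOn.sum fun k _ => (hX i k).mul (hY k j)
  have hΘi : ∀ i j, ContDiffOn ℝ ∞ (fun y => (Θ y)⁻¹ i j) (Metric.ball 0 δ) := fun i j y hy =>
    (contDiffAt_matrix_inv (fun i j => (hΘc i j).contDiffAt (Metric.isOpen_ball.mem_nhds hy))
      (hΘd y hy) i j).contDiffWithinAt
  have hGc : ∀ i j, ContDiffOn ℝ ∞ (fun y => G y i j) (Metric.ball 0 δ) :=
    hmulc (hmulc (fun i j => hΘc j i) fun _ _ => contDiffOn_const) hΘc
  have hLc : ∀ a i j, ContDiffOn ℝ ∞ (fun y => L a y i j) (Metric.ball 0 δ) := fun a =>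
    hmulc (hmulc hΘi fun _ _ => contDiffOn_const) hΘc
  have hGd : ∀ y ∈ Metric.ball (0 : E) δ, IsUnit (G y).det := by
    intro y hy
    rw [hGdef]
    simp only [Matrix.det_mul, Matrix.det_transpose]
    exact ((hΘd y hy).mul hBdet).mul (hΘd y hy)
  obtain ⟨_, _, hc, hval, htar⟩ := exists_chartedSpace_ball (E := E) hδ
  let P : Metric.ball (0 : E) δ := ⟨0, Metric.mem_ball_self hδ⟩
  let g : PseudoRiemannianMetric E (Metric.ball (0 : E) δ) :=
    metricOfMatrix hc P G (by rwa [htar]) hGs (by rwa [htar])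
  let 𝒥 : Fin 3 → EndomorphismField E (Metric.ball (0 : E) δ) := fun a =>
    endOfMatrix hc P (L a) (by rw [htar]; exact hLc a)
  have hform : ∀ p, LinearMap.BilinForm.toMatrix (PseudoRiemannianMetric.tangentBasis p) (g.form p)
      = G p := fun p => (toMatrix_form_metricOfMatrix p).trans (by rw [hval])
  have hend : ∀ a p, LinearMap.toMatrix (PseudoRiemannianMetric.tangentBasis p)
      (PseudoRiemannianMetric.tangentBasis p) ((𝒥 a).endAt p) = L a p := fun a p =>
    (toMatrix_endAt_endOfMatrix p).trans (by rw [hval])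
  have hR : ∀ (p) (x y z w : TangentSpace 𝓘(ℝ, E) p), g.curvature p x y z w
      = ∑ i, ∑ j, ∑ k, ∑ l,
      (PseudoRiemannianMetric.tangentBasis p).repr x i *
      (PseudoRiemannianMetric.tangentBasis p).repr y j *
      (PseudoRiemannianMetric.tangentBasis p).repr z k *
      (PseudoRiemannianMetric.tangentBasis p).repr w l * curvTensorCoeff G i j k l p := fun p x y z w =>
    (curvature_metricOfMatrix p x y z w).trans (by rw [hval])
  have hinv : ∀ p, invGram (PseudoRiemannianMetric.tangentBasis p) (g.form p)
      = (Θ p)⁻¹ * Bi * ((Θ p)⁻¹)ᵀ := by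
    intro p
    rw [invGram_eq, hform, hGdef]
    simp only [Matrix.mul_inv_rev, hBinv, Matrix.transpose_nonsing_inv, Matrix.mul_assoc]
  have hinvs : ∀ p, (invGram (PseudoRiemannianMetric.tangentBasis p) (g.form p))ᵀ
      = invGram (PseudoRiemannianMetric.tangentBasis p) (g.form p) := by
    intro p
    rw [invGram_eq, hform, Matrix.transpose_nonsing_inv, hGs]
  refine ⟨Metric.ball (0 : E) δ, inferInstance, _, _, g, 𝒥, P, inferInstance, ?_, ?_, ?_, ?_, ?_, ?_⟩
  · have : SecondCountableTopology E := by
      have := FiniteDimensional.proper_real E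
      infer_instance
    infer_instance
  · exact isConnected_iff_connectedSpace.1
      ((convex_ball (0 : E) δ).isConnected ⟨0, Metric.mem_ball_self hδ⟩)
  · intro p
    rw [← isHyperMatrix_iff (PseudoRiemannianMetric.tangentBasis p), hform]
    simp only [hend]
    exact hL.conj (hΘd p p.2)
  · have hP : (P : E) = 0 := rfl
    set e := PseudoRiemannianMetric.tangentBasis (E := E) P with he
    -- As `Θ 0 = 1`, the matrices of metric and structure at the origin in the coordinate basis are
    -- those of the model in `b`; matching the two bases is the isomorphism sought.
    let φ := b.equiv e (Equiv.refl _)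
    have hφ : ∀ x i, e.repr (φ x) i = b.repr x i := repr_equiv_refl b e
    have hφb : ∀ i, φ (b i) = e i := fun i => Basis.equiv_apply _ _ _ _
    have hG0 : G P = Bm := by
      rw [hGdef]
      simp only [hP, hΘ0, Matrix.transpose_one, Matrix.one_mul, Matrix.mul_one]
    have hL0 : ∀ a, L a P = Lm a := fun a => by
      rw [hLdef]
      simp only [hP, hΘ0, inv_one, Matrix.one_mul, Matrix.mul_one]
    refine ⟨φ, ?_, ?_, ?_⟩
    · have h : (g.form P).comp φ.toLinearMap φ.toLinearMap = B := by
        refine (LinearMap.BilinForm.toMatrix b).injective (Matrix.ext fun i j => ?_)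
        rw [LinearMap.BilinForm.toMatrix_apply, LinearMap.BilinForm.comp_apply]
        change g.form P (φ (b i)) (φ (b j)) = Bm i j
        rw [hφb, hφb, ← LinearMap.BilinForm.toMatrix_apply, hform, hG0]
      exact fun x y => LinearMap.congr_fun₂ h x y
    · intro x y z w
      rw [hR, multilinear_eq_sum b A x y z w]
      simp only [← he, hφ, hP, hcurv]
    · intro a
      have h : (𝒥 a).endAt P ∘ₗ φ.toLinearMap = φ.toLinearMap ∘ₗ J a := by
        have h1 : LinearMap.toMatrix b e φ.toLinearMap = 1 :=
          LinearMap.toMatrix_basis_equiv e b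
        refine (LinearMap.toMatrix b e).injective ?_
        rw [LinearMap.toMatrix_comp b e e, LinearMap.toMatrix_comp b b e, h1, hend, hL0,
          Matrix.one_mul, Matrix.mul_one]
      exact LinearMap.congr_fun h
  · refine ⟨contrComb (scalarCoeff σ 0) (scalarMatrix Bi Lm)
      fun i j k l => A (b i) (b j) (b k) (b l), fun p => ?_⟩
    rw [← hconst p p.2 0, PseudoRiemannianMetric.scalarCurvature, scalarCurv_eq_contr _ (hinvs p)]
    simp only [scalarMatrix_conj (hΘd p p.2)]
    rw [contrComb_scalarCoeff_zero, hinv]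
    congr 1
    funext i j k l
    rw [hR]
    simp [Finsupp.single_apply]
  · refine ⟨contrComb (scalarCoeff σ 1) (scalarMatrix Bi Lm)
      fun i j k l => A (b i) (b j) (b k) (b l), fun p => ?_⟩
    rw [← hconst p p.2 1]
    simp only [scalarMatrix_conj (hΘd p p.2)]
    rw [contrComb_scalarCoeff_one, Fin.sum_univ_three]
    simp only [starScalarCurv_eq_contr _ (hinvs p) (hR p), hend, hinv]
    rfl

end Realization

end CurvReal

theorem theorem6p1 {V : Type*} [AddCommGroup V] [Module ℝ V] [FiniteDimensional ℝ V]
    (m : ℕ) (hm : 8 ≤ m) (hV : Module.finrank ℝ V = m)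
    (B : LinearMap.BilinForm ℝ V) (A : V →ₗ[ℝ] V →ₗ[ℝ] V →ₗ[ℝ] V →ₗ[ℝ] ℝ)
    (hA : IsCurvatureModel B A) (J : Fin 3 → V →ₗ[ℝ] V) :
    (IsHyperHermitianStructure B J →
      HyperHermitianRealizable (EuclideanSpace ℝ (Fin m)) B J A) ∧
    (IsHyperParaHermitianStructure B J →
      HyperParaHermitianRealizable (EuclideanSpace ℝ (Fin m)) B J A) := by
  have hE : Module.finrank ℝ (EuclideanSpace ℝ (Fin m)) = m := finrank_euclideanSpace_fin
  have hm' : 4 < Module.finrank ℝ (EuclideanSpace ℝ (Fin m)) := by omega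
  constructor
  · intro hJ
    obtain ⟨M, i1, i2, i3, g, 𝒥, P, h1, h2, h3, h4, h5, h6, c, h7⟩ :=
      exists_realization (hV.trans hE.symm) hm' hA (σ := ![1, 1, 1])
        (fun a => by fin_cases a <;> simp) rfl (isHyperStructure_hermitian_iff.2 hJ)
    refine ⟨M, i1, i2, i3, g, 𝒥, P, h1, h2, h3,
      fun p => isHyperStructure_hermitian_iff.1 (h4 p), h5, h6, c, fun p => ?_⟩
    rw [← h7 p, Fin.sum_univ_three, PseudoRiemannianMetric.hyperStarScalarCurvature]
    simp
  · intro hJ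
    obtain ⟨M, i1, i2, i3, g, 𝒥, P, h1, h2, h3, h4, h5, h6, c, h7⟩ :=
      exists_realization (hV.trans hE.symm) hm' hA (σ := ![1, -1, -1])
        (fun a => by fin_cases a <;> simp) rfl (isHyperStructure_paraHermitian_iff.2 hJ)
    refine ⟨M, i1, i2, i3, g, 𝒥, P, h1, h2, h3,
      fun p => isHyperStructure_paraHermitian_iff.1 (h4 p), h5, h6, c, fun p => ?_⟩
    rw [← h7 p, Fin.sum_univ_three, PseudoRiemannianMetric.hyperParaStarScalarCurvature]
    simp [paraStarScalarCurv, starScalarCurv]
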